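/- Let $\mathfrak a$ be the space of trace-zero real diagonal $3\times 3$ matrices, $A=\exp(\mathfrak a)\subset SL_3(\mathbb R)$, $N$ the group of upper triangular unipotent matrices, $K=SO(3)$ with Haar probability measure $dk$, and $M$ the centraliser of $\mathfrak a$ in $K$. Let $\|\cdot\|$ be the Euclidean norm on $M_3(\mathbb R)=\mathbb R^9$, its restrictions to $\mathfrak{sl}_3(\mathbb R)$ and to $\mathfrak a$, and the dual norm on the real dual $\mathfrak a^*$; let $B_{\mathfrak a}$ be the unit ball of $\mathfrak a$, let $dH$ be the Euclidean measure on $\mathfrak a$, and let $d$ be the left-invariant Riemannian distance on $SL_3(\mathbb R)$ associated to $\|\cdot\|$. For $g\in SL_3(\mathbb R)$ let $A(g)\in\mathfrak a$ be defined by the Iwasawa decomposition $g\in N\exp(A(g))K$. Let $\rho\in\mathfrak a^*$ be half the sum of the positive roots (those occurring in the Lie algebra of $N$), and for $\mu\in\mathfrak a^*$ let $\varphi_\mu(g)=\int_K e^{(\rho+i\mu)(A(kg))}\,dk$ be the spherical function. Call $\mu\in\mathfrak a^*$ regular if it is not orthogonal to any root. For $b_1,b_2\in C_0^\infty(\mathfrak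 a)$, $t\ge 1$, $\lambda_1,\lambda_2,\nu\in\mathfrak a^*$ and $g\in SL_3(\mathbb R)$ put $$I=\iint_{\mathfrak a\times\mathfrak a} b_1(H_1)\,b_2(H_2)\,e^{it(\lambda_1(H_1)-\lambda_2(H_2))}\,\varphi_{t\nu}\bigl(\exp(-H_1)\,g\,\exp(H_2)\bigr)\,dH_1\,dH_2 .$$ Let $B^*$ be a compact set of regular elements of $\mathfrak a^*$. Suppose that $\operatorname{supp}(b_i)\subseteq B_{\mathfrak a}$, that $t\ge 1$ and $1\le\beta\le t^{1/2}$, that $\nu,\lambda_1,\lambda_2\in B^*$ satisfy $\|\lambda_i-\nu\|\le\beta/t$ for $i=1,2$, and that $d(g,e)\le 1$. Then: (1) for every $\epsilon>0$, $\;|I|\le C\,t^{-3/2+\epsilon}\beta^{3/2}$; (2) for every $\epsilon>0$ and $A>0$, if moreover $d(g,MA)\ge t^{-1/2+\epsilon}\beta^{1/2}$, then $|I|\le C\,t^{-A}$. Here $C$ depends only on $B^*$, on $\epsilon$ (and on $A$ in (2)), and on an upper bound for the derivatives of $b_1$ and $b_2$ of order at most $n$, where $n$ depends only on $\epsilon$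 (and on $A$ in (2)). -/

import Mathlib

open Set MeasureTheory
open scoped ENNReal ContDiff Matrix

noncomputable section

namespace FlatSL3

/-- The group `SL₃(ℝ)`. -/
abbrev G : Type := Matrix.SpecialLinearGroup (Fin 3) ℝ

/-- The Lie algebra `𝔞` of trace-zero real diagonal matrices, a matrix being written as the vector
of its diagonal entries. The Euclidean norm of that vector is the Frobenius norm of the matrix,
see `norm_diagonal`. The measure `dH` is the Euclidean (Lebesgue) measure `volume`. -/
def frakA : Submodule ℝ (EuclideanSpace ℝ (Fin 3)) where
  carrier := {H | ∑ i, H i = 0}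
  add_mem' := by
    intro x y hx hy
    simp only [Set.mem_ofPred_eq, PiLp.add_apply, Finset.sum_add_distrib] at *
    rw [hx, hy, add_zero]
  zero_mem' := by simp
  smul_mem' := by
    intro c x hx
    simp only [Set.mem_ofPred_eq, PiLp.smul_apply, smul_eq_mul, ← Finset.mul_sum] at *
    rw [hx, mul_zero]

/-- The diagonal matrix that an element of `𝔞` stands for. -/
def toMat (H : frakA) : Matrix (Fin 3) (Fin 3) ℝ := Matrix.diagonal fun i => H.1 i

/-- The real dual `𝔞^*`, with the norm dual to the norm of `𝔞`. -/
abbrev frakADual : Type := StrongDual ℝ frakA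

/-- The exponential map `𝔞 → A ⊆ SL₃(ℝ)`, see `coe_expA`. -/
def expA (H : frakA) : G :=
  ⟨Matrix.diagonal fun i => Real.exp (H.1 i), by
    rw [Matrix.det_diagonal, ← Real.exp_sum, show ∑ i, H.1 i = 0 from H.2, Real.exp_zero]⟩

/-- The subgroup `A` of diagonal matrices with positive entries, as the image of `𝔞`. -/
def setA : Set G := range expA

/-- The set `N` of upper triangular unipotent matrices. -/
def setN : Set G := {g | ∀ i j, j ≤ i → g.1 i j = if i = j then 1 else 0}

/-- The group `K = SO(3)`. -/
def K : Subgroup G where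
  carrier := {g | g.1 * g.1ᵀ = 1}
  mul_mem' := by
    intro a b ha hb
    simp only [Set.mem_ofPred_eq, Matrix.SpecialLinearGroup.coe_mul, Matrix.transpose_mul] at *
    rw [Matrix.mul_assoc, ← Matrix.mul_assoc b.1, hb, Matrix.one_mul, ha]
  one_mem' := by simp
  inv_mem' := by
    intro a ha
    simp only [Set.mem_ofPred_eq] at *
    have h1 : (a⁻¹).1 * a.1 = 1 := by
      rw [← Matrix.SpecialLinearGroup.coe_mul, inv_mul_cancel, Matrix.SpecialLinearGroup.coe_one]
    have h2 : (a⁻¹).1 = a.1ᵀ := by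
      calc (a⁻¹).1 = (a⁻¹).1 * (a.1 * a.1ᵀ) := by rw [ha, Matrix.mul_one]
        _ = a.1ᵀ := by rw [← Matrix.mul_assoc, h1, Matrix.one_mul]
    rw [h2, Matrix.transpose_transpose]
    exact mul_eq_one_comm.mp ha

/-- The centraliser `M` of `𝔞` in `K`. -/
def setM : Set G := {k | k ∈ K ∧ ∀ H : frakA, k.1 * toMat H = toMat H * k.1}

/-! ### The invariant metric -/

section Metric

open scoped Matrix.Norms.Frobenius

theorem norm_diagonal (H : frakA) : ‖toMat H‖ = ‖H‖ := by
  rw [toMat, Matrix.frobenius_norm_diagonal]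
  rfl

theorem coe_expA (H : frakA) : (expA H).1 = NormedSpace.exp (toMat H) := by
  rw [toMat, Matrix.exp_diagonal]
  simp only [expA]
  congr 1
  funext i
  rw [Pi.coe_exp, Real.exp_eq_exp_ℝ]

/-- The left-invariant Riemannian distance on `SL₃(ℝ)` whose norm on the tangent space at the
identity is the restriction of the Euclidean norm of `M₃(ℝ) = ℝ⁹` (the Frobenius norm):
the infimum over the `C¹` paths `γ` from `g` to `h` of `∫₀¹ ‖γ(s)⁻¹ γ'(s)‖ ds`. -/
def leftEDist (g h : G) : ℝ≥0∞ :=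
  ⨅ (γ : ℝ → G) (_ : ContDiffOn ℝ 1 (fun s => (γ s).1) (Icc 0 1)) (_ : γ 0 = g) (_ : γ 1 = h),
    ∫⁻ s in Icc (0 : ℝ) 1, ‖((γ s)⁻¹).1 * derivWithin (fun s => (γ s).1) (Icc 0 1) s‖ₑ

end Metric

/-- The distance from `g` to the subgroup `MA`. -/
def distMA (g : G) : ℝ≥0∞ := ⨅ (m ∈ setM) (a ∈ setA), leftEDist g (m * a)

/-! ### Roots -/

/-- The root `H ↦ H_i - H_j` of `𝔞` in `𝔰𝔩₃(ℝ)` (for `i ≠ j`). -/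
def root (i j : Fin 3) : frakADual :=
  ((EuclideanSpace.proj i : EuclideanSpace ℝ (Fin 3) →L[ℝ] ℝ) - EuclideanSpace.proj j).comp
    frakA.subtypeL

/-- Half the sum of the positive roots, which are the `root i j` with `i < j`. -/
def rho : frakADual := (1 / 2 : ℝ) • (root 0 1 + root 1 2 + root 0 2)

/-- The regular elements of `𝔞^*`: those that are not orthogonal to any root. Here
`(toDual ℝ frakA).symm α` is the element of `𝔞` dual to `α` under the trace form, of which the
Killing form of `𝔰𝔩₃(ℝ)` is a positive multiple. -/
def regular : Set frakADual :=
  {ν | ∀ i j : Fin 3, i ≠ j → ν ((InnerProductSpace.toDual ℝ frakA).symm (root i j)) ≠ 0}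

/-! ### The Iwasawa projection -/

/-- The squared length of the third row of `g`. -/
def minorP (g : G) : ℝ := (g.1 * g.1ᵀ) 2 2

/-- The Gram determinant of the second and third rows of `g`. -/
def minorQ (g : G) : ℝ :=
  (g.1 * g.1ᵀ) 1 1 * (g.1 * g.1ᵀ) 2 2 - (g.1 * g.1ᵀ) 1 2 * (g.1 * g.1ᵀ) 2 1

/-- The Iwasawa projection `A : SL₃(ℝ) → 𝔞`: for `g = n exp(H) k` with `n ∈ N`, `H ∈ 𝔞` and
`k ∈ K`, it is `A(g) = H`. The formula in terms of `g` is justified by `exists_iwasawa` and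
`iwasawaA_eq`. -/
def iwasawaA (g : G) : frakA :=
  ⟨!₂[-Real.log (minorQ g) / 2, (Real.log (minorQ g) - Real.log (minorP g)) / 2,
      Real.log (minorP g) / 2], by
    change ∑ i, _ = _
    simp [Fin.sum_univ_three]; ring⟩

theorem gram_eq (n : G) {k : G} (hk : k ∈ K) (H : frakA) (i j : Fin 3) :
    ((n * expA H * k).1 * (n * expA H * k).1ᵀ) i j =
      n.1 i 0 * Real.exp (H.1 0) ^ 2 * n.1 j 0 + n.1 i 1 * Real.exp (H.1 1) ^ 2 * n.1 j 1 +
        n.1 i 2 * Real.exp (H.1 2) ^ 2 * n.1 j 2 := by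
  have hk' : k.1 * k.1ᵀ = 1 := hk
  have h : (n * expA H * k).1 * (n * expA H * k).1ᵀ =
      (n.1 * (expA H).1) * (n.1 * (expA H).1)ᵀ := by
    simp only [Matrix.SpecialLinearGroup.coe_mul]
    rw [Matrix.transpose_mul, Matrix.mul_assoc, ← Matrix.mul_assoc k.1, hk', Matrix.one_mul]
  rw [h]
  simp [expA, Matrix.mul_apply, Fin.sum_univ_three, Matrix.diagonal_apply]
  ring

theorem iwasawaA_eq {n k : G} (hn : n ∈ setN) (H : frakA) (hk : k ∈ K) :
    iwasawaA (n * expA H * k) = H := by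
  have h := gram_eq n hk H
  have e1 := hn 1 0 (by decide)
  have e2 := hn 1 1 (by decide)
  have e3 := hn 2 0 (by decide)
  have e4 := hn 2 1 (by decide)
  have e5 := hn 2 2 (by decide)
  simp only [Fin.reduceEq, if_true, if_false] at e1 e2 e3 e4 e5
  have hP : minorP (n * expA H * k) = Real.exp (2 * H.1 2) := by
    simp only [minorP, h, e3, e4, e5]
    rw [two_mul, Real.exp_add]; ring
  have hQ : minorQ (n * expA H * k) = Real.exp (2 * H.1 1 + 2 * H.1 2) := by
    simp only [minorQ, h, e1, e2, e3, e4, e5]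
    rw [Real.exp_add, two_mul, two_mul, Real.exp_add, Real.exp_add]; ring
  have h0 : H.1 0 + H.1 1 + H.1 2 = 0 := by
    have := H.2
    change ∑ i, H.1 i = 0 at this
    rwa [Fin.sum_univ_three] at this
  apply Subtype.ext
  ext i
  fin_cases i <;> simp [iwasawaA, hP, hQ]
  all_goals linarith

theorem exists_iwasawa (g : G) :
    ∃ n ∈ setN, ∃ k ∈ K, g = n * expA (iwasawaA g) * k := by
  set S := g.1 * g.1ᵀ with hS
  have hdet : S.det = 1 := by rw [hS, Matrix.det_mul, Matrix.det_transpose, g.2, mul_one]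
  have hsym : ∀ i j, S i j = S j i := by
    intro i j
    have : Sᵀ = S := by rw [hS, Matrix.transpose_mul, Matrix.transpose_transpose]
    exact congrFun (congrFun this j) i
  have hpd : S.PosDef := by
    have := Matrix.PosDef.mul_conjTranspose_self g.1
      (Matrix.vecMul_injective_of_isUnit
        ((Matrix.isUnit_iff_isUnit_det _).mpr (by rw [g.2]; exact isUnit_one)))
    rwa [Matrix.conjTranspose_eq_transpose_of_trivial] at this
  have hP : 0 < minorP g := hpd.diag_pos
  have hQ : 0 < minorQ g := by
    have := (hpd.submatrix (e := ![1, 2]) (by decide)).det_pos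
    rwa [Matrix.det_fin_two] at this
  have hPS : minorP g = S 2 2 := rfl
  have hQS : minorQ g = S 1 1 * S 2 2 - S 1 2 * S 2 1 := rfl
  have E2 : Real.exp ((iwasawaA g).1 2) ^ 2 = minorP g := by
    rw [← Real.exp_nat_mul]
    simp only [iwasawaA]
    simp [mul_div_cancel₀, Real.exp_log hP]
  have E1 : Real.exp ((iwasawaA g).1 1) ^ 2 = minorQ g / minorP g := by
    rw [← Real.exp_nat_mul]
    simp only [iwasawaA]
    simp [mul_div_cancel₀, Real.exp_sub, Real.exp_log hP, Real.exp_log hQ]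
  have E0 : Real.exp ((iwasawaA g).1 0) ^ 2 = (minorQ g)⁻¹ := by
    rw [← Real.exp_nat_mul]
    simp only [iwasawaA]
    simp [mul_div_cancel₀, Real.exp_neg, Real.exp_log hQ]
  let n : G := ⟨!![1, (S 0 1 * S 2 2 - S 0 2 * S 1 2) / minorQ g, S 0 2 / minorP g;
    0, 1, S 1 2 / minorP g; 0, 0, 1], by simp [Matrix.det_fin_three]⟩
  have hn : n ∈ setN := by
    intro i j hij
    fin_cases i <;> fin_cases j <;> simp_all [n]
  have key : (n * expA (iwasawaA g)).1 * (n * expA (iwasawaA g)).1ᵀ = S := by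
    have h := gram_eq n (one_mem K) (iwasawaA g)
    rw [mul_one] at h
    have hf : S 2 2 ≠ 0 := hP.ne'
    rw [hQS, ← hsym 1 2] at hQ
    have hq := hQ.ne'
    rw [Matrix.det_fin_three, ← hsym 0 1, ← hsym 0 2, ← hsym 1 2] at hdet
    have s10 := hsym 1 0
    have s20 := hsym 2 0
    have s21 := hsym 2 1
    ext i j
    rw [h, E0, E1, E2]
    simp only [n, hPS, hQS, ← hsym 1 2]
    obtain ⟨a, ha⟩ : ∃ a, S 0 0 = a := ⟨_, rfl⟩
    obtain ⟨b, hb⟩ : ∃ b, S 0 1 = b := ⟨_, rfl⟩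
    obtain ⟨c, hc⟩ : ∃ c, S 0 2 = c := ⟨_, rfl⟩
    obtain ⟨d, hd⟩ : ∃ d, S 1 1 = d := ⟨_, rfl⟩
    obtain ⟨e, he⟩ : ∃ e, S 1 2 = e := ⟨_, rfl⟩
    obtain ⟨f, hf'⟩ : ∃ f, S 2 2 = f := ⟨_, rfl⟩
    rw [hb] at s10
    rw [hc] at s20
    rw [he] at s21
    rw [ha, hb, hc, hd, he, hf'] at hdet
    rw [hd, he, hf', ← sq] at hq
    rw [hf'] at hf
    have hq' : f * d - e ^ 2 ≠ 0 := by rwa [mul_comm]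
    rw [hb, hc, hd, he, hf', ← sq]
    fin_cases i <;> fin_cases j <;> simp [s10, s20, s21, ha, hb, hc, hd, he, hf']
    all_goals try field_simp
    all_goals first | ring1 | linear_combination (-f) * hdet
  refine ⟨n, hn, (n * expA (iwasawaA g))⁻¹ * g, ?_, by rw [mul_inv_cancel_left]⟩
  set m := n * expA (iwasawaA g) with hm
  have hinv : (m⁻¹).1 * m.1 = 1 := by
    rw [← Matrix.SpecialLinearGroup.coe_mul, inv_mul_cancel, Matrix.SpecialLinearGroup.coe_one]
  change (m⁻¹ * g).1 * (m⁻¹ * g).1ᵀ = 1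
  rw [Matrix.SpecialLinearGroup.coe_mul, Matrix.transpose_mul, Matrix.mul_assoc,
    ← Matrix.mul_assoc g.1, ← hS, ← key, Matrix.mul_assoc, ← Matrix.transpose_mul, hinv,
    Matrix.transpose_one, Matrix.mul_one, hinv]

/-! ### Spherical functions -/

instance : MeasurableSpace K := borel K

instance : BorelSpace K := ⟨rfl⟩

instance : CompactSpace K := by
  refine isCompact_iff_compactSpace.mp (?_ : IsCompact (K : Set G))
  have hK : (K : Set G) = Subtype.val ⁻¹'
      {x : Matrix (Fin 3) (Fin 3) ℝ | x * xᵀ = 1} := rfl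
  rw [hK]
  apply Matrix.SpecialLinearGroup.isClosedEmbedding_val.isCompact_preimage
  have hbox : IsCompact (Set.pi univ fun _ : Fin 3 => Set.pi univ fun _ : Fin 3 =>
      Icc (-1 : ℝ) 1) := isCompact_univ_pi fun _ => isCompact_univ_pi fun _ => isCompact_Icc
  refine hbox.of_isClosed_subset ?_ ?_
  · exact isClosed_eq (by fun_prop) continuous_const
  · intro x hx i _ j _
    have h : ∑ l, x i l * x i l = 1 := by
      have h' := congrFun (congrFun hx i) i
      rw [Matrix.one_apply_eq] at h'
      exact h'
    have h1 : x i j * x i j ≤ ∑ l, x i l * x i l :=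
      Finset.single_le_sum (f := fun l => x i l * x i l)
        (fun l _ => mul_self_nonneg _) (Finset.mem_univ j)
    rw [h] at h1
    exact ⟨by nlinarith, by nlinarith⟩

/-- The Haar probability measure on `K`. -/
def haarK : Measure K := Measure.haarMeasure ⊤

/-- The spherical function `φ_μ(g) = ∫_K exp((ρ + iμ)(A(kg))) dk`, for `μ ∈ 𝔞^*`. -/
def spherical (μ : frakADual) (g : G) : ℂ :=
  ∫ k : K, Complex.exp (((rho (iwasawaA (k.1 * g)) : ℝ) : ℂ) +
    Complex.I * ((μ (iwasawaA (k.1 * g)) : ℝ) : ℂ)) ∂haarK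

/-! ### The oscillatory integral -/

/-- `b ∈ C_0^∞(𝔞)` with support in the unit ball `B_𝔞`, and with all derivatives of order at most
`n` bounded by `D`. -/
structure IsCutoff (n : ℕ) (D : ℝ) (b : frakA → ℂ) : Prop where
  contDiff : ContDiff ℝ ∞ b
  tsupport_subset : tsupport b ⊆ Metric.closedBall 0 1
  deriv_le : ∀ m ≤ n, ∀ H, ‖iteratedFDeriv ℝ m b H‖ ≤ D

/-- The integral
`∬ b₁(H₁) b₂(H₂) e^{it(λ₁(H₁) - λ₂(H₂))} φ_{tν}(exp(-H₁) g exp(H₂)) dH₁ dH₂` over `𝔞 × 𝔞`. -/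
def flatIntegral (b₁ b₂ : frakA → ℂ) (t : ℝ) (l₁ l₂ ν : frakADual) (g : G) : ℂ :=
  ∫ H₁ : frakA, ∫ H₂ : frakA,
    b₁ H₁ * b₂ H₂ * Complex.exp (Complex.I * ((t * (l₁ H₁ - l₂ H₂) : ℝ) : ℂ)) *
      spherical (t • ν) (expA (-H₁) * g * expA H₂)

end FlatSL3

end

/-!
The spherical function is an average of the characters `e^{(ρ+iμ)(A(kg))}` over `k ∈ K`. Since
`A(kg)` depends only on the last two rows of `kg`, the average over `K` can be replaced by a
weighted integral over pairs of vectors `z = (u, v)` in `ℝ³ × ℝ³`, on which `SL₃(ℝ)` acts on the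
right preserving Lebesgue measure (`spherical_formula`). Substituting `z ↦ z exp(H₁)` removes
`exp(-H₁)` from the argument of the spherical function, so that for a fixed pair `z` the integrals
over `H₁` and `H₂` separate: up to a constant, `I` is `∫ J₁(z) J₂(zg) dz`, with two oscillatory
integrals over `𝔞` (`psiMass_mul_flatIntegral`). Both have a phase of the form
`λ(H) - ν(A(z exp H))`.

Let `τ(z)` be comparable to the squared distance of the `K`-component of `z` to `M` (`tauP`). The
gradient of the phase at any `H` in the unit ball is at least a multiple of `τ(z)`, provided that
`‖λ - ν‖` is small compared with `τ(z)`. By Bessel's inequality the third row of an orthogonal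
matrix and its first row cannot concentrate on the same coordinate, and by regularity of `ν` one of
two fixed directions then sees all of `τ(z)` (`exists_direction`). All derivatives of the phase in
this direction are bounded by multiples of `τ(z)` as well, so that integration by parts `n` times
gives the bound `(t τ(z))⁻ⁿ`, uniformly in the compact set of parameters (`exists_osc_bound`).

For the first bound, the pairs with `τ(z) ≤ x` are estimated by their measure `O(x^{3/2})`
(`volume_near_le`), the exponent being half the codimension of the pairs over `M`, and on the others
`J₁` decays; the choice `x = t^{-1+2ε/3} β` balances the two. For the second bound, if `τ(z)` and
`τ(zg)` are both small then both pairs are close to the last rows of upper triangular matrices, so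
that the entries of `g` below the diagonal are small (`lowSq_le`). If these entries are not small,
one of `J₁(z)`, `J₂(zg)` decays for every `z`. If the entries above the diagonal are large instead,
the argument is applied to the transpose of `g`: as `gᵀ ∈ K g K`, the spherical function is
invariant under transposition, and `I` only changes by an exchange of the two variables
(`flatIntegral_trG`). Finally, a nearly diagonal `g` is a product of a lower unipotent, a diagonal
and an upper unipotent matrix, and contracting the unipotent factors shows that the Riemannian
distance of `g` to `MA` is at most a multiple of the size of the off-diagonal entries
(`exists_distMA_le`).
-/

noncomputable section

namespace FlatSL3

/-! ### Non-stationary phase in a fixed direction -/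

/-- All derivatives in the second variable of a smooth function of a parameter and a point
of a normed space are bounded uniformly over a compact set of parameters and over the unit ball. -/
theorem exists_iteratedFDeriv_bound {P E F : Type*} [NormedAddCommGroup P] [NormedSpace ℝ P]
    [NormedAddCommGroup E] [NormedSpace ℝ E] [ProperSpace E]
    [NormedAddCommGroup F] [NormedSpace ℝ F] {U : P × E → F} (hU : ContDiff ℝ ∞ U)
    {S : Set P} (hS : IsCompact S) (n : ℕ) :
    ∃ M : ℝ, 0 ≤ M ∧ ∀ θ ∈ S, ∀ H ∈ Metric.closedBall (0 : E) 1, ∀ j ≤ n,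
      ‖iteratedFDeriv ℝ j (fun H => U (θ, H)) H‖ ≤ M := by
  have hK : IsCompact (S ×ˢ Metric.closedBall (0 : E) 1) :=
    hS.prod (isCompact_closedBall _ _)
  have h1 : ∀ j : ℕ, ∃ M : ℝ, ∀ z ∈ S ×ˢ Metric.closedBall (0 : E) 1,
      ‖iteratedFDeriv ℝ j U z‖ ≤ M := fun j =>
    hK.exists_bound_of_continuousOn (hU.continuous_iteratedFDeriv
      (by exact_mod_cast le_top)).continuousOn
  choose M hM using h1
  refine ⟨∑ j ∈ Finset.range (n + 1), |M j|, Finset.sum_nonneg fun _ _ => abs_nonneg _, ?_⟩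
  intro θ hθ H hH j hj
  have e : (fun H => U (θ, H)) =
      (fun z => U ((θ, 0) + z)) ∘ (ContinuousLinearMap.inr ℝ P E) := by
    funext H; simp
  have hU' : ContDiff ℝ ∞ (fun z => U ((θ, 0) + z)) := hU.comp (by fun_prop)
  rw [e, ContinuousLinearMap.iteratedFDeriv_comp_right _ hU' _ (by exact_mod_cast le_top),
    iteratedFDeriv_comp_add_left]
  refine (ContinuousMultilinearMap.norm_compContinuousLinearMap_le _ _).trans ?_
  have h2 : ∏ _i : Fin j, ‖ContinuousLinearMap.inr ℝ P E‖ ≤ 1 :=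
    Finset.prod_le_one (fun _ _ => norm_nonneg _)
      (fun _ _ => ContinuousLinearMap.norm_inr_le_one ℝ P E)
  have h3 := hM j ((θ, 0) + ContinuousLinearMap.inr ℝ P E H) (by
    simpa using ⟨hθ, by simpa using hH⟩)
  calc _ ≤ ‖iteratedFDeriv ℝ j U ((θ, 0) + ContinuousLinearMap.inr ℝ P E H)‖ * 1 := by
        gcongr
    _ ≤ |M j| := by rw [mul_one]; exact h3.trans (le_abs_self _)
    _ ≤ _ := Finset.single_le_sum (f := fun j => |M j|) (fun _ _ => abs_nonneg _)
        (Finset.mem_range.mpr (by omega))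

/-- A smooth function supported in the unit ball, with all derivatives of order at most `n` bounded
by `D`: the notion `IsCutoff` over an arbitrary normed space. -/
structure IsBump {E : Type*} [NormedAddCommGroup E] [NormedSpace ℝ E] (n : ℕ) (D : ℝ)
    (b : E → ℂ) : Prop where
  contDiff : ContDiff ℝ ∞ b
  tsupport_subset : tsupport b ⊆ Metric.closedBall 0 1
  deriv_le : ∀ m ≤ n, ∀ H, ‖iteratedFDeriv ℝ m b H‖ ≤ D

theorem IsCutoff.isBump {n : ℕ} {D : ℝ} {b : frakA → ℂ} (h : IsCutoff n D b) : IsBump n D b :=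
  ⟨h.contDiff, h.tsupport_subset, h.deriv_le⟩

section Bump

variable {E : Type*} [NormedAddCommGroup E] [NormedSpace ℝ E]

namespace IsBump

variable {n : ℕ} {D : ℝ} {b : E → ℂ}

theorem nonneg (h : IsBump n D b) : 0 ≤ D :=
  (norm_nonneg _).trans (h.deriv_le 0 (Nat.zero_le _) 0)

theorem norm_le (h : IsBump n D b) (H : E) : ‖b H‖ ≤ D := by
  simpa using h.deriv_le 0 (Nat.zero_le _) H

theorem eq_zero (h : IsBump n D b) {H : E} (hH : H ∉ Metric.closedBall (0 : E) 1) :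
    b H = 0 :=
  image_eq_zero_of_notMem_tsupport fun h' => hH (h.tsupport_subset h')

theorem mul (h : IsBump n D b) {u : E → ℂ} (hu : ContDiff ℝ ∞ u) {M : ℝ} (hM : 0 ≤ M)
    (huM : ∀ H ∈ Metric.closedBall (0 : E) 1, ∀ j ≤ n, ‖iteratedFDeriv ℝ j u H‖ ≤ M) :
    IsBump n (2 ^ n * M * D) (fun H => b H * u H) := by
  have hts : tsupport (fun H => b H * u H) ⊆ Metric.closedBall 0 1 :=
    (tsupport_mul_subset_left (f := b) (g := u)).trans h.tsupport_subset
  have hD := h.nonneg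
  refine ⟨h.contDiff.mul hu, hts, fun j hj H => ?_⟩
  by_cases hH : H ∈ Metric.closedBall (0 : E) 1
  · refine (norm_iteratedFDeriv_mul_le h.contDiff hu H
      (by exact_mod_cast le_top : ((j : ℕ) : WithTop ℕ∞) ≤ ((⊤ : ℕ∞) : WithTop ℕ∞))).trans ?_
    calc ∑ i ∈ Finset.range (j + 1), (j.choose i : ℝ) * ‖iteratedFDeriv ℝ i b H‖ *
          ‖iteratedFDeriv ℝ (j - i) u H‖
        ≤ ∑ i ∈ Finset.range (j + 1), (j.choose i : ℝ) * D * M := by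
          refine Finset.sum_le_sum fun i hi => ?_
          have hi' : i ≤ j := by simpa [Nat.lt_succ_iff] using hi
          gcongr
          · exact h.deriv_le i (hi'.trans hj) H
          · exact huM H hH _ (by omega)
      _ = 2 ^ j * M * D := by
          rw [← Finset.sum_mul, ← Finset.sum_mul, ← Nat.cast_sum, Nat.sum_range_choose]
          push_cast; ring
      _ ≤ 2 ^ n * M * D := by
          gcongr
          norm_num
  · have h0 : iteratedFDeriv ℝ j (fun H => b H * u H) H = 0 :=
      image_eq_zero_of_notMem_tsupport fun h' =>
        hH (hts (tsupport_iteratedFDeriv_subset j h'))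
    rw [h0, norm_zero]
    positivity

theorem fderiv_apply (h : IsBump (n + 1) D b) (X : E) :
    IsBump n (‖X‖ * D) (fun H => fderiv ℝ b H X) := by
  have hd : ContDiff ℝ ∞ (fderiv ℝ b) := h.contDiff.fderiv_right (by simp)
  refine ⟨hd.clm_apply contDiff_const, ?_, fun j hj H => ?_⟩
  · exact (closure_mono fun H hH => by
      intro h0; apply hH; simp [h0]).trans ((tsupport_fderiv_subset ℝ).trans h.tsupport_subset)
  · refine (norm_iteratedFDeriv_clm_apply_const (hd.contDiffAt (x := H))
      (by exact_mod_cast le_top : ((j : ℕ) : WithTop ℕ∞) ≤ ((⊤ : ℕ∞) : WithTop ℕ∞))).trans ?_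
    rw [norm_iteratedFDeriv_fderiv]
    gcongr
    exact h.deriv_le _ (by omega) H

end IsBump

theorem norm_integral_le_of_eq_zero_off_closedBall {E : Type*} [NormedAddCommGroup E]
    [ProperSpace E] [MeasurableSpace E]
    [OpensMeasurableSpace E] (μ : Measure E) [IsFiniteMeasureOnCompacts μ] {f : E → ℂ} {D : ℝ}
    (h0 : ∀ H ∉ Metric.closedBall (0 : E) 1, f H = 0)
    (hD : ∀ H ∈ Metric.closedBall (0 : E) 1, ‖f H‖ ≤ D) :
    ‖∫ H, f H ∂μ‖ ≤ D * μ.real (Metric.closedBall 0 1) := by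
  rw [← setIntegral_eq_integral_of_forall_compl_eq_zero h0]
  exact norm_setIntegral_le_of_norm_le_const (isCompact_closedBall _ _).measure_lt_top hD

variable [FiniteDimensional ℝ E] [MeasurableSpace E] [BorelSpace E] (μ : Measure E)
  [μ.IsAddHaarMeasure]

theorem norm_exp_I_mul (x : ℝ) : ‖Complex.exp (Complex.I * (x : ℂ))‖ = 1 := by
  rw [mul_comm, Complex.norm_exp_ofReal_mul_I]

/-- One integration by parts against `e^{itΦ}` in the direction `X`, where `u = τ / ∂_X Φ`. -/
theorem integral_by_parts_phase {F u : E → ℂ} (hF : ContDiff ℝ ∞ F)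
    (hFs : tsupport F ⊆ Metric.closedBall 0 1) (hu : ContDiff ℝ ∞ u) {Φ : E → ℝ}
    (hΦ : ContDiff ℝ ∞ Φ) (X : E) {t τ : ℝ} (ht : 0 < t) (hτ : 0 < τ)
    (h : ∀ H ∈ Metric.closedBall (0 : E) 1, ((fderiv ℝ Φ H X : ℝ) : ℂ) * u H = τ) :
    ‖∫ H, F H * Complex.exp (Complex.I * ((t * Φ H : ℝ) : ℂ)) ∂μ‖ = (t * τ)⁻¹ *
      ‖∫ H, fderiv ℝ (fun H => F H * u H) H X *
        Complex.exp (Complex.I * ((t * Φ H : ℝ) : ℂ)) ∂μ‖ := by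
  set e : E → ℂ := fun H => Complex.exp (Complex.I * ((t * Φ H : ℝ) : ℂ)) with he
  have hec : ContDiff ℝ ∞ e := by
    have : ContDiff ℝ ∞ fun H => ((t * Φ H : ℝ) : ℂ) :=
      Complex.ofRealCLM.contDiff.comp (contDiff_const.mul hΦ)
    exact (contDiff_const.mul this).cexp
  have hed : ∀ H, fderiv ℝ e H X = Complex.I * t * ((fderiv ℝ Φ H X : ℝ) : ℂ) * e H := by
    intro H
    have h1 : HasFDerivAt Φ (fderiv ℝ Φ H) H := (hΦ.differentiable (by simp) H).hasFDerivAt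
    have h2 : HasFDerivAt (fun H => ((t * Φ H : ℝ) : ℂ))
        (Complex.ofRealCLM.comp (t • fderiv ℝ Φ H)) H :=
      Complex.ofRealCLM.hasFDerivAt.comp H (h1.const_mul t)
    have h3 := ((h2.const_mul Complex.I).cexp)
    rw [h3.fderiv]
    simp [he]
    ring
  set f : E → ℂ := fun H => F H * u H with hf
  have hfc : ContDiff ℝ ∞ f := hF.mul hu
  have hcs : HasCompactSupport F :=
    (isCompact_closedBall (0 : E) 1).of_isClosed_subset (isClosed_tsupport _) hFs
  have hfs : HasCompactSupport f := hcs.mul_right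
  have hfd : Continuous fun H => fderiv ℝ f H X :=
    (hfc.continuous_fderiv (by simp)).clm_apply continuous_const
  have hedc : Continuous fun H => fderiv ℝ e H X :=
    (hec.continuous_fderiv (by simp)).clm_apply continuous_const
  have key := integral_mul_fderiv_eq_neg_fderiv_mul_of_integrable (μ := μ)
    (f := f) (g := e) (v := X)
    ((hfd.mul hec.continuous).integrable_of_hasCompactSupport (hfs.fderiv_apply ℝ X).mul_right)
    ((hfc.continuous.mul hedc).integrable_of_hasCompactSupport hfs.mul_right)
    ((hfc.continuous.mul hec.continuous).integrable_of_hasCompactSupport hfs.mul_right)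
    (fun x _ => hfc.differentiable (by simp) x) (fun x _ => hec.differentiable (by simp) x)
  have h1 : ∫ H, f H * fderiv ℝ e H X ∂μ = (Complex.I * t * τ) * ∫ H, F H * e H ∂μ := by
    rw [← integral_const_mul]
    congr 1
    funext H
    by_cases hH : H ∈ Metric.closedBall (0 : E) 1
    · rw [hed, hf, ← h H hH]; ring
    · have : F H = 0 := image_eq_zero_of_notMem_tsupport fun h' => hH (hFs h')
      simp [hf, this]
  have h2 : ‖∫ H, fderiv ℝ f H X * e H ∂μ‖ = t * τ * ‖∫ H, F H * e H ∂μ‖ := by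
    rw [← norm_neg, ← key, h1]
    simp [abs_of_pos ht, abs_of_pos hτ]
  rw [h2, inv_mul_cancel_left₀ (by positivity)]

/-- Repeated integration by parts: every step gains a factor `(tτ)⁻¹`. -/
theorem nonstationary_phase {u : E → ℂ} (hu : ContDiff ℝ ∞ u) {N : ℕ} {M : ℝ} (hM : 0 ≤ M)
    (huM : ∀ H ∈ Metric.closedBall (0 : E) 1, ∀ j ≤ N, ‖iteratedFDeriv ℝ j u H‖ ≤ M)
    {Φ : E → ℝ} (hΦ : ContDiff ℝ ∞ Φ) (X : E) {t τ : ℝ} (ht : 0 < t) (hτ : 0 < τ)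
    (h : ∀ H ∈ Metric.closedBall (0 : E) 1, ((fderiv ℝ Φ H X : ℝ) : ℂ) * u H = τ)
    (n : ℕ) (hn : n ≤ N) {D : ℝ} {F : E → ℂ} (hF : IsBump n D F) :
    ‖∫ H, F H * Complex.exp (Complex.I * ((t * Φ H : ℝ) : ℂ)) ∂μ‖ ≤
      (‖X‖ * (2 ^ N * M)) ^ n * D * μ.real (Metric.closedBall 0 1) * (t * τ)⁻¹ ^ n := by
  induction n generalizing D F with
  | zero =>
    simp only [pow_zero, one_mul, mul_one]
    refine norm_integral_le_of_eq_zero_off_closedBall μ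
      (fun H hH => by rw [hF.eq_zero hH, zero_mul]) fun H _ => ?_
    rw [norm_mul, norm_exp_I_mul, mul_one]
    exact hF.norm_le H
  | succ n ih =>
    rw [integral_by_parts_phase μ hF.contDiff hF.tsupport_subset hu hΦ X ht hτ h]
    have h1 := (hF.mul hu hM fun H hH j hj => huM H hH j (hj.trans hn)).fderiv_apply X
    have h2 := ih (by omega) h1
    have hD := hF.nonneg
    have hpow : (2 : ℝ) ^ (n + 1) ≤ 2 ^ N := pow_le_pow_right₀ (by norm_num) hn
    calc _ ≤ (t * τ)⁻¹ * ((‖X‖ * (2 ^ N * M)) ^ n * (‖X‖ * (2 ^ (n + 1) * M * D)) *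
          μ.real (Metric.closedBall 0 1) * (t * τ)⁻¹ ^ n) := by gcongr
      _ ≤ (t * τ)⁻¹ * ((‖X‖ * (2 ^ N * M)) ^ n * (‖X‖ * (2 ^ N * M * D)) *
          μ.real (Metric.closedBall 0 1) * (t * τ)⁻¹ ^ n) := by
          gcongr
      _ = _ := by ring

end Bump

/-! ### Coordinates on `𝔞` -/

/-- The coroot `diag(1, -1, 0)`. -/
def h12 : frakA := ⟨!₂[1, -1, 0], by change ∑ i, _ = _; simp [Fin.sum_univ_three]⟩

/-- The coroot `diag(0, 1, -1)`. -/
def h23 : frakA := ⟨!₂[0, 1, -1], by change ∑ i, _ = _; simp [Fin.sum_univ_three]⟩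

/-- The `i`-th diagonal entry, as a continuous linear functional on `𝔞`. -/
def coord (i : Fin 3) : frakA →L[ℝ] ℝ :=
  (EuclideanSpace.proj i : EuclideanSpace ℝ (Fin 3) →L[ℝ] ℝ).comp frakA.subtypeL

@[simp] theorem coord_apply (i : Fin 3) (H : frakA) : coord i H = H.1 i := rfl

theorem abs_coord_le (H : frakA) (i : Fin 3) : |H.1 i| ≤ ‖H‖ :=
  PiLp.norm_apply_le (p := 2) H.1 i

/-- The element of `𝔞` that the Iwasawa projection attaches to the values `p` and `q` of the two
Gram minors. -/
def iwa (p q : ℝ) : frakA := (-(Real.log q / 2)) • h12 + (-(Real.log p / 2)) • h23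

theorem iwasawaA_eq_iwa (g : G) : iwasawaA g = iwa (minorP g) (minorQ g) := by
  apply Subtype.ext
  ext i
  fin_cases i <;> simp [iwasawaA, iwa, h12, h23]
  all_goals ring

theorem apply_iwa (ν : frakADual) (p q : ℝ) :
    ν (iwa p q) = -(ν h12 / 2 * Real.log q) - ν h23 / 2 * Real.log p := by
  simp [iwa]; ring

theorem rho_h12 : rho h12 = 1 := by
  simp [rho, root, h12]; norm_num

theorem rho_h23 : rho h23 = 1 := by
  simp [rho, root, h23]; norm_num

theorem toDual_symm_root (i j : Fin 3) (X : frakA)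
    (hX : ∀ H : frakA, ∑ k, X.1 k * H.1 k = H.1 i - H.1 j) :
    (InnerProductSpace.toDual ℝ frakA).symm (root i j) = X := by
  rw [LinearIsometryEquiv.symm_apply_eq]
  ext H
  rw [InnerProductSpace.toDual_apply_apply]
  simp only [root]
  change H.1 i - H.1 j = inner ℝ X.1 H.1
  rw [← hX H, PiLp.inner_apply]
  simp [mul_comm]

theorem coroots_ne_zero_of_regular {ν : frakADual} (hν : ν ∈ regular) :
    ν h12 ≠ 0 ∧ ν h23 ≠ 0 ∧ ν h12 + ν h23 ≠ 0 := by
  have e1 := toDual_symm_root 0 1 h12 fun H => by simp [Fin.sum_univ_three, h12]; ring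
  have e2 := toDual_symm_root 1 2 h23 fun H => by simp [Fin.sum_univ_three, h23]; ring
  have e3 := toDual_symm_root 0 2 (h12 + h23) fun H => by
    simp [Fin.sum_univ_three, h12, h23]; ring
  refine ⟨?_, ?_, ?_⟩
  · rw [← e1]; exact hν 0 1 (by decide)
  · rw [← e2]; exact hν 1 2 (by decide)
  · rw [← map_add, ← e3]; exact hν 0 2 (by decide)

/-- On a compact set of regular functionals the values at the coroots are bounded, and bounded away
from zero. -/
theorem exists_coroot_bounds {B : Set frakADual} (hB : IsCompact B) (hBr : B ⊆ regular) :
    ∃ κ M : ℝ, 0 < κ ∧ κ ≤ M ∧ ∀ ν ∈ B, κ ≤ |ν h12| ∧ κ ≤ |ν h23| ∧ κ ≤ |ν h12 + ν h23| ∧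
      |ν h12| ≤ M ∧ |ν h23| ≤ M := by
  have lower : ∀ X : frakA, (∀ ν ∈ B, ν X ≠ 0) → ∃ κ : ℝ, 0 < κ ∧ ∀ ν ∈ B, κ ≤ |ν X| := by
    intro X hX
    exact hB.exists_forall_le' (f := fun ν : frakADual => |ν X|) (a := 0)
      (by fun_prop) fun ν hν => abs_pos.mpr (hX ν hν)
  obtain ⟨κ₁, h₁, h₁'⟩ := lower h12 fun ν hν => (coroots_ne_zero_of_regular (hBr hν)).1
  obtain ⟨κ₂, h₂, h₂'⟩ := lower h23 fun ν hν => (coroots_ne_zero_of_regular (hBr hν)).2.1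
  obtain ⟨κ₃, h₃, h₃'⟩ := lower (h12 + h23) fun ν hν => by
    rw [map_add]; exact (coroots_ne_zero_of_regular (hBr hν)).2.2
  obtain ⟨M, hM⟩ := hB.exists_bound_of_continuousOn (f := fun ν => ν) continuousOn_id
  have hk : 0 < min κ₁ (min κ₂ κ₃) := lt_min h₁ (lt_min h₂ h₃)
  refine ⟨min κ₁ (min κ₂ κ₃),
    max (min κ₁ (min κ₂ κ₃)) (max (M * ‖h12‖) (M * ‖h23‖)), hk, le_max_left _ _, fun ν hν => ?_⟩
  refine ⟨(min_le_left _ _).trans (h₁' ν hν),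
    ((min_le_right _ _).trans (min_le_left _ _)).trans (h₂' ν hν), ?_, ?_, ?_⟩
  · rw [← map_add]
    exact ((min_le_right _ _).trans (min_le_right _ _)).trans (h₃' ν hν)
  · refine le_max_of_le_right (le_max_of_le_left ?_)
    exact (ν.le_opNorm h12).trans (by gcongr; exact hM ν hν)
  · refine le_max_of_le_right (le_max_of_le_right ?_)
    exact (ν.le_opNorm h23).trans (by gcongr; exact hM ν hν)

/-- The direction `diag(2, -1, -1) / 3`. Along it the derivative of `ν(A(g exp H))` differs from
`ν dirX` only by terms that vanish for `g ∈ M`; the same holds for `dirY`. -/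
def dirX : frakA := (2 / 3 : ℝ) • h12 + (1 / 3 : ℝ) • h23

/-- The direction `diag(-1, 2, -1) / 3`. -/
def dirY : frakA := (-1 / 3 : ℝ) • h12 + (1 / 3 : ℝ) • h23

/-! ### The phase function -/

/-- The sum `∑ mᵢ exp(2 Hᵢ)`. -/
def wSum (m : Fin 3 → ℝ) (H : frakA) : ℝ := ∑ i, m i * Real.exp (2 * coord i H)

theorem wSum_eq (m : Fin 3 → ℝ) (H : frakA) : wSum m H =
    m 0 * Real.exp (2 * H.1 0) + m 1 * Real.exp (2 * H.1 1) + m 2 * Real.exp (2 * H.1 2) := by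
  simp [wSum, Fin.sum_univ_three]

/-- The squared Euclidean length of `s`. -/
def sqSum (s : Fin 3 → ℝ) : ℝ := s 0 ^ 2 + s 1 ^ 2 + s 2 ^ 2

/-- The squared length of `s exp(H)`, corrected by a term that vanishes for unit vectors `s` so as
to be positive for all `s`. -/
def posSum (s : Fin 3 → ℝ) (H : frakA) : ℝ := wSum (s ^ 2) H + (1 - sqSum s) ^ 2

theorem posSum_of_unit {s : Fin 3 → ℝ} (hs : sqSum s = 1) (H : frakA) :
    posSum s H = wSum (s ^ 2) H := by simp [posSum, hs]

theorem wSum_nonneg {m : Fin 3 → ℝ} (hm : ∀ i, 0 ≤ m i) (H : frakA) : 0 ≤ wSum m H :=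
  Finset.sum_nonneg fun i _ => mul_nonneg (hm i) (Real.exp_pos _).le

theorem wSum_pos {s : Fin 3 → ℝ} (hs : 0 < sqSum s) (H : frakA) : 0 < wSum (s ^ 2) H := by
  refine lt_of_le_of_ne (wSum_nonneg (fun i => sq_nonneg _) H) fun h0 => hs.ne' ?_
  have h1 := (Finset.sum_eq_zero_iff_of_nonneg (s := Finset.univ)
    (f := fun i => (s ^ 2) i * Real.exp (2 * coord i H))
    fun i _ => mul_nonneg (sq_nonneg _) (Real.exp_pos _).le).mp h0.symm
  have h2 : ∀ i, s i ^ 2 = 0 := fun i => by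
    have := h1 i (Finset.mem_univ i)
    simpa [(Real.exp_pos _).ne'] using this
  simp [sqSum, h2]

theorem posSum_pos (s : Fin 3 → ℝ) (H : frakA) : 0 < posSum s H := by
  have h0 : 0 ≤ sqSum s := by unfold sqSum; positivity
  rcases h0.eq_or_lt with h | h
  · have := wSum_nonneg (m := s ^ 2) (fun i => sq_nonneg _) H
    simp only [posSum, ← h]; linarith
  · exact add_pos_of_pos_of_nonneg (wSum_pos h H) (sq_nonneg _)

theorem contDiff_wSum {E : Type*} [NormedAddCommGroup E] [NormedSpace ℝ E]
    {m : E → Fin 3 → ℝ} {H : E → frakA} (hm : ContDiff ℝ ∞ m) (hH : ContDiff ℝ ∞ H) :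
    ContDiff ℝ ∞ fun x => wSum (m x) (H x) := by
  refine ContDiff.sum fun i _ => ?_
  have h1 : ContDiff ℝ ∞ fun x => m x i := (contDiff_apply ℝ ℝ i).comp hm
  have h2 : ContDiff ℝ ∞ fun x => coord i (H x) := (coord i).contDiff.comp hH
  exact h1.mul (contDiff_const.mul h2).exp

theorem contDiff_posSum {E : Type*} [NormedAddCommGroup E] [NormedSpace ℝ E]
    {s : E → Fin 3 → ℝ} {H : E → frakA} (hs : ContDiff ℝ ∞ s) (hH : ContDiff ℝ ∞ H) :
    ContDiff ℝ ∞ fun x => posSum (s x) (H x) := by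
  have h1 : ∀ i, ContDiff ℝ ∞ fun x => s x i := fun i => (contDiff_apply ℝ ℝ i).comp hs
  exact (contDiff_wSum (hs.pow 2) hH).add
    ((contDiff_const.sub ((((h1 0).pow 2).add ((h1 1).pow 2)).add ((h1 2).pow 2))).pow 2)

theorem hasFDerivAt_wSum (m : Fin 3 → ℝ) (H : frakA) : HasFDerivAt (wSum m)
    (∑ i, (m i * (Real.exp (2 * coord i H) * 2)) • coord i) H := by
  have h : ∀ i, HasFDerivAt (fun H : frakA => m i * Real.exp (2 * coord i H))
      ((m i * (Real.exp (2 * coord i H) * 2)) • coord i) H := by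
    intro i
    have := ((((coord i).hasFDerivAt (x := H)).const_mul 2).exp).const_mul (m i)
    rwa [show m i • Real.exp (2 * coord i H) • (2 : ℝ) • coord i =
      (m i * (Real.exp (2 * coord i H) * 2)) • coord i by simp only [smul_smul]] at this
  exact HasFDerivAt.fun_sum fun i _ => h i

/-- The phase `λ(H) - ν(A(g exp H) - A(g))`, where `s` and `r` are the normalised third row of `g`
and the normalised cross product of its second and third rows. -/
def phase (l ν : frakADual) (s r : Fin 3 → ℝ) (H : frakA) : ℝ :=
  l H - ν (iwa (wSum (s ^ 2) H) (wSum (r ^ 2) (-H)))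

theorem contDiff_phase (l ν : frakADual) {s r : Fin 3 → ℝ} (hs : sqSum s = 1)
    (hr : sqSum r = 1) : ContDiff ℝ ∞ (phase l ν s r) := by
  have h1 : ContDiff ℝ ∞ fun H => Real.log (wSum (s ^ 2) H) :=
    (contDiff_wSum contDiff_const contDiff_id).log fun H => (wSum_pos (by rw [hs]; norm_num) H).ne'
  have h2 : ContDiff ℝ ∞ fun H : frakA => Real.log (wSum (r ^ 2) (-H)) :=
    (contDiff_wSum contDiff_const contDiff_neg).log
      fun H => (wSum_pos (by rw [hr]; norm_num) (-H)).ne'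
  unfold phase
  simp only [apply_iwa]
  exact l.contDiff.sub ((contDiff_const.mul h2).neg.sub (contDiff_const.mul h1))

theorem fderiv_phase (l ν : frakADual) {s r : Fin 3 → ℝ} (hs : sqSum s = 1)
    (hr : sqSum r = 1) (H X : frakA) : fderiv ℝ (phase l ν s r) H X =
      l X - ν h12 * (wSum (fun i => r i ^ 2 * X.1 i) (-H) / wSum (r ^ 2) (-H)) +
        ν h23 * (wSum (fun i => s i ^ 2 * X.1 i) H / wSum (s ^ 2) H) := by
  have hP := (wSum_pos (s := s) (by rw [hs]; norm_num) H).ne'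
  have hQ := (wSum_pos (s := r) (by rw [hr]; norm_num) (-H)).ne'
  have h1 := (hasFDerivAt_wSum (s ^ 2) H).log hP
  have hn : HasFDerivAt (fun H : frakA => -H) (-(ContinuousLinearMap.id ℝ frakA)) H :=
    (hasFDerivAt_id H).neg
  have h2 := ((hasFDerivAt_wSum (r ^ 2) (-H)).comp H hn).log hQ
  have hl : HasFDerivAt (fun H => l H) l H := l.hasFDerivAt
  have h3 := (hl.sub
    ((h2.const_mul (ν h12 / 2)).neg.sub (h1.const_mul (ν h23 / 2))))
  have h4 := h3.congr_of_eventuallyEq (f₁ := phase l ν s r)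
    (Filter.Eventually.of_forall fun H => by simp only [phase, apply_iwa]; rfl)
  rw [h4.fderiv]
  simp [wSum, Fin.sum_univ_three] at hP hQ ⊢
  field_simp
  ring

/-! ### Lower bound for the gradient of the phase -/

/-- The `i`-th coordinate of the probability vector of the squared entries of `s exp(H)`. -/
def pr (s : Fin 3 → ℝ) (H : frakA) (i : Fin 3) : ℝ :=
  s i ^ 2 * Real.exp (2 * H.1 i) / wSum (s ^ 2) H

theorem pr_nonneg (s : Fin 3 → ℝ) (H : frakA) (i : Fin 3) : 0 ≤ pr s H i :=
  div_nonneg (mul_nonneg (sq_nonneg _) (Real.exp_pos _).le)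
    (wSum_nonneg (fun _ => sq_nonneg _) H)

theorem pr_sum {s : Fin 3 → ℝ} (hs : sqSum s = 1) (H : frakA) :
    pr s H 0 + pr s H 1 + pr s H 2 = 1 := by
  have h := (wSum_pos (s := s) (by rw [hs]; norm_num) H).ne'
  simp only [pr, ← add_div]
  rw [div_eq_one_iff_eq h, wSum_eq]
  rfl

/-- Bessel's inequality for the orthogonal vectors `s exp(H)` and `r exp(-H)`. -/
theorem pr_add_pr_le_one {s r : Fin 3 → ℝ} (hs : sqSum s = 1) (hr : sqSum r = 1)
    (hsr : s ⬝ᵥ r = 0) (H : frakA) (i : Fin 3) : pr s H i + pr r (-H) i ≤ 1 := by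
  have hP := wSum_pos (s := s) (by rw [hs]; norm_num) H
  have hQ := wSum_pos (s := r) (by rw [hr]; norm_num) (-H)
  have e : ∀ j, Real.exp (2 * H.1 j) = Real.exp (H.1 j) ^ 2 := fun j => by
    rw [← Real.exp_nat_mul]; norm_num
  have e' : ∀ j, Real.exp (2 * (-H).1 j) = Real.exp (-H.1 j) ^ 2 := fun j => by
    rw [← Real.exp_nat_mul]; norm_num
  have ee : ∀ j, Real.exp (H.1 j) * Real.exp (-H.1 j) = 1 := fun j => by
    rw [← Real.exp_add, add_neg_cancel, Real.exp_zero]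
  obtain ⟨a, ha⟩ : ∃ a : Fin 3 → ℝ, a = fun j => s j * Real.exp (H.1 j) := ⟨_, rfl⟩
  obtain ⟨b, hb⟩ : ∃ b : Fin 3 → ℝ, b = fun j => r j * Real.exp (-H.1 j) := ⟨_, rfl⟩
  have hab : a 0 * b 0 + a 1 * b 1 + a 2 * b 2 = 0 := by
    rw [← hsr]
    simp only [ha, hb, dotProduct, Fin.sum_univ_three]
    linear_combination s 0 * r 0 * ee 0 + s 1 * r 1 * ee 1 + s 2 * r 2 * ee 2
  have eP : wSum (s ^ 2) H = a 0 ^ 2 + a 1 ^ 2 + a 2 ^ 2 := by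
    rw [wSum_eq]; simp only [ha, e, Pi.pow_apply, mul_pow]
  have eQ : wSum (r ^ 2) (-H) = b 0 ^ 2 + b 1 ^ 2 + b 2 ^ 2 := by
    rw [wSum_eq]; simp only [hb, e', Pi.pow_apply, mul_pow]
  have ea : s i ^ 2 * Real.exp (2 * H.1 i) = a i ^ 2 := by simp only [ha, e, mul_pow]
  have eb : r i ^ 2 * Real.exp (2 * (-H).1 i) = b i ^ 2 := by simp only [hb, e', mul_pow]
  rw [pr, pr, ea, eb, div_add_div _ _ hP.ne' hQ.ne', div_le_one (mul_pos hP hQ), eP, eQ]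
  -- Lagrange's identity for the two coordinates other than the `i`-th
  fin_cases i
  · have : a 0 * b 0 = -(a 1 * b 1 + a 2 * b 2) := by linarith
    have h2 : a 0 ^ 2 * b 0 ^ 2 = (a 1 * b 1 + a 2 * b 2) ^ 2 := by rw [← mul_pow, this]; ring
    simp only [Fin.zero_eta]
    nlinarith [sq_nonneg (a 1 * b 2 - a 2 * b 1)]
  · have : a 1 * b 1 = -(a 0 * b 0 + a 2 * b 2) := by linarith
    have h2 : a 1 ^ 2 * b 1 ^ 2 = (a 0 * b 0 + a 2 * b 2) ^ 2 := by rw [← mul_pow, this]; ring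
    simp only [Fin.mk_one]
    nlinarith [sq_nonneg (a 0 * b 2 - a 2 * b 0)]
  · have : a 2 * b 2 = -(a 0 * b 0 + a 1 * b 1) := by linarith
    have h2 : a 2 ^ 2 * b 2 ^ 2 = (a 0 * b 0 + a 1 * b 1) ^ 2 := by rw [← mul_pow, this]; ring
    simp only [Fin.reduceFinMk]
    nlinarith [sq_nonneg (a 0 * b 1 - a 1 * b 0)]

theorem exp_coord_bounds {H : frakA} (hH : ‖H‖ ≤ 1) (i : Fin 3) :
    Real.exp (-2) ≤ Real.exp (2 * H.1 i) ∧ Real.exp (2 * H.1 i) ≤ Real.exp 2 := by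
  have h := abs_le.mp ((abs_coord_le H i).trans hH)
  constructor <;> apply Real.exp_le_exp.mpr <;> linarith [h.1, h.2]

theorem wSum_bounds {m : Fin 3 → ℝ} (hm : ∀ i, 0 ≤ m i) {H : frakA} (hH : ‖H‖ ≤ 1) :
    Real.exp (-2) * (m 0 + m 1 + m 2) ≤ wSum m H ∧
      wSum m H ≤ Real.exp 2 * (m 0 + m 1 + m 2) := by
  rw [wSum_eq]
  have h := fun i => exp_coord_bounds hH i
  have h1 := fun i => mul_le_mul_of_nonneg_left (h i).1 (hm i)
  have h2 := fun i => mul_le_mul_of_nonneg_left (h i).2 (hm i)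
  constructor
  · linarith [h1 0, h1 1, h1 2]
  · linarith [h2 0, h2 1, h2 2]

theorem pr_bounds {s : Fin 3 → ℝ} (hs : sqSum s = 1) {H : frakA} (hH : ‖H‖ ≤ 1) (i : Fin 3) :
    s i ^ 2 ≤ Real.exp 4 * pr s H i ∧ pr s H i ≤ Real.exp 4 * s i ^ 2 := by
  have hP := wSum_pos (s := s) (by rw [hs]; norm_num) H
  have h := wSum_bounds (m := s ^ 2) (fun i => sq_nonneg _) hH
  have h1 : (s ^ 2) 0 + (s ^ 2) 1 + (s ^ 2) 2 = 1 := hs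
  rw [h1, mul_one, mul_one] at h
  have e4 : Real.exp 4 = Real.exp 2 * Real.exp 2 := by rw [← Real.exp_add]; norm_num
  have e0 : Real.exp 2 * Real.exp (-2) = 1 := by rw [← Real.exp_add]; norm_num
  have hi := exp_coord_bounds hH i
  have hsi := sq_nonneg (s i)
  have p2 := Real.exp_pos 2
  constructor
  · rw [pr, mul_div_assoc', le_div_iff₀ hP, e4]
    calc s i ^ 2 * wSum (s ^ 2) H ≤ s i ^ 2 * Real.exp 2 := by gcongr; exact h.2
      _ = s i ^ 2 * Real.exp 2 * (Real.exp 2 * Real.exp (-2)) := by rw [e0, mul_one]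
      _ ≤ s i ^ 2 * Real.exp 2 * (Real.exp 2 * Real.exp (2 * H.1 i)) :=
        mul_le_mul_of_nonneg_left (mul_le_mul_of_nonneg_left hi.1 p2.le) (by positivity)
      _ = _ := by ring
  · rw [pr, div_le_iff₀ hP, e4]
    calc s i ^ 2 * Real.exp (2 * H.1 i) ≤ s i ^ 2 * Real.exp 2 :=
        mul_le_mul_of_nonneg_left hi.2 hsi
      _ = s i ^ 2 * Real.exp 2 * (Real.exp 2 * Real.exp (-2)) := by rw [e0, mul_one]
      _ ≤ s i ^ 2 * Real.exp 2 * (Real.exp 2 * wSum (s ^ 2) H) := by gcongr; exact h.1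
      _ = _ := by ring

theorem fderiv_phase_dirX (l ν : frakADual) {s r : Fin 3 → ℝ} (hs : sqSum s = 1)
    (hr : sqSum r = 1) (H : frakA) : fderiv ℝ (phase l ν s r) H dirX = (l - ν) dirX +
      (ν h23 * pr s H 0 + ν h12 * (pr r (-H) 1 + pr r (-H) 2)) := by
  have hP := (wSum_pos (s := s) (by rw [hs]; norm_num) H).ne'
  have hQ := (wSum_pos (s := r) (by rw [hr]; norm_num) (-H)).ne'
  have hν : ν dirX = 2 / 3 * ν h12 + 1 / 3 * ν h23 := by simp [dirX]
  rw [fderiv_phase l ν hs hr, show (l - ν) dirX = l dirX - ν dirX from rfl, hν]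
  simp only [pr]
  rw [wSum_eq (fun i => r i ^ 2 * _), wSum_eq (fun i => s i ^ 2 * _)]
  rw [wSum_eq] at hP hQ ⊢
  rw [wSum_eq]
  simp [dirX, h12, h23] at hP hQ ⊢
  field_simp
  ring

theorem fderiv_phase_dirY (l ν : frakADual) {s r : Fin 3 → ℝ} (hs : sqSum s = 1)
    (hr : sqSum r = 1) (H : frakA) : fderiv ℝ (phase l ν s r) H dirY = (l - ν) dirY +
      (ν h23 * pr s H 1 - ν h12 * pr r (-H) 1) := by
  have hP := (wSum_pos (s := s) (by rw [hs]; norm_num) H).ne'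
  have hQ := (wSum_pos (s := r) (by rw [hr]; norm_num) (-H)).ne'
  have hν : ν dirY = -1 / 3 * ν h12 + 1 / 3 * ν h23 := by simp [dirY]
  rw [fderiv_phase l ν hs hr, show (l - ν) dirY = l dirY - ν dirY from rfl, hν]
  simp only [pr]
  rw [wSum_eq (fun i => r i ^ 2 * _), wSum_eq (fun i => s i ^ 2 * _)]
  rw [wSum_eq] at hP hQ ⊢
  rw [wSum_eq]
  simp [dirY, h12, h23] at hP hQ ⊢
  field_simp
  ring

/-- A quantity comparable to the squared distance of the pair of unit vectors `(s, r)` to the pairs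
`(±e₃, ±e₁)`, which correspond to the elements of `M`. -/
def tau (s r : Fin 3 → ℝ) : ℝ := s 0 ^ 2 + s 1 ^ 2 + r 1 ^ 2 + r 2 ^ 2

/-- Four nonnegative numbers `x = (p₀', p₁', q₁', q₂')` that are comparable to the given ones with
the constant `E`, and satisfy `p₀' - q₂' ≤ q₁'` and `q₂' - p₀' ≤ p₁'`. For two probability vectors
`p'`, `q'` these last two are the Bessel inequalities `pᵢ' + qᵢ' ≤ 1` for `i = 0` and `i = 2`. Only
the comparisons that are needed for the gradient bound are included. -/
structure Comparable (E p₀ p₁ q₁ q₂ : ℝ) (x : ℝ × ℝ × ℝ × ℝ) : Prop where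
  le₁ : p₀ ≤ E * x.1
  le₂ : p₁ ≤ E * x.2.1
  le₃ : q₁ ≤ E * x.2.2.1
  le₄ : q₂ ≤ E * x.2.2.2
  ge₂ : x.2.1 ≤ E * p₁
  ge₃ : x.2.2.1 ≤ E * q₁
  nn₁ : 0 ≤ x.1
  nn₂ : 0 ≤ x.2.1
  nn₃ : 0 ≤ x.2.2.1
  nn₄ : 0 ≤ x.2.2.2
  sub_le : x.1 - x.2.2.2 ≤ x.2.2.1
  sub_le' : x.2.2.2 - x.1 ≤ x.2.1

/-- No cancellation occurs between coefficients of the same sign. -/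
theorem lower_same_sign {κ a c : ℝ} (hκ : 0 < κ) (ha : κ ≤ |a|) (hc : κ ≤ |c|) (hs : 0 ≤ a * c)
    {x y : ℝ} (hx : 0 ≤ x) (hy : 0 ≤ y) : κ * (x + y) ≤ |c * x + a * y| := by
  have : |c * x + a * y| = |c| * x + |a| * y := by
    have h : 0 ≤ c * x * (a * y) := by
      have := mul_nonneg hs (mul_nonneg hx hy); linarith
    rw [(abs_add_eq_add_abs_iff _ _).mpr ?_, abs_mul, abs_mul, abs_of_nonneg hx, abs_of_nonneg hy]
    have ha0 : a ≠ 0 := abs_pos.mp (hκ.trans_le ha)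
    have hc0 : c ≠ 0 := abs_pos.mp (hκ.trans_le hc)
    rcases lt_or_gt_of_ne ha0 with h1 | h1 <;> rcases lt_or_gt_of_ne hc0 with h2 | h2
    · exact Or.inr ⟨mul_nonpos_of_nonpos_of_nonneg h2.le hx,
        mul_nonpos_of_nonpos_of_nonneg h1.le hy⟩
    · exact absurd (mul_neg_of_neg_of_pos h1 h2) (not_lt.mpr hs)
    · exact absurd (mul_neg_of_pos_of_neg h1 h2) (not_lt.mpr hs)
    · exact Or.inl ⟨mul_nonneg h2.le hx, mul_nonneg h1.le hy⟩
  rw [this, mul_add]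
  exact add_le_add (mul_le_mul_of_nonneg_right hc hx) (mul_le_mul_of_nonneg_right ha hy)

/-- The lower bound for the second derivative when `p₁` dominates. -/
theorem lower_large_p₁ {κ M E A a c p₀ p₁ q₁ q₂ : ℝ} (hκ : 0 < κ) (hM : 0 < M) (hE : 0 < E)
    (hA : A * κ = 8 * M * E ^ 2) (hA0 : 0 < A) (hc : κ ≤ |c|) (haM : |a| ≤ M) (hp₀ : 0 ≤ p₀)
    (hq₂ : 0 ≤ q₂) (h : A * (p₀ + q₁ + q₂) < p₁) {x : ℝ × ℝ × ℝ × ℝ}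
    (hx : Comparable E p₀ p₁ q₁ q₂ x) :
    κ * p₁ ≤ 4 * (E * |c * x.2.1 - a * x.2.2.1|) := by
  have h1 : κ * x.2.1 - M * x.2.2.1 ≤ |c * x.2.1 - a * x.2.2.1| := by
    have := abs_sub_abs_le_abs_sub (c * x.2.1) (a * x.2.2.1)
    rw [abs_mul, abs_mul, abs_of_nonneg hx.nn₂, abs_of_nonneg hx.nn₃] at this
    linarith [mul_le_mul_of_nonneg_right hc hx.nn₂, mul_le_mul_of_nonneg_right haM hx.nn₃]
  have h2 : 8 * M * E ^ 2 * q₁ ≤ κ * p₁ := by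
    have : κ * (A * q₁) ≤ κ * p₁ := by
      refine mul_le_mul_of_nonneg_left ?_ hκ.le
      linarith [mul_nonneg hA0.le hp₀, mul_nonneg hA0.le hq₂]
    rw [← hA]; linarith
  have h3 : M * (E * x.2.2.1) ≤ M * (E * (E * q₁)) := by
    have := hx.ge₃; gcongr
  have h4 : κ * p₁ ≤ κ * (E * x.2.1) := mul_le_mul_of_nonneg_left hx.le₂ hκ.le
  have h5 := mul_le_mul_of_nonneg_left h1 hE.le
  have h6 : 0 ≤ E * |c * x.2.1 - a * x.2.2.1| := by positivity
  linarith

/-- The lower bound for the first derivative when `p₀ + q₂` dominates: then `p₀` and `q₂` nearly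
agree, and the derivative is about `(a + c) p₀`. -/
theorem lower_large_p₀_q₂ {κ M E A a c p₀ p₁ q₁ q₂ : ℝ} (hκ : 0 < κ) (hM : 0 < M) (hE : 0 < E)
    (hA : A * κ = 8 * M * E ^ 2) (hac : κ ≤ |a + c|) (haM : |a| ≤ M) (hcM : |c| ≤ M)
    (h : A * (p₁ + q₁) < p₀ + q₂) {x : ℝ × ℝ × ℝ × ℝ} (hx : Comparable E p₀ p₁ q₁ q₂ x) :
    κ * (p₀ + q₂) ≤ 4 * (E * |c * x.1 + a * (x.2.2.1 + x.2.2.2)|) := by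
  have z1 := hx.nn₁
  have z2 := hx.nn₂
  have z3 := hx.nn₃
  have z4 := hx.nn₄
  have hd : |x.2.2.2 - x.1| ≤ x.2.1 + x.2.2.1 :=
    abs_le.mpr ⟨by linarith [hx.sub_le], by linarith [hx.sub_le']⟩
  have g1 : κ * x.1 - M * (x.2.1 + 2 * x.2.2.1) ≤ |c * x.1 + a * (x.2.2.1 + x.2.2.2)| := by
    have e : c * x.1 + a * (x.2.2.1 + x.2.2.2) =
      (a + c) * x.1 + a * (x.2.2.2 - x.1 + x.2.2.1) := by ring
    have t1 : |x.2.2.2 - x.1 + x.2.2.1| ≤ x.2.1 + 2 * x.2.2.1 := by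
      refine (abs_add_le _ _).trans ?_
      rw [abs_of_nonneg z3]; linarith
    have t2 := abs_sub_abs_le_abs_add ((a + c) * x.1) (a * (x.2.2.2 - x.1 + x.2.2.1))
    rw [abs_mul, abs_mul, abs_of_nonneg z1] at t2
    rw [e]
    have t3 : |a| * |x.2.2.2 - x.1 + x.2.2.1| ≤ M * (x.2.1 + 2 * x.2.2.1) := by gcongr
    linarith [mul_le_mul_of_nonneg_right hac z1]
  have g2 : κ * x.2.2.2 - M * (x.2.1 + 2 * x.2.2.1) ≤
      |c * x.1 + a * (x.2.2.1 + x.2.2.2)| := by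
    have e : c * x.1 + a * (x.2.2.1 + x.2.2.2) =
      (a + c) * x.2.2.2 + (c * (x.1 - x.2.2.2) + a * x.2.2.1) := by ring
    have t1 : |c * (x.1 - x.2.2.2) + a * x.2.2.1| ≤ M * (x.2.1 + 2 * x.2.2.1) := by
      refine (abs_add_le _ _).trans ?_
      rw [abs_mul, abs_mul, abs_of_nonneg z3, abs_sub_comm]
      linarith [mul_le_mul hcM hd (abs_nonneg _) hM.le, mul_le_mul_of_nonneg_right haM z3]
    have t2 := abs_sub_abs_le_abs_add ((a + c) * x.2.2.2) (c * (x.1 - x.2.2.2) + a * x.2.2.1)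
    rw [abs_mul, abs_of_nonneg z4] at t2
    rw [e]
    linarith [mul_le_mul_of_nonneg_right hac z4]
  have h1 : κ * (p₀ + q₂) ≤ κ * (E * (x.1 + x.2.2.2)) := by
    refine mul_le_mul_of_nonneg_left ?_ hκ.le
    linarith [hx.le₁, hx.le₄]
  have h2 : M * (E * (x.2.1 + 2 * x.2.2.1)) ≤ M * (E * (2 * (E * (p₁ + q₁)))) := by
    refine mul_le_mul_of_nonneg_left (mul_le_mul_of_nonneg_left ?_ hE.le) hM.le
    linarith [hx.ge₂, hx.ge₃]
  have h3 : κ * (A * (p₁ + q₁)) ≤ κ * (p₀ + q₂) := mul_le_mul_of_nonneg_left h.le hκ.le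
  have h4 : κ * (A * (p₁ + q₁)) = 8 * M * E ^ 2 * (p₁ + q₁) := by rw [← hA]; ring
  have h5 := mul_le_mul_of_nonneg_left (add_le_add g1 g2) hE.le
  linarith

/-- One of the two derivatives of the phase is bounded below by a multiple of
`p₀ + p₁ + q₁ + q₂`, uniformly over all perturbations comparable to these numbers. If `a` and
`c` have the same sign, the first derivative controls all variables but `p₁`, which the second
controls when it is dominant. For opposite signs the second derivative controls `p₁ + q₁`, and when
that is negligible `p₀` and `q₂` nearly agree, so that the first derivative is about
`(a + c) p₀`. -/
theorem exists_direction {κ M E : ℝ} (hκ : 0 < κ) (hκM : κ ≤ M) (hE : 1 ≤ E) :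
    ∃ δ : ℝ, 0 < δ ∧ ∀ a c : ℝ, κ ≤ |a| → κ ≤ |c| → κ ≤ |a + c| → |a| ≤ M → |c| ≤ M →
      ∀ p₀ p₁ q₁ q₂ : ℝ, 0 ≤ p₀ → 0 ≤ p₁ → 0 ≤ q₁ → 0 ≤ q₂ →
      (∀ x, Comparable E p₀ p₁ q₁ q₂ x →
        δ * (p₀ + p₁ + q₁ + q₂) ≤ |c * x.1 + a * (x.2.2.1 + x.2.2.2)|) ∨
      (∀ x, Comparable E p₀ p₁ q₁ q₂ x →
        δ * (p₀ + p₁ + q₁ + q₂) ≤ |c * x.2.1 - a * x.2.2.1|) := by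
  have hM : 0 < M := hκ.trans_le hκM
  have hE0 : 0 < E := by linarith
  obtain ⟨A, hA⟩ : ∃ A, A = 8 * M * E ^ 2 / κ := ⟨_, rfl⟩
  have hAκ : A * κ = 8 * M * E ^ 2 := by rw [hA]; field_simp
  have hA0 : 0 < A := by rw [hA]; positivity
  have hA1 : 1 ≤ A := by
    have h1 : M * 1 ≤ M * E ^ 2 := mul_le_mul_of_nonneg_left (one_le_pow₀ hE) hM.le
    have : 1 * κ ≤ A * κ := by rw [hAκ]; linarith
    exact le_of_mul_le_mul_right this hκ
  obtain ⟨δ, hδ⟩ : ∃ δ, δ = κ / (4 * E * (1 + A)) := ⟨_, rfl⟩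
  have hδ' : δ * (4 * E * (1 + A)) = κ := by rw [hδ]; field_simp
  have hδ0 : 0 < δ := by rw [hδ]; positivity
  have fin : ∀ S y Y : ℝ, S ≤ (1 + A) * y → κ * y ≤ 4 * (E * Y) → δ * S ≤ Y := by
    intro S y Y h1 h2
    have h3 : δ * S * (4 * E) ≤ Y * (4 * E) := by
      calc δ * S * (4 * E) ≤ δ * ((1 + A) * y) * (4 * E) := by gcongr
        _ = κ * y := by rw [← hδ']; ring
        _ ≤ _ := by linarith
    exact le_of_mul_le_mul_right h3 (by positivity)
  -- a lower bound `κ Y ≤ Z` and a comparison `y ≤ E Y` give the second hypothesis of `fin`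
  have fin' : ∀ y Y Z : ℝ, 0 ≤ Z → y ≤ E * Y → κ * Y ≤ Z → κ * y ≤ 4 * (E * Z) := by
    intro y Y Z hZ h1 h2
    have h3 := mul_le_mul_of_nonneg_left h1 hκ.le
    have h4 := mul_le_mul_of_nonneg_left h2 hE0.le
    have h5 := mul_nonneg hE0.le hZ
    linarith
  refine ⟨δ, hδ0, fun a c ha hc hac haM hcM p₀ p₁ q₁ q₂ hp₀ hp₁ hq₁ hq₂ => ?_⟩
  rcases le_or_gt 0 (a * c) with hs | hs
  · rcases le_or_gt p₁ (A * (p₀ + q₁ + q₂)) with h | h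
    · left
      intro x hx
      refine fin _ (p₀ + q₁ + q₂) _ (by linarith) (fin' _ (x.1 + (x.2.2.1 + x.2.2.2)) _
        (abs_nonneg _) (by linarith [hx.le₁, hx.le₃, hx.le₄]) ?_)
      exact lower_same_sign hκ ha hc hs hx.nn₁ (add_nonneg hx.nn₃ hx.nn₄)
    · right
      intro x hx
      refine fin _ p₁ _ ?_ (lower_large_p₁ hκ hM hE0 hAκ hA0 hc haM hp₀ hq₂ h hx)
      have h1 : 1 * (p₀ + q₁ + q₂) ≤ A * (p₀ + q₁ + q₂) :=
        mul_le_mul_of_nonneg_right hA1 (by positivity)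
      have h2 := mul_nonneg hA0.le hp₁
      have h3 : 1 * p₁ ≤ A * p₁ := mul_le_mul_of_nonneg_right hA1 hp₁
      linarith
  · rcases le_or_gt (p₀ + q₂) (A * (p₁ + q₁)) with h | h
    · right
      intro x hx
      refine fin _ (p₁ + q₁) _ (by linarith) (fin' _ (x.2.1 + x.2.2.1) _
        (abs_nonneg _) (by linarith [hx.le₂, hx.le₃]) ?_)
      have := lower_same_sign (a := -a) (c := c) hκ (by rwa [abs_neg]) hc (by linarith)
        hx.nn₂ hx.nn₃
      rwa [neg_mul, ← sub_eq_add_neg] at this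
    · left
      intro x hx
      refine fin _ (p₀ + q₂) _ ?_ (lower_large_p₀_q₂ hκ hM hE0 hAκ hac haM hcM h hx)
      have h1 : 1 * (p₁ + q₁) ≤ A * (p₁ + q₁) := mul_le_mul_of_nonneg_right hA1 (by positivity)
      have h3 : 1 * (p₀ + q₂) ≤ A * (p₀ + q₂) := mul_le_mul_of_nonneg_right hA1 (by positivity)
      linarith

/-! ### Decay of the oscillatory integral over `𝔞` -/

/-- A smooth function on the line that agrees with `1 / y` outside a neighbourhood of the origin. -/
theorem exists_smooth_inv {c : ℝ} (hc : 0 < c) :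
    ∃ ξ : ℝ → ℝ, ContDiff ℝ ∞ ξ ∧ ∀ y, c ≤ |y| → y * ξ y = 1 := by
  let χ : ℝ → ℝ := fun y => Real.smoothTransition (2 * (y / c) ^ 2 - 1)
  have hχ : ContDiff ℝ ∞ χ := Real.smoothTransition.contDiff.comp (by fun_prop)
  refine ⟨fun y => y⁻¹ * χ y, contDiff_iff_contDiffAt.mpr fun y => ?_, fun y hy => ?_⟩
  · by_cases hy : y = 0
    · have h0 : (fun y => y⁻¹ * χ y) =ᶠ[nhds y] fun _ => 0 := by
        have : Filter.Tendsto (fun y : ℝ => 2 * (y / c) ^ 2 - 1) (nhds y)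
            (nhds (2 * (y / c) ^ 2 - 1)) := (Continuous.tendsto (by fun_prop) y)
        have h1 := this.eventually (Iio_mem_nhds (show 2 * (y / c) ^ 2 - 1 < 0 by simp [hy]))
        filter_upwards [h1] with z hz
        have : χ z = 0 := Real.smoothTransition.zero_of_nonpos (le_of_lt hz)
        rw [this, mul_zero]
      exact contDiffAt_const.congr_of_eventuallyEq h0
    · exact (contDiffAt_inv ℝ hy).mul hχ.contDiffAt
  · have hy0 : y ≠ 0 := abs_pos.mp (hc.trans_le hy)
    have h1 : χ y = 1 := by
      apply Real.smoothTransition.one_of_one_le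
      have : 1 ≤ (y / c) ^ 2 := by
        rw [← sq_abs, abs_div, abs_of_pos hc]
        exact one_le_pow₀ ((one_le_div hc).mpr hy)
      linarith
    change y * (y⁻¹ * χ y) = 1
    rw [h1, mul_one, mul_inv_cancel₀ hy0]

/-- The parameters `(c, m, n, s, r)` on which the derivative of the phase depends once it has been
divided by `tau s r`: `s` and `r` are unit vectors, and the quotients by `tau s r` in `c`, `m`, `n`
are bounded. -/
abbrev Par : Type :=
  ℝ × (Fin 3 → ℝ) × (Fin 3 → ℝ) × (Fin 3 → ℝ) × (Fin 3 → ℝ)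

/-- The derivative of the phase in a fixed direction, divided by `tau s r`. -/
def normDeriv (x : Par × frakA) : ℝ :=
  x.1.1 + wSum x.1.2.1 x.2 / posSum x.1.2.2.2.1 x.2 +
    wSum x.1.2.2.1 (-x.2) / posSum x.1.2.2.2.2 (-x.2)

theorem contDiff_normDeriv : ContDiff ℝ ∞ normDeriv := by
  have a : ContDiff ℝ ∞ fun x : Par × frakA => x.2 := contDiff_snd
  have a' : ContDiff ℝ ∞ fun x : Par × frakA => -x.2 := contDiff_snd.neg
  refine ContDiff.add (ContDiff.add ?_ (ContDiff.div ?_ ?_ ?_)) (ContDiff.div ?_ ?_ ?_)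
  · exact contDiff_fst.fst
  · exact contDiff_wSum contDiff_fst.snd.fst a
  · exact contDiff_posSum contDiff_fst.snd.snd.snd.fst a
  · exact fun x => (posSum_pos _ _).ne'
  · exact contDiff_wSum contDiff_fst.snd.snd.fst a'
  · exact contDiff_posSum contDiff_fst.snd.snd.snd.snd a'
  · exact fun x => (posSum_pos _ _).ne'

theorem sq_le_one_of_sqSum {s : Fin 3 → ℝ} (hs : sqSum s = 1) (i : Fin 3) : s i ^ 2 ≤ 1 := by
  rw [← hs, sqSum]
  fin_cases i <;> simp <;> nlinarith [sq_nonneg (s 0), sq_nonneg (s 1), sq_nonneg (s 2)]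

theorem norm_le_one_of_sqSum {s : Fin 3 → ℝ} (hs : sqSum s = 1) : ‖s‖ ≤ 1 :=
  (pi_norm_le_iff_of_nonneg zero_le_one).mpr fun i =>
    (sq_le_one_iff_abs_le_one _).mp (sq_le_one_of_sqSum hs i)

theorem norm_vec_le {a b c R : ℝ} (ha : |a| ≤ R) (hb : |b| ≤ R) (hc : |c| ≤ R) :
    ‖(![a, b, c] : Fin 3 → ℝ)‖ ≤ R := by
  refine (pi_norm_le_iff_of_nonneg ((abs_nonneg a).trans ha)).mpr fun i => ?_
  fin_cases i <;> simpa

theorem abs_mul_div_le {a x τ M : ℝ} (hτ : 0 < τ) (ha : |a| ≤ M) (hx0 : 0 ≤ x) (hx : x ≤ τ) :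
    |a * x / τ| ≤ M := by
  rw [abs_div, abs_mul, abs_of_nonneg hx0, abs_of_pos hτ, div_le_iff₀ hτ]
  exact mul_le_mul ha hx hx0 ((abs_nonneg _).trans ha)

theorem comparable_pr {s r : Fin 3 → ℝ} (hs : sqSum s = 1) (hr : sqSum r = 1)
    (hsr : s ⬝ᵥ r = 0) {H : frakA} (hH : ‖H‖ ≤ 1) :
    Comparable (Real.exp 4) (s 0 ^ 2) (s 1 ^ 2) (r 1 ^ 2) (r 2 ^ 2)
      (pr s H 0, pr s H 1, pr r (-H) 1, pr r (-H) 2) := by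
  have hH' : ‖-H‖ ≤ 1 := by rwa [norm_neg]
  have q := pr_sum hr (-H)
  have p := pr_sum hs H
  have b0 := pr_add_pr_le_one hs hr hsr H 0
  have b2 := pr_add_pr_le_one hs hr hsr H 2
  exact ⟨(pr_bounds hs hH 0).1, (pr_bounds hs hH 1).1, (pr_bounds hr hH' 1).1,
    (pr_bounds hr hH' 2).1, (pr_bounds hs hH 1).2, (pr_bounds hr hH' 1).2, pr_nonneg _ _ _,
    pr_nonneg _ _ _, pr_nonneg _ _ _, pr_nonneg _ _ _, by simp only; linarith,
    by simp only; linarith⟩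

theorem fderiv_phase_dirX_eq (l ν : frakADual) {s r : Fin 3 → ℝ} (hs : sqSum s = 1)
    (hr : sqSum r = 1) (hτ : 0 < tau s r) (H : frakA) : fderiv ℝ (phase l ν s r) H dirX =
      tau s r * normDeriv (((l - ν) dirX / tau s r, ![ν h23 * s 0 ^ 2 / tau s r, 0, 0],
        ![0, ν h12 * r 1 ^ 2 / tau s r, ν h12 * r 2 ^ 2 / tau s r], s, r), H) := by
  rw [fderiv_phase_dirX l ν hs hr]
  simp only [normDeriv, posSum_of_unit hs, posSum_of_unit hr]
  rw [wSum_eq ![_, _, _], wSum_eq ![_, _, _]]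
  simp only [pr]
  have hP := (wSum_pos (s := s) (by rw [hs]; norm_num) H).ne'
  have hQ := (wSum_pos (s := r) (by rw [hr]; norm_num) (-H)).ne'
  simp
  field_simp
  ring

theorem fderiv_phase_dirY_eq (l ν : frakADual) {s r : Fin 3 → ℝ} (hs : sqSum s = 1)
    (hr : sqSum r = 1) (hτ : 0 < tau s r) (H : frakA) : fderiv ℝ (phase l ν s r) H dirY =
      tau s r * normDeriv (((l - ν) dirY / tau s r, ![0, ν h23 * s 1 ^ 2 / tau s r, 0],
        ![0, -ν h12 * r 1 ^ 2 / tau s r, 0], s, r), H) := by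
  rw [fderiv_phase_dirY l ν hs hr]
  simp only [normDeriv, posSum_of_unit hs, posSum_of_unit hr]
  rw [wSum_eq ![_, _, _], wSum_eq ![_, _, _]]
  simp only [pr]
  have hP := (wSum_pos (s := s) (by rw [hs]; norm_num) H).ne'
  have hQ := (wSum_pos (s := r) (by rw [hr]; norm_num) (-H)).ne'
  simp
  field_simp
  ring

/-- Under the smallness condition on `l - ν`, there is a direction `X`, one of `dirX` and `dirY`, in
which the derivative of the phase is `tau s r` times a function `normDeriv (θ, ·)` that is bounded
away from zero on the unit ball. -/
theorem exists_direction_phase {B : Set frakADual} (hB : IsCompact B) (hBr : B ⊆ regular) :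
    ∃ δ R C₁ : ℝ, 0 < δ ∧ 0 < C₁ ∧ ∀ ν ∈ B, ∀ l : frakADual, ∀ s r : Fin 3 → ℝ,
      sqSum s = 1 → sqSum r = 1 → s ⬝ᵥ r = 0 → 0 < tau s r → C₁ * ‖l - ν‖ ≤ tau s r →
      ∃ X : frakA, ‖X‖ ≤ max ‖dirX‖ ‖dirY‖ ∧ ∃ θ : Par, ‖θ‖ ≤ R ∧
        (∀ H, fderiv ℝ (phase l ν s r) H X = tau s r * normDeriv (θ, H)) ∧
        ∀ H ∈ Metric.closedBall (0 : frakA) 1, δ ≤ |normDeriv (θ, H)| := by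
  obtain ⟨κ, M, hκ, hκM, hBκ⟩ := exists_coroot_bounds hB hBr
  obtain ⟨δ, hδ, hdir⟩ := exists_direction hκ hκM (Real.one_le_exp (by norm_num : (0 : ℝ) ≤ 4))
  obtain ⟨m, hm⟩ : ∃ m, m = max ‖dirX‖ ‖dirY‖ := ⟨_, rfl⟩
  have hm0 : 0 ≤ m := by rw [hm]; exact le_max_of_le_left (norm_nonneg _)
  refine ⟨δ / 2, max 1 (max (δ / 2) M), (m + 1) / (δ / 2), by positivity, by positivity, ?_⟩
  intro ν hν l s r hs hr hsr hτ hl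
  obtain ⟨n1, n2, n3, n4, n5⟩ := hBκ ν hν
  have hl' : ∀ X : frakA, ‖X‖ ≤ m → |(l - ν) X| ≤ δ / 2 * tau s r := by
    intro X hX
    rw [div_mul_eq_mul_div, div_le_iff₀ (by positivity)] at hl
    calc |(l - ν) X| ≤ ‖l - ν‖ * ‖X‖ := (l - ν).le_opNorm X
      _ ≤ ‖l - ν‖ * (m + 1) := by gcongr; linarith
      _ ≤ _ := by linarith
  have hquot : ∀ X : frakA, ‖X‖ ≤ m → |(l - ν) X / tau s r| ≤ δ / 2 := by
    intro X hX
    rw [abs_div, abs_of_pos hτ, div_le_iff₀ hτ]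
    exact hl' X hX
  have hM0 : 0 ≤ M := hκ.le.trans hκM
  have hpar : ∀ (c : ℝ) (u v : Fin 3 → ℝ), |c| ≤ δ / 2 → ‖u‖ ≤ M → ‖v‖ ≤ M →
      ‖((c, u, v, s, r) : Par)‖ ≤ max 1 (max (δ / 2) M) := by
    intro c u v hc hu hv
    have h1 := norm_le_one_of_sqSum hs
    have h2 := norm_le_one_of_sqSum hr
    simp only [Prod.norm_def, Real.norm_eq_abs]
    have e1 : (1 : ℝ) ≤ max 1 (max (δ / 2) M) := le_max_left _ _
    have e2 : δ / 2 ≤ max 1 (max (δ / 2) M) := (le_max_left _ _).trans (le_max_right _ _)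
    have e3 : M ≤ max 1 (max (δ / 2) M) := (le_max_right _ _).trans (le_max_right _ _)
    exact max_le (hc.trans e2) (max_le (hu.trans e3) (max_le (hv.trans e3)
      (max_le (h1.trans e1) (h2.trans e1))))
  -- a perturbation of size `δ τ / 2` does not spoil a lower bound `δ τ`
  have hlow : ∀ x g N : ℝ, x + g = tau s r * N → |x| ≤ δ / 2 * tau s r → δ * tau s r ≤ |g| →
      δ / 2 ≤ |N| := by
    intro x g N h h1 h2
    have h3 : |g| - |x| ≤ tau s r * |N| := by
      have e : tau s r * |N| = |tau s r * N| := by rw [abs_mul, abs_of_pos hτ]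
      rw [e, ← h]
      have := abs_sub_abs_le_abs_sub g (-x)
      rwa [abs_neg, sub_neg_eq_add, add_comm] at this
    have h4 : tau s r * (δ / 2) ≤ tau s r * |N| := by linarith
    exact le_of_mul_le_mul_left h4 hτ
  have htau : s 0 ^ 2 ≤ tau s r ∧ s 1 ^ 2 ≤ tau s r ∧ r 1 ^ 2 ≤ tau s r ∧ r 2 ^ 2 ≤ tau s r := by
    have := sq_nonneg (s 0); have := sq_nonneg (s 1)
    have := sq_nonneg (r 1); have := sq_nonneg (r 2)
    unfold tau
    exact ⟨by linarith, by linarith, by linarith, by linarith⟩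
  have zero : |(0 : ℝ)| ≤ M := by simpa using hM0
  rcases hdir (ν h12) (ν h23) n1 n2 n3 n4 n5 (s 0 ^ 2) (s 1 ^ 2) (r 1 ^ 2) (r 2 ^ 2)
    (sq_nonneg _) (sq_nonneg _) (sq_nonneg _) (sq_nonneg _) with h | h
  · have hX : ‖dirX‖ ≤ m := hm ▸ le_max_left _ _
    refine ⟨dirX, le_max_left _ _, _, hpar _ _ _ (hquot dirX hX)
      (norm_vec_le (abs_mul_div_le hτ n5 (sq_nonneg _) htau.1) zero zero)
      (norm_vec_le zero (abs_mul_div_le hτ n4 (sq_nonneg _) htau.2.2.1)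
        (abs_mul_div_le hτ n4 (sq_nonneg _) htau.2.2.2)),
      fun H => fderiv_phase_dirX_eq l ν hs hr hτ H, fun H hH => ?_⟩
    rw [mem_closedBall_zero_iff] at hH
    refine hlow _ _ _ ?_ (hl' dirX hX) (h _ (comparable_pr hs hr hsr hH))
    rw [← fderiv_phase_dirX_eq l ν hs hr hτ H, fderiv_phase_dirX l ν hs hr]
  · have hY : ‖dirY‖ ≤ m := hm ▸ le_max_right _ _
    refine ⟨dirY, le_max_right _ _, _, hpar _ _ _ (hquot dirY hY)
      (norm_vec_le zero (abs_mul_div_le hτ n5 (sq_nonneg _) htau.2.1) zero)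
      (norm_vec_le zero (abs_mul_div_le hτ (by rwa [abs_neg]) (sq_nonneg _) htau.2.2.1) zero),
      fun H => fderiv_phase_dirY_eq l ν hs hr hτ H, fun H hH => ?_⟩
    rw [mem_closedBall_zero_iff] at hH
    refine hlow _ _ _ ?_ (hl' dirY hY) (h _ (comparable_pr hs hr hsr hH))
    rw [← fderiv_phase_dirY_eq l ν hs hr hτ H, fderiv_phase_dirY l ν hs hr]

/-- The oscillatory integral over `𝔞` is bounded, and it is `O((t τ)⁻ⁿ)` as soon as `τ = tau s r`
is large compared with `l - ν`. -/
theorem exists_osc_bound {B : Set frakADual} (hB : IsCompact B) (hBr : B ⊆ regular)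
    {P : Type*} [NormedAddCommGroup P] [NormedSpace ℝ P] {amp : P × frakA → ℂ}
    (hamp : ContDiff ℝ ∞ amp) {S : Set P} (hS : IsCompact S) (n : ℕ) (D : ℝ) :
    ∃ C₁ C : ℝ, 0 < C₁ ∧ 0 < C ∧ ∀ b : frakA → ℂ, IsCutoff n D b → ∀ ν ∈ B, ∀ l : frakADual,
      ∀ s r : Fin 3 → ℝ, sqSum s = 1 → sqSum r = 1 → s ⬝ᵥ r = 0 → ∀ θ ∈ S, ∀ t : ℝ, 0 < t →
      ‖∫ H, b H * amp (θ, H) * Complex.exp (Complex.I * ((t * phase l ν s r H : ℝ) : ℂ))‖ ≤ C ∧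
      (0 < tau s r → C₁ * ‖l - ν‖ ≤ tau s r →
      ‖∫ H, b H * amp (θ, H) * Complex.exp (Complex.I * ((t * phase l ν s r H : ℝ) : ℂ))‖ ≤
        C * (t * tau s r)⁻¹ ^ n) := by
  obtain ⟨δ, R, C₁, hδ, hC₁, hdir⟩ := exists_direction_phase hB hBr
  obtain ⟨ξ, hξ, hξ'⟩ := exists_smooth_inv hδ
  have hU : ContDiff ℝ ∞ fun x : Par × frakA => ((ξ (normDeriv x) : ℝ) : ℂ) :=
    Complex.ofRealCLM.contDiff.comp (hξ.comp contDiff_normDeriv)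
  obtain ⟨Mu, hMu, hu⟩ :=
    exists_iteratedFDeriv_bound hU (isCompact_closedBall (0 : Par) R) n
  obtain ⟨Ma, hMa, ha⟩ := exists_iteratedFDeriv_bound hamp hS n
  set m := max ‖dirX‖ ‖dirY‖ with hm
  have hm0 : 0 ≤ m := le_max_of_le_left (norm_nonneg _)
  set vol := (volume : Measure frakA).real (Metric.closedBall 0 1)
  have hvol : 0 ≤ vol := measureReal_nonneg
  set D' := 2 ^ n * Ma * |D| with hD'
  set K := (m * (2 ^ n * Mu)) ^ n * D' * vol with hK
  have hK0 : 0 ≤ K := by positivity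
  have hL0 : 0 ≤ D' * vol := by positivity
  refine ⟨C₁, K + D' * vol + 1, hC₁, by positivity, ?_⟩
  intro b hb ν hν l s r hs hr hsr θ hθ t ht
  have hDD : |D| = D := abs_of_nonneg hb.isBump.nonneg
  have hF : IsBump n D' (fun H => b H * amp (θ, H)) := by
    rw [hD', hDD]
    exact hb.isBump.mul (hamp.comp (contDiff_const.prodMk contDiff_id)) hMa (ha θ hθ)
  constructor
  · refine (norm_integral_le_of_eq_zero_off_closedBall volume (D := D')
      (fun H hH => by rw [hF.eq_zero hH, zero_mul]) fun H _ => ?_).trans ?_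
    · rw [norm_mul, norm_exp_I_mul, mul_one]
      exact hF.norm_le H
    · change D' * vol ≤ _
      linarith
  · intro hτ hl
    obtain ⟨X, hX, η, hη, hd, hlow⟩ := hdir ν hν l s r hs hr hsr hτ hl
    have key := nonstationary_phase volume (u := fun H => ((ξ (normDeriv (η, H)) : ℝ) : ℂ))
      (hU.comp (contDiff_const.prodMk contDiff_id)) hMu
      (hu η (by simpa using hη)) (contDiff_phase l ν hs hr) X ht hτ
      (fun H hH => by
        rw [hd, ← Complex.ofReal_mul, mul_assoc, hξ' _ (hlow H hH), mul_one]) n le_rfl hF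
    refine key.trans ?_
    have hp : 0 ≤ (t * tau s r)⁻¹ ^ n := by positivity
    refine mul_le_mul_of_nonneg_right ?_ hp
    calc (‖X‖ * (2 ^ n * Mu)) ^ n * D' * vol ≤ K := by rw [hK]; gcongr
      _ ≤ _ := by linarith

/-! ### Symmetry of spherical functions: the polar decomposition -/

section Polar

open scoped MatrixOrder

/-- The transpose of `x ∈ SL₃(ℝ)`. -/
def trG (x : G) : G := ⟨x.1ᵀ, by rw [Matrix.det_transpose, x.2]⟩

/-- Polar decomposition: if `x = p k` with `p` symmetric and `k ∈ K`, then `xᵀ = k⁻¹ x k⁻¹`. -/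
theorem exists_trG_eq (x : G) : ∃ k ∈ K, trG x = k * x * k := by
  set S := x.1 * x.1ᵀ with hS
  have hpsd : S.PosSemidef := by
    have := Matrix.posSemidef_self_mul_conjTranspose x.1
    rwa [Matrix.conjTranspose_eq_transpose_of_trivial] at this
  set p := CFC.sqrt S with hp
  have hpp : p * p = S := CFC.sqrt_mul_sqrt_self S hpsd.nonneg
  have hpt : pᵀ = p := by
    have h1 : (0 : Matrix (Fin 3) (Fin 3) ℝ) ≤ p := CFC.sqrt_nonneg S
    have h2 := (Matrix.nonneg_iff_posSemidef.mp h1).isHermitian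
    rwa [Matrix.IsHermitian, Matrix.conjTranspose_eq_transpose_of_trivial] at h2
  have hdet : p.det = 1 := by
    rw [hp, hpsd.det_sqrt, hS, Matrix.det_mul, Matrix.det_transpose, x.2]
    simp
  let q : G := ⟨p, hdet⟩
  have hqq : q * q = x * trG x := Subtype.ext hpp
  have hqt : trG q = q := Subtype.ext hpt
  have htm : ∀ a b : G, trG (a * b) = trG b * trG a := fun a b =>
    Subtype.ext (Matrix.transpose_mul a.1 b.1)
  have hti : ∀ a : G, trG a⁻¹ = (trG a)⁻¹ := fun a => by
    apply eq_inv_of_mul_eq_one_left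
    rw [← htm, mul_inv_cancel]
    exact Subtype.ext (by simp [trG])
  -- the orthogonal factor of `x = q (q⁻¹ x)`
  have hk : q⁻¹ * x * trG (q⁻¹ * x) = 1 := by
    rw [htm, hti, hqt]
    calc q⁻¹ * x * (trG x * q⁻¹) = q⁻¹ * (x * trG x) * q⁻¹ := by group
      _ = 1 := by rw [← hqq]; group
  refine ⟨(q⁻¹ * x)⁻¹, inv_mem (congrArg Subtype.val hk : _), ?_⟩
  have h1 : trG (q⁻¹ * x) = (q⁻¹ * x)⁻¹ := by
    rw [eq_inv_iff_mul_eq_one]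
    exact mul_eq_one_comm.mp hk
  have h2 : trG x = trG (q⁻¹ * x) * q := by
    rw [htm, hti, hqt]; group
  rw [h2, h1]
  group

end Polar

/-! ### Pairs of rows -/

/-- Pairs of vectors, thought of as the second and third rows of a `3 × 3` matrix. -/
abbrev Pairs : Type := (Fin 3 → ℝ) × (Fin 3 → ℝ)

/-- Multiplication of a pair of rows by `x` on the right. -/
def act (x : G) (z : Pairs) : Pairs := (z.1 ᵥ* x.1, z.2 ᵥ* x.1)

/-- The cross product of the two rows. -/
def cr (z : Pairs) : Fin 3 → ℝ := crossProduct z.1 z.2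

theorem cr_eq (z : Pairs) : cr z = ![z.1 1 * z.2 2 - z.1 2 * z.2 1,
    z.1 2 * z.2 0 - z.1 0 * z.2 2, z.1 0 * z.2 1 - z.1 1 * z.2 0] := cross_apply _ _

/-- The squared length of the third row. -/
def lenP (z : Pairs) : ℝ := sqSum z.2

/-- The Gram determinant of the two rows. -/
def lenQ (z : Pairs) : ℝ := sqSum (cr z)

/-- The set of linearly independent pairs. -/
def indep : Set Pairs := {z | 0 < lenQ z}

theorem sqSum_nonneg (s : Fin 3 → ℝ) : 0 ≤ sqSum s := by unfold sqSum; positivity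

@[fun_prop] theorem continuous_sqSum : Continuous sqSum := by unfold sqSum; fun_prop

theorem continuous_cr : Continuous cr := by
  simp only [funext cr_eq]
  fun_prop

@[fun_prop] theorem continuous_lenP : Continuous lenP := continuous_sqSum.comp continuous_snd

@[fun_prop] theorem continuous_lenQ : Continuous lenQ := continuous_sqSum.comp continuous_cr

theorem isOpen_indep : IsOpen indep := isOpen_lt continuous_const continuous_lenQ

theorem measurableSet_indep : MeasurableSet indep := isOpen_indep.measurableSet

theorem act_mul (x y : G) (z : Pairs) : act (x * y) z = act y (act x z) := by
  simp [act, Matrix.vecMul_vecMul]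

theorem act_one (z : Pairs) : act 1 z = z := by simp [act]

theorem cr_act (x : G) (z : Pairs) : cr (act x z) = (x⁻¹).1 *ᵥ cr z := by
  rw [Matrix.SpecialLinearGroup.coe_inv, Matrix.adjugate_fin_three, cr_eq, cr_eq]
  ext i
  fin_cases i <;>
    simp [act, Matrix.vecMul, Matrix.mulVec, dotProduct, Fin.sum_univ_three] <;> ring

/-- The squared Frobenius norm. -/
def fro (x : Matrix (Fin 3) (Fin 3) ℝ) : ℝ := sqSum (x 0) + sqSum (x 1) + sqSum (x 2)

theorem sqSum_vecMul_le (v : Fin 3 → ℝ) (x : Matrix (Fin 3) (Fin 3) ℝ) :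
    sqSum (v ᵥ* x) ≤ fro x * sqSum v := by
  have cs : ∀ a b c d e f : ℝ, (a * d + b * e + c * f) ^ 2 ≤
      (a ^ 2 + b ^ 2 + c ^ 2) * (d ^ 2 + e ^ 2 + f ^ 2) := fun a b c d e f => by
    nlinarith [sq_nonneg (a * e - b * d), sq_nonneg (a * f - c * d), sq_nonneg (b * f - c * e)]
  have h := fun j => cs (v 0) (v 1) (v 2) (x 0 j) (x 1 j) (x 2 j)
  simp only [sqSum, fro, Matrix.vecMul, dotProduct, Fin.sum_univ_three]
  linarith [h 0, h 1, h 2]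

theorem sqSum_mulVec_le (v : Fin 3 → ℝ) (x : Matrix (Fin 3) (Fin 3) ℝ) :
    sqSum (x *ᵥ v) ≤ fro x * sqSum v := by
  have h := sqSum_vecMul_le v xᵀ
  rw [Matrix.vecMul_transpose] at h
  have e : fro xᵀ = fro x := by simp [fro, sqSum]; ring
  rwa [e] at h

theorem fro_nonneg (x : Matrix (Fin 3) (Fin 3) ℝ) : 0 ≤ fro x :=
  add_nonneg (add_nonneg (sqSum_nonneg _) (sqSum_nonneg _)) (sqSum_nonneg _)

theorem lenP_act_le (x : G) (z : Pairs) : lenP (act x z) ≤ fro x.1 * lenP z :=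
  sqSum_vecMul_le _ _

theorem lenQ_act_le (x : G) (z : Pairs) : lenQ (act x z) ≤ fro (x⁻¹).1 * lenQ z := by
  rw [lenQ, cr_act]
  exact sqSum_mulVec_le _ _

theorem le_lenP_act (x : G) (z : Pairs) : lenP z ≤ fro (x⁻¹).1 * lenP (act x z) := by
  have := lenP_act_le x⁻¹ (act x z)
  rwa [← act_mul, mul_inv_cancel, act_one] at this

theorem le_lenQ_act (x : G) (z : Pairs) : lenQ z ≤ fro x.1 * lenQ (act x z) := by
  have := lenQ_act_le x⁻¹ (act x z)
  rwa [← act_mul, mul_inv_cancel, act_one, inv_inv] at this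

theorem act_mem_indep (x : G) {z : Pairs} : act x z ∈ indep ↔ z ∈ indep := by
  constructor
  · intro h
    by_contra h'
    have : lenQ z = 0 := le_antisymm (not_lt.mp h') (sqSum_nonneg _)
    have h1 := lenQ_act_le x z
    rw [this, mul_zero] at h1
    exact absurd h (not_lt.mpr h1)
  · intro h
    by_contra h'
    have : lenQ (act x z) = 0 := le_antisymm (not_lt.mp h') (sqSum_nonneg _)
    have h1 := le_lenQ_act x z
    rw [this, mul_zero] at h1
    exact absurd h (not_lt.mpr h1)

theorem lenP_pos_of_mem {z : Pairs} (h : z ∈ indep) : 0 < lenP z := by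
  refine lt_of_le_of_ne (sqSum_nonneg _) fun h0 => ?_
  have h1 : z.2 0 ^ 2 + z.2 1 ^ 2 + z.2 2 ^ 2 = 0 := h0.symm
  have a0 : z.2 0 = 0 := by nlinarith [sq_nonneg (z.2 0), sq_nonneg (z.2 1), sq_nonneg (z.2 2)]
  have a1 : z.2 1 = 0 := by nlinarith [sq_nonneg (z.2 0), sq_nonneg (z.2 1), sq_nonneg (z.2 2)]
  have a2 : z.2 2 = 0 := by nlinarith [sq_nonneg (z.2 0), sq_nonneg (z.2 1), sq_nonneg (z.2 2)]
  have h2 : (0 : ℝ) < lenQ z := h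
  rw [lenQ, cr_eq] at h2
  simp [sqSum, a0, a1, a2] at h2

theorem measurePreserving_vecMul (x : G) :
    MeasurePreserving (fun v : Fin 3 → ℝ => v ᵥ* x.1) volume volume := by
  have e : (fun v : Fin 3 → ℝ => v ᵥ* x.1) = ⇑(Matrix.toLin' x.1ᵀ) := by
    funext v; rw [Matrix.toLin'_apply, Matrix.mulVec_transpose]
  have hd : (x.1ᵀ).det = 1 := by rw [Matrix.det_transpose, x.2]
  refine ⟨by fun_prop, ?_⟩
  rw [e, Real.map_matrix_volume_pi_eq_smul_volume_pi (by rw [hd]; exact one_ne_zero), hd]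
  simp

theorem measurePreserving_act (x : G) : MeasurePreserving (act x) volume volume := by
  rw [Measure.volume_eq_prod]
  exact (measurePreserving_vecMul x).prod (measurePreserving_vecMul x)

theorem continuous_act (x : G) : Continuous (act x) := by unfold act; fun_prop

theorem measurableEmbedding_act (x : G) : MeasurableEmbedding (act x) :=
  (continuous_act x).measurableEmbedding fun a b h => by
    have := congrArg (act x⁻¹) h
    rwa [← act_mul, ← act_mul, mul_inv_cancel, act_one, act_one] at this

theorem setIntegral_act (x : G) (f : Pairs → ℂ) :
    ∫ z in indep, f (act x z) = ∫ z in indep, f z := by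
  have h := (measurePreserving_act x).setIntegral_preimage_emb (measurableEmbedding_act x) f indep
  rwa [show act x ⁻¹' indep = indep from Set.ext fun z => act_mem_indep x] at h

/-! ### Spherical functions as integrals over pairs of rows -/

/-- The Iwasawa projection of a pair of rows. -/
def iwaP (z : Pairs) : frakA := iwa (lenP z) (lenQ z)

/-- The second and third rows of a matrix. -/
def rows (g : G) : Pairs := (g.1 1, g.1 2)

theorem rows_mul (g y : G) : rows (g * y) = act y (rows g) := by
  simp only [rows, act, Matrix.SpecialLinearGroup.coe_mul]
  ext i <;> simp [Matrix.mul_apply, Matrix.vecMul, dotProduct]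

theorem iwasawaA_eq_iwaP (g : G) : iwasawaA g = iwaP (rows g) := by
  rw [iwasawaA_eq_iwa, iwaP]
  congr 1
  · simp [minorP, lenP, rows, sqSum, Matrix.mul_apply, Fin.sum_univ_three]; ring
  · simp [minorQ, lenQ, rows, sqSum, cr_eq, Matrix.mul_apply, Fin.sum_univ_three]; ring

theorem expA_val (H : frakA) : (expA H).1 = Matrix.diagonal fun i => Real.exp (H.1 i) := rfl

theorem expA_add (H H' : frakA) : expA (H + H') = expA H * expA H' := by
  apply Subtype.ext
  rw [Matrix.SpecialLinearGroup.coe_mul, expA_val, expA_val, expA_val,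
    Matrix.diagonal_mul_diagonal]
  congr 1
  funext i
  rw [← Real.exp_add]
  rfl

theorem expA_zero : expA 0 = 1 := by
  apply Subtype.ext
  simp [expA]

theorem expA_neg (H : frakA) : expA (-H) = (expA H)⁻¹ := by
  rw [eq_inv_iff_mul_eq_one, ← expA_add, neg_add_cancel, expA_zero]

/-- `A(n a k y) = log a + A(k y)`, because `A` normalises `N`. -/
theorem iwasawaA_mul {n k : G} (hn : n ∈ setN) (H : frakA) (y : G) :
    iwasawaA (n * expA H * k * y) = H + iwasawaA (k * y) := by
  obtain ⟨n', hn', k', hk', h⟩ := exists_iwasawa (k * y)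
  set H' := iwasawaA (k * y)
  have e : n * expA H * k * y = (n * (expA H * n' * expA (-H))) * expA (H + H') * k' := by
    rw [mul_assoc (n * expA H), h, expA_add, expA_neg]
    group
  rw [e]
  refine iwasawaA_eq ?_ _ hk'
  intro i j hij
  have h1 := fun i j hij => hn i j hij
  have h2 := fun i j hij => hn' i j hij
  have ee : ∀ j, Real.exp (H.1 j) * Real.exp (-H.1 j) = 1 := fun j => by
    rw [← Real.exp_add, add_neg_cancel, Real.exp_zero]
  have a := h1 0 0 (by decide); have b := h1 1 0 (by decide); have c := h1 1 1 (by decide)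
  have d := h1 2 0 (by decide); have e := h1 2 1 (by decide); have f := h1 2 2 (by decide)
  have a' := h2 0 0 (by decide); have b' := h2 1 0 (by decide); have c' := h2 1 1 (by decide)
  have d' := h2 2 0 (by decide); have e' := h2 2 1 (by decide); have f' := h2 2 2 (by decide)
  simp at a b c d e f a' b' c' d' e' f'
  rw [Matrix.SpecialLinearGroup.coe_mul, Matrix.SpecialLinearGroup.coe_mul,
    Matrix.SpecialLinearGroup.coe_mul, expA_val, expA_val]
  fin_cases i <;> fin_cases j <;> first
    | exact absurd hij (by decide)
    | simp [Matrix.mul_apply, Fin.sum_univ_three, Matrix.diagonal_apply, a, b, c, d, e, f,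
        a', b', c', d', e', f', ee]

/-- A pair of independent rows is `b k` with `b` triangular and `k ∈ K`. -/
theorem exists_iwasawa_pair {z : Pairs} (hz : z ∈ indep) :
    ∃ k ∈ K, ∀ y : G, iwaP (act y z) = iwaP z + iwasawaA (k * y) := by
  have hz' : lenQ z ≠ 0 := (show 0 < lenQ z from hz).ne'
  -- completing the two rows by a multiple of their cross product gives a matrix in `SL₃`
  let g : G := ⟨!![cr z 0 / lenQ z, cr z 1 / lenQ z, cr z 2 / lenQ z;
      z.1 0, z.1 1, z.1 2; z.2 0, z.2 1, z.2 2], by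
    rw [Matrix.det_fin_three]
    simp [cr_eq]
    field_simp
    simp [lenQ, sqSum, cr_eq]
    ring⟩
  have hg : rows g = z := by
    refine Prod.ext ?_ ?_ <;> ext i <;> fin_cases i <;> simp [rows, g]
  obtain ⟨n, hn, k, hk, h⟩ := exists_iwasawa g
  refine ⟨k, hk, fun y => ?_⟩
  rw [← hg, ← rows_mul, ← iwasawaA_eq_iwaP, ← iwasawaA_eq_iwaP]
  conv_lhs => rw [h]
  exact iwasawaA_mul hn _ y

theorem sqSum_vecMul_of_mem_K (v : Fin 3 → ℝ) {k : G} (hk : k ∈ K) :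
    sqSum (v ᵥ* k.1) = sqSum v := by
  have e : ∀ v : Fin 3 → ℝ, sqSum v = v ⬝ᵥ v := fun v => by
    simp [sqSum, dotProduct, Fin.sum_univ_three]; ring
  have hk' : k.1 * k.1ᵀ = 1 := hk
  rw [e, e, ← Matrix.dotProduct_mulVec, ← Matrix.mulVec_transpose k.1, Matrix.mulVec_mulVec, hk',
    Matrix.one_mulVec]

instance : SecondCountableTopology K := by
  have h : Topology.IsEmbedding (fun k : K => (k.1.1 : Matrix (Fin 3) (Fin 3) ℝ)) :=
    Matrix.SpecialLinearGroup.isClosedEmbedding_val.isEmbedding.comp Topology.IsEmbedding.subtypeVal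
  have : SecondCountableTopology (Matrix (Fin 3) (Fin 3) ℝ) :=
    inferInstanceAs (SecondCountableTopology (Fin 3 → Fin 3 → ℝ))
  exact h.secondCountableTopology

instance : haarK.IsMulLeftInvariant := Measure.isMulLeftInvariant_haarMeasure _

instance : IsProbabilityMeasure haarK :=
  ⟨Measure.haarMeasure_self (K₀ := (⊤ : TopologicalSpace.PositiveCompacts K))⟩

/-- The function `g ↦ e^{(ρ + iν)(A(g))}` on pairs of rows. -/
def chr (ν : frakADual) (z : Pairs) : ℂ :=
  Complex.exp (((rho (iwaP z) : ℝ) : ℂ) + Complex.I * ((ν (iwaP z) : ℝ) : ℂ))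

theorem chr_ne_zero (ν : frakADual) (z : Pairs) : chr ν z ≠ 0 := Complex.exp_ne_zero _

theorem norm_chr (ν : frakADual) (z : Pairs) : ‖chr ν z‖ = Real.exp (rho (iwaP z)) := by
  rw [chr, Complex.norm_exp]
  simp

@[fun_prop] theorem measurable_apply_iwaP (ν : frakADual) : Measurable fun z => ν (iwaP z) := by
  simp only [iwaP, apply_iwa]
  have h1 : Measurable lenP := continuous_lenP.measurable
  have h2 : Measurable lenQ := continuous_lenQ.measurable
  exact ((measurable_const.mul h2.log).neg).sub (measurable_const.mul h1.log)

theorem measurable_chr (ν : frakADual) : Measurable (chr ν) := by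
  unfold chr
  have h1 := measurable_apply_iwaP rho
  have h2 := measurable_apply_iwaP ν
  exact ((Complex.measurable_ofReal.comp h1).add
    (measurable_const.mul (Complex.measurable_ofReal.comp h2))).cexp

theorem rho_iwa (p q : ℝ) : rho (iwa p q) = -(Real.log q / 2) - Real.log p / 2 := by
  rw [apply_iwa, rho_h12, rho_h23]; ring

theorem log_le_log_add {a b R : ℝ} (hR : 1 ≤ R) (ha : 0 ≤ a) (hb : 0 ≤ b) (h1 : a ≤ R * b)
    (h2 : b ≤ R * a) : Real.log a ≤ Real.log R + Real.log b := by
  rcases hb.eq_or_lt with h | h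
  · have : a = 0 := le_antisymm (by rw [← h, mul_zero] at h1; exact h1) ha
    rw [this, ← h, Real.log_zero, add_zero]
    exact Real.log_nonneg hR
  · have ha' : 0 < a := by
      rcases ha.eq_or_lt with h' | h'
      · rw [← h', mul_zero] at h2; exact absurd h (not_lt.mpr h2)
      · exact h'
    rw [← Real.log_mul (by positivity) h.ne']
    exact Real.log_le_log ha' h1

/-- Multiplication by a matrix of bounded size changes the weight `e^{ρ(A(g))}` by a bounded factor.
This holds for dependent pairs too, on which the junk value `log 0 = 0` is used on both sides. -/
theorem norm_chr_act_le {x : G} {R : ℝ} (hR : 1 ≤ R) (h1 : fro x.1 ≤ R) (h2 : fro (x⁻¹).1 ≤ R)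
    (ν ν' : frakADual) (z : Pairs) : ‖chr ν (act x z)‖ ≤ R * ‖chr ν' z‖ := by
  have mono : ∀ {f a b : ℝ}, f ≤ R → 0 ≤ b → a ≤ f * b → a ≤ R * b := fun hf hb h =>
    h.trans (mul_le_mul_of_nonneg_right hf hb)
  have e1 := log_le_log_add hR (sqSum_nonneg z.2) (sqSum_nonneg (act x z).2)
    (mono h2 (sqSum_nonneg _) (le_lenP_act x z)) (mono h1 (sqSum_nonneg _) (lenP_act_le x z))
  have e2 := log_le_log_add hR (sqSum_nonneg (cr z)) (sqSum_nonneg (cr (act x z)))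
    (mono h1 (sqSum_nonneg _) (le_lenQ_act x z)) (mono h2 (sqSum_nonneg _) (lenQ_act_le x z))
  rw [norm_chr, norm_chr, iwaP, iwaP, rho_iwa, rho_iwa]
  calc _ ≤ Real.exp (Real.log R + (-(Real.log (lenQ z) / 2) - Real.log (lenP z) / 2)) := by
        apply Real.exp_le_exp.mpr
        change Real.log (lenP z) ≤ _ + Real.log (lenP (act x z)) at e1
        change Real.log (lenQ z) ≤ _ + Real.log (lenQ (act x z)) at e2
        linarith
    _ = _ := by rw [Real.exp_add, Real.exp_log (by linarith)]

/-- A smooth function on the line, equal to `1` on `(-∞, 1]` and to `0` on `[2, ∞)`. -/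
def step (y : ℝ) : ℝ := Real.smoothTransition (2 - y)

theorem contDiff_step : ContDiff ℝ ∞ step :=
  Real.smoothTransition.contDiff.comp (contDiff_const.sub contDiff_id)

theorem step_nonneg (y : ℝ) : 0 ≤ step y := Real.smoothTransition.nonneg _

theorem step_le_one (y : ℝ) : step y ≤ 1 := Real.smoothTransition.le_one _

theorem lt_two_of_step_ne_zero {y : ℝ} (h : step y ≠ 0) : y < 2 := by
  by_contra h'
  exact h (Real.smoothTransition.zero_of_nonpos (by linarith [not_lt.mp h']))

/-- A `K`-invariant compactly supported weight on pairs of rows. -/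
def psi (z : Pairs) : ℝ := step (sqSum z.1) * step (sqSum z.2)

theorem continuous_psi : Continuous psi := by
  have := contDiff_step.continuous
  unfold psi
  fun_prop

theorem psi_nonneg (z : Pairs) : 0 ≤ psi z := mul_nonneg (step_nonneg _) (step_nonneg _)

theorem psi_le_one (z : Pairs) : psi z ≤ 1 :=
  mul_le_one₀ (step_le_one _) (step_nonneg _) (step_le_one _)

theorem norm_le_of_sqSum_le {v : Fin 3 → ℝ} {R : ℝ} (hR : 0 ≤ R) (h : sqSum v ≤ R ^ 2) :
    ‖v‖ ≤ R := by
  refine (pi_norm_le_iff_of_nonneg hR).mpr fun i => ?_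
  rw [Real.norm_eq_abs]
  refine abs_le_of_sq_le_sq ?_ hR
  refine le_trans ?_ h
  unfold sqSum
  have h0 := sq_nonneg (v 0)
  have h1 := sq_nonneg (v 1)
  have h2 := sq_nonneg (v 2)
  fin_cases i <;> simp only [Fin.zero_eta, Fin.mk_one, Fin.reduceFinMk] <;> linarith

theorem psi_ne_zero {z : Pairs} (h : psi z ≠ 0) : sqSum z.1 < 2 ∧ sqSum z.2 < 2 :=
  ⟨lt_two_of_step_ne_zero (left_ne_zero_of_mul h), lt_two_of_step_ne_zero (right_ne_zero_of_mul h)⟩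

theorem psi_eq_zero_of_notMem {z : Pairs} (h : z ∉ Metric.closedBall (0 : Pairs) 2) :
    psi z = 0 := by
  by_contra h'
  obtain ⟨h1, h2⟩ := psi_ne_zero h'
  apply h
  rw [mem_closedBall_zero_iff, Prod.norm_def]
  exact max_le (norm_le_of_sqSum_le (by norm_num) (by linarith))
    (norm_le_of_sqSum_le (by norm_num) (by linarith))

theorem integrable_psi : Integrable fun z => (psi z : ℂ) := by
  refine Continuous.integrable_of_hasCompactSupport
    (Complex.continuous_ofReal.comp continuous_psi) ?_
  refine HasCompactSupport.of_support_subset_isCompact (isCompact_closedBall (0 : Pairs) 2) ?_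
  intro z hz
  by_contra h
  exact hz (by simp [psi_eq_zero_of_notMem h])

theorem psi_act_K (z : Pairs) {k : G} (hk : k ∈ K) : psi (act k z) = psi z := by
  simp [psi, act, sqSum_vecMul_of_mem_K _ hk]

/-- The total mass of the weight `psi`. -/
def psiMass : ℝ := ∫ z in indep, psi z

theorem psiMass_pos : 0 < psiMass := by
  have hint : IntegrableOn psi indep := by
    have := integrable_psi.re
    exact (this.congr (Filter.Eventually.of_forall fun z => by simp)).integrableOn
  rw [psiMass, setIntegral_pos_iff_support_of_nonneg_ae
    (Filter.Eventually.of_forall fun z => psi_nonneg z) hint]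
  have hopen : IsOpen (Function.support psi ∩ indep) :=
    (continuous_psi.isOpen_support).inter isOpen_indep
  refine hopen.measure_pos volume ⟨(![0, 1, 0], ![0, 0, 1]), ?_, ?_⟩
  · have : step 1 = 1 := Real.smoothTransition.one_of_one_le (by norm_num)
    simp [psi, sqSum, this]
  · change (0 : ℝ) < _
    simp [lenQ, sqSum, cr_eq]

theorem ofReal_psiMass : ((psiMass : ℝ) : ℂ) = ∫ z in indep, (psi z : ℂ) :=
  (integral_ofReal).symm

theorem continuous_coe_K : Continuous fun k : K => (k.1.1 : Matrix (Fin 3) (Fin 3) ℝ) :=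
  Matrix.SpecialLinearGroup.isClosedEmbedding_val.continuous.comp continuous_subtype_val

/-- The inner average over `K`: for every independent pair `z = b k`, translating by `K` and
averaging turns the quotient of characters into the spherical function. -/
theorem integral_K_chr_div (ν : frakADual) (x : G) {z : Pairs} (hz : z ∈ indep) :
    ∫ k : K, chr ν (act x (act k.1 z)) / chr ν (act k.1 z) ∂haarK = spherical ν x := by
  obtain ⟨k₁, hk₁, h⟩ := exists_iwasawa_pair hz
  have hone : ∀ k : G, k ∈ K → iwasawaA k = 0 := fun k hk => by
    have h1 : (1 : G) ∈ setN := fun i j _ => by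
      rw [Matrix.SpecialLinearGroup.coe_one, Matrix.one_apply]
    have := iwasawaA_eq h1 0 hk
    rwa [expA_zero, one_mul, one_mul] at this
  have e : ∀ k : K, chr ν (act x (act k.1 z)) / chr ν (act k.1 z) =
      (fun k : K => Complex.exp (((rho (iwasawaA (k.1 * x)) : ℝ) : ℂ) +
        Complex.I * ((ν (iwasawaA (k.1 * x)) : ℝ) : ℂ))) (⟨k₁, hk₁⟩ * k) := by
    intro k
    rw [← act_mul, chr, chr, ← Complex.exp_sub, h, h, hone _ (mul_mem hk₁ k.2)]
    simp only [Subgroup.coe_mul, ← mul_assoc, map_add, map_zero]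
    congr 1
    push_cast
    ring
  rw [integral_congr_ae (Filter.Eventually.of_forall e)]
  exact integral_mul_left_eq_self (μ := haarK) (fun k : K => Complex.exp
    (((rho (iwasawaA (k.1 * x)) : ℝ) : ℂ) +
      Complex.I * ((ν (iwasawaA (k.1 * x)) : ℝ) : ℂ))) ⟨k₁, hk₁⟩

/-- The spherical function as an average over pairs of rows with the `K`-invariant weight `psi`. -/
theorem spherical_formula (ν : frakADual) (x : G) :
    (psiMass : ℂ) * spherical ν x = ∫ z in indep, psi z * (chr ν (act x z) / chr ν z) := by
  set R := max 1 (max (fro x.1) (fro (x⁻¹).1)) with hR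
  have hbd : ∀ z, ‖chr ν (act x z) / chr ν z‖ ≤ R := fun z => by
    rw [norm_div, div_le_iff₀ (norm_pos_iff.mpr (chr_ne_zero ν z))]
    exact norm_chr_act_le (le_max_left _ _) ((le_max_left _ _).trans (le_max_right _ _))
      ((le_max_right _ _).trans (le_max_right _ _)) ν ν z
  have hmeas : Measurable fun z => chr ν (act x z) / chr ν z :=
    ((measurable_chr ν).comp (continuous_act x).measurable).div (measurable_chr ν)
  have hcont : Continuous fun p : Pairs × K => act p.2.1 p.1 := by
    have := continuous_coe_K
    unfold act
    refine Continuous.prodMk ?_ ?_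
    · exact Continuous.matrix_vecMul (by fun_prop) (this.comp continuous_snd)
    · exact Continuous.matrix_vecMul (by fun_prop) (this.comp continuous_snd)
  have hint : Integrable (fun p : Pairs × K => (psi p.1 : ℂ) *
      (chr ν (act x (act p.2.1 p.1)) / chr ν (act p.2.1 p.1)))
      ((volume.restrict indep).prod haarK) := by
    have h1 : Integrable (fun p : Pairs × K => (psi p.1 : ℂ) * (1 : ℂ))
        ((volume.restrict indep).prod haarK) :=
      integrable_psi.restrict.mul_prod (integrable_const (1 : ℂ))
    simp only [mul_one] at h1
    exact h1.mul_bdd (c := R) (hmeas.comp hcont.measurable).aestronglyMeasurable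
      (Filter.Eventually.of_forall fun p => hbd _)
  have hswap := integral_integral_swap (f := fun z (k : K) => (psi z : ℂ) *
    (chr ν (act x (act k.1 z)) / chr ν (act k.1 z))) hint
  have hl : ∫ z in indep, ∫ k : K, (psi z : ℂ) *
      (chr ν (act x (act k.1 z)) / chr ν (act k.1 z)) ∂haarK =
      (psiMass : ℂ) * spherical ν x := by
    rw [ofReal_psiMass, ← integral_mul_const]
    refine setIntegral_congr_fun measurableSet_indep fun z hz => ?_
    rw [integral_const_mul, integral_K_chr_div ν x hz]
  have hr : ∀ k : K, ∫ z in indep, (psi z : ℂ) *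
      (chr ν (act x (act k.1 z)) / chr ν (act k.1 z)) =
      ∫ z in indep, psi z * (chr ν (act x z) / chr ν z) := fun k => by
    rw [← setIntegral_act k.1 fun z => (psi z : ℂ) * (chr ν (act x z) / chr ν z)]
    congr 1
    funext z
    rw [psi_act_K z k.2]
  rw [← hl, hswap]
  simp only [hr]
  simp

theorem chr_act_K (ν : frakADual) (z : Pairs) {k : G} (hk : k ∈ K) :
    chr ν (act k z) = chr ν z := by
  have h1 : lenP (act k z) = lenP z := sqSum_vecMul_of_mem_K _ hk
  have h2 : lenQ (act k z) = lenQ z := by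
    have hk' := inv_mem hk
    have e : (k⁻¹).1ᵀ ∈ {x : Matrix (Fin 3) (Fin 3) ℝ | x * xᵀ = 1} := by
      have : (k⁻¹).1 * (k⁻¹).1ᵀ = 1 := hk'
      rw [Set.mem_ofPred_eq, Matrix.transpose_transpose]
      exact mul_eq_one_comm.mp this
    have h3 := sqSum_vecMul_of_mem_K (cr z) (k := trG k⁻¹) e
    rw [lenQ, cr_act, lenQ, ← h3, trG, Matrix.vecMul_transpose]
  rw [chr, chr, iwaP, iwaP, h1, h2]

theorem spherical_mul_K (ν : frakADual) (x : G) {k : G} (hk : k ∈ K) :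
    spherical ν (x * k) = spherical ν x := by
  have h : (psiMass : ℂ) ≠ 0 := Complex.ofReal_ne_zero.mpr psiMass_pos.ne'
  apply mul_left_cancel₀ h
  rw [spherical_formula, spherical_formula]
  simp only [act_mul, chr_act_K ν _ hk]

theorem spherical_K_mul (ν : frakADual) (x : G) {k : G} (hk : k ∈ K) :
    spherical ν (k * x) = spherical ν x := by
  have h : (psiMass : ℂ) ≠ 0 := Complex.ofReal_ne_zero.mpr psiMass_pos.ne'
  apply mul_left_cancel₀ h
  rw [spherical_formula, spherical_formula,
    ← setIntegral_act k fun z => (psi z : ℂ) * (chr ν (act x z) / chr ν z)]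
  simp only [act_mul, psi_act_K _ hk, chr_act_K ν _ hk]

/-- Spherical functions are invariant under transposition, since `xᵀ ∈ K x K`. -/
theorem spherical_trG (ν : frakADual) (x : G) : spherical ν (trG x) = spherical ν x := by
  obtain ⟨k, hk, h⟩ := exists_trG_eq x
  rw [h, spherical_mul_K ν _ hk, spherical_K_mul ν _ hk]

theorem trG_mul (a b : G) : trG (a * b) = trG b * trG a :=
  Subtype.ext (Matrix.transpose_mul a.1 b.1)

theorem trG_expA (H : frakA) : trG (expA H) = expA H :=
  Subtype.ext (Matrix.diagonal_transpose _)

/-! ### Decoupling the two integrals over `𝔞` -/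

theorem sqSum_expA_bounds (v : Fin 3 → ℝ) {H : frakA} (hH : ‖H‖ ≤ 1) :
    sqSum (v ᵥ* (expA H).1) ≤ Real.exp 2 * sqSum v ∧
      sqSum v ≤ Real.exp 2 * sqSum (v ᵥ* (expA H).1) := by
  have e : ∀ {H : frakA}, ‖H‖ ≤ 1 → ∀ v, sqSum (v ᵥ* (expA H).1) ≤ Real.exp 2 * sqSum v := by
    intro H hH v
    have h : sqSum (v ᵥ* (expA H).1) = wSum (v ^ 2) H := by
      rw [wSum_eq]
      have e2 : ∀ x : ℝ, Real.exp (2 * x) = Real.exp x ^ 2 := fun x => by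
        rw [← Real.exp_nat_mul]; norm_num
      simp [sqSum, expA_val, Matrix.vecMul_diagonal, e2, mul_pow]
    rw [h]
    exact (wSum_bounds (m := v ^ 2) (fun i => sq_nonneg _) hH).2
  refine ⟨e hH v, ?_⟩
  have := e (H := -H) (by rwa [norm_neg]) (v ᵥ* (expA H).1)
  rwa [Matrix.vecMul_vecMul, ← Matrix.SpecialLinearGroup.coe_mul, expA_neg, mul_inv_cancel,
    Matrix.SpecialLinearGroup.coe_one, Matrix.vecMul_one] at this

theorem exp_two_lt : Real.exp 2 < 8 := by
  have h := Real.exp_one_lt_d9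
  have : Real.exp 2 = Real.exp 1 * Real.exp 1 := by rw [← Real.exp_add]; norm_num
  rw [this]
  nlinarith [Real.exp_pos 1]

/-- If the weight does not vanish at `z exp(H)` with `H` in the unit ball, then `z` is bounded. -/
theorem sqSum_le_of_psi_ne_zero {z : Pairs} {H : frakA} (hH : ‖H‖ ≤ 1)
    (h : psi (act (expA H) z) ≠ 0) : sqSum z.1 ≤ 16 ∧ sqSum z.2 ≤ 16 := by
  obtain ⟨h1, h2⟩ := psi_ne_zero h
  have e := exp_two_lt
  have e0 := Real.exp_pos 2
  constructor
  · refine (sqSum_expA_bounds z.1 hH).2.trans ?_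
    calc Real.exp 2 * _ ≤ 8 * 2 := mul_le_mul e.le h1.le (sqSum_nonneg _) (by norm_num)
      _ = 16 := by norm_num
  · refine (sqSum_expA_bounds z.2 hH).2.trans ?_
    calc Real.exp 2 * _ ≤ 8 * 2 := mul_le_mul e.le h2.le (sqSum_nonneg _) (by norm_num)
      _ = 16 := by norm_num

theorem fro_expA_le (x : G) {H H' : frakA} (hH : ‖H‖ ≤ 1) (hH' : ‖H'‖ ≤ 1) :
    fro (expA H * x * expA H').1 ≤ Real.exp 4 * fro x.1 := by
  have e4 : Real.exp 4 = Real.exp 2 * Real.exp 2 := by rw [← Real.exp_add]; norm_num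
  have b : ∀ i, Real.exp (H.1 i) ^ 2 ≤ Real.exp 2 := fun i => by
    rw [← Real.exp_nat_mul]; exact_mod_cast (exp_coord_bounds hH i).2
  have r : ∀ i, sqSum ((expA H * x * expA H').1 i) ≤ Real.exp 4 * sqSum (x.1 i) := by
    intro i
    have h1 : (expA H * x * expA H').1 i =
        (Real.exp (H.1 i) • x.1 i) ᵥ* (expA H').1 := by
      rw [Matrix.SpecialLinearGroup.coe_mul, Matrix.SpecialLinearGroup.coe_mul, expA_val H]
      funext j
      rw [Matrix.mul_apply_eq_vecMul]
      congr 2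
      funext k
      simp [Matrix.diagonal_mul]
    rw [h1]
    refine (sqSum_expA_bounds _ hH').1.trans ?_
    have h2 : sqSum (Real.exp (H.1 i) • x.1 i) = Real.exp (H.1 i) ^ 2 * sqSum (x.1 i) := by
      simp [sqSum]; ring
    rw [h2, e4, mul_assoc]
    have := mul_le_mul_of_nonneg_right (b i) (sqSum_nonneg (x.1 i))
    gcongr
  simp only [fro]
  linarith [r 0, r 1, r 2]

/-- Fubini's theorem for an integrand that decouples for a fixed value of the third variable, in
both orders of the first two. -/
theorem integral_decouple {X Y Z : Type*} [MeasurableSpace X] [MeasurableSpace Y]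
    [MeasurableSpace Z] {μ : Measure X} {μ' : Measure Y} {μ'' : Measure Z} [SFinite μ]
    [SFinite μ'] [SFinite μ''] {f : X → Z → ℂ} {h : Y → Z → ℂ}
    (hint : Integrable (fun p : (X × Y) × Z => f p.1.1 p.2 * h p.1.2 p.2)
      ((μ.prod μ').prod μ'')) :
    (∫ x, ∫ y, ∫ z, f x z * h y z ∂μ'' ∂μ' ∂μ =
      ∫ z, (∫ x, f x z ∂μ) * (∫ y, h y z ∂μ') ∂μ'') ∧
    (∫ y, ∫ x, ∫ z, f x z * h y z ∂μ'' ∂μ ∂μ' =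
      ∫ z, (∫ x, f x z ∂μ) * (∫ y, h y z ∂μ') ∂μ'') := by
  have h1 : Integrable (fun p : X × Y => ∫ z, f p.1 z * h p.2 z ∂μ'') (μ.prod μ') :=
    hint.integral_prod_left
  have h2 : ∫ x, ∫ y, ∫ z, f x z * h y z ∂μ'' ∂μ' ∂μ =
      ∫ z, (∫ x, f x z ∂μ) * (∫ y, h y z ∂μ') ∂μ'' := by
    rw [← integral_prod _ h1, integral_integral_swap hint]
    congr 1
    funext z
    exact integral_prod_mul (fun x => f x z) (fun y => h y z)
  refine ⟨h2, ?_⟩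
  rw [← h2]
  exact (integral_integral_swap h1).symm

/-- The part of the decoupled integrand that involves the first variable of `𝔞`. -/
def kerL (b : frakA → ℂ) (t : ℝ) (l ν : frakADual) (H : frakA) (z : Pairs) : ℂ :=
  b H * Complex.exp (Complex.I * ((t * l H : ℝ) : ℂ)) *
    ((psi (act (expA H) z) : ℂ) / chr (t • ν) (act (expA H) z))

/-- The part of the decoupled integrand that involves the second variable of `𝔞`. -/
def kerR (b : frakA → ℂ) (t : ℝ) (l ν : frakADual) (H : frakA) (z : Pairs) : ℂ :=
  b H * Complex.exp (-(Complex.I * ((t * l H : ℝ) : ℂ))) * chr (t • ν) (act (expA H) z)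

theorem continuous_act_expA : Continuous fun p : frakA × Pairs => act (expA p.1) p.2 := by
  have h : Continuous fun H : frakA => (expA H).1 := by
    simp only [expA_val]
    refine Continuous.matrix_diagonal (continuous_pi fun i => ?_)
    exact Real.continuous_exp.comp (coord i).continuous
  have h' : Continuous fun p : frakA × Pairs => (expA p.1).1 := h.comp continuous_fst
  unfold act
  exact Continuous.prodMk (Continuous.matrix_vecMul (by fun_prop) h')
    (Continuous.matrix_vecMul (by fun_prop) h')

theorem measurable_kerL {b : frakA → ℂ} (hb : Continuous b) (t : ℝ) (l ν : frakADual) :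
    Measurable fun p : frakA × Pairs => kerL b t l ν p.1 p.2 := by
  have h1 := continuous_act_expA.measurable
  have h2 := (Complex.continuous_ofReal.comp continuous_psi).measurable.comp h1
  have h3 := (measurable_chr (t • ν)).comp h1
  have h4 : Continuous fun p : frakA × Pairs =>
      b p.1 * Complex.exp (Complex.I * ((t * l p.1 : ℝ) : ℂ)) := by fun_prop
  exact h4.measurable.mul (h2.div h3)

theorem measurable_kerR {b : frakA → ℂ} (hb : Continuous b) (t : ℝ) (l ν : frakADual) :
    Measurable fun p : frakA × Pairs => kerR b t l ν p.1 p.2 := by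
  have h1 := continuous_act_expA.measurable
  have h3 := (measurable_chr (t • ν)).comp h1
  have h4 : Continuous fun p : frakA × Pairs =>
      b p.1 * Complex.exp (-(Complex.I * ((t * l p.1 : ℝ) : ℂ))) := by fun_prop
  exact h4.measurable.mul h3

theorem norm_kerL (b : frakA → ℂ) (t : ℝ) (l ν : frakADual) (H : frakA) (z : Pairs) :
    ‖kerL b t l ν H z‖ = ‖b H‖ * (psi (act (expA H) z) / ‖chr (t • ν) (act (expA H) z)‖) := by
  rw [kerL, norm_mul, norm_mul, norm_exp_I_mul, mul_one, norm_div, Complex.norm_real,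
    Real.norm_of_nonneg (psi_nonneg _)]

theorem norm_kerR (b : frakA → ℂ) (t : ℝ) (l ν : frakADual) (H : frakA) (z : Pairs) :
    ‖kerR b t l ν H z‖ = ‖b H‖ * ‖chr (t • ν) (act (expA H) z)‖ := by
  rw [kerR, norm_mul, norm_mul, Complex.exp_neg, norm_inv, norm_exp_I_mul, inv_one, mul_one]

/-- The kernel is bounded with compact support: the factor `‖chr‖⁻¹` of `kerL` and the factor
`‖chr‖` of `kerR` compensate each other up to a constant, although the latter is unbounded near the
dependent pairs. -/
theorem integrable_kernel {n : ℕ} {D : ℝ} {b₁ b₂ : frakA → ℂ} (hb₁ : IsCutoff n D b₁)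
    (hb₂ : IsCutoff n D b₂) (t : ℝ) (l₁ l₂ ν : frakADual) (g : G) :
    Integrable (fun p : (frakA × frakA) × Pairs =>
      kerL b₁ t l₁ ν p.1.1 p.2 * kerR b₂ t l₂ ν p.1.2 (act g p.2))
      ((volume.prod volume).prod (volume.restrict indep)) := by
  set R := max 1 (Real.exp 4 * max (fro g.1) (fro (g⁻¹).1)) with hR
  set S : Set ((frakA × frakA) × Pairs) :=
    (Metric.closedBall 0 1 ×ˢ Metric.closedBall 0 1) ×ˢ Metric.closedBall 0 4 with hS
  have hSc : IsCompact S :=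
    ((isCompact_closedBall _ _).prod (isCompact_closedBall _ _)).prod (isCompact_closedBall _ _)
  have hD := hb₁.isBump.nonneg
  have hsupp : Function.support (fun p : (frakA × frakA) × Pairs =>
      kerL b₁ t l₁ ν p.1.1 p.2 * kerR b₂ t l₂ ν p.1.2 (act g p.2)) ⊆ S := by
    intro p hp
    have h1 := left_ne_zero_of_mul hp
    have h2 := right_ne_zero_of_mul hp
    have hH1 : p.1.1 ∈ Metric.closedBall (0 : frakA) 1 := by
      by_contra h
      exact h1 (by rw [kerL, hb₁.isBump.eq_zero h]; simp)
    have hH2 : p.1.2 ∈ Metric.closedBall (0 : frakA) 1 := by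
      by_contra h
      exact h2 (by rw [kerR, hb₂.isBump.eq_zero h]; simp)
    have hz : psi (act (expA p.1.1) p.2) ≠ 0 := fun h => h1 (by rw [kerL, h]; simp)
    obtain ⟨h3, h4⟩ := sqSum_le_of_psi_ne_zero (mem_closedBall_zero_iff.mp hH1) hz
    refine ⟨⟨hH1, hH2⟩, ?_⟩
    rw [mem_closedBall_zero_iff, Prod.norm_def]
    exact max_le (norm_le_of_sqSum_le (by norm_num) (by linarith))
      (norm_le_of_sqSum_le (by norm_num) (by linarith))
  have hmeas : Measurable (fun p : (frakA × frakA) × Pairs =>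
      kerL b₁ t l₁ ν p.1.1 p.2 * kerR b₂ t l₂ ν p.1.2 (act g p.2)) := by
    refine ((measurable_kerL hb₁.contDiff.continuous t l₁ ν).comp
      (f := fun p : (frakA × frakA) × Pairs => (p.1.1, p.2)) (by fun_prop)).mul
      ((measurable_kerR hb₂.contDiff.continuous t l₂ ν).comp
      (f := fun p : (frakA × frakA) × Pairs => (p.1.2, act g p.2)) ?_)
    exact Measurable.prodMk (by fun_prop) ((continuous_act g).measurable.comp measurable_snd)
  rw [← integrableOn_iff_integrable_of_support_subset hsupp]
  refine Measure.integrableOn_of_bounded (M := D * D * R) hSc.measure_lt_top.ne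
    hmeas.aestronglyMeasurable ?_
  refine (ae_restrict_mem hSc.measurableSet).mono fun p hp => ?_
  obtain ⟨⟨h1, h2⟩, -⟩ := hp
  rw [mem_closedBall_zero_iff] at h1 h2
  rw [norm_mul, norm_kerL, norm_kerR]
  have hc : ‖chr (t • ν) (act (expA p.1.2) (act g p.2))‖ ≤
      R * ‖chr (t • ν) (act (expA p.1.1) p.2)‖ := by
    have e : act (expA p.1.2) (act g p.2) =
        act (expA (-p.1.1) * g * expA p.1.2) (act (expA p.1.1) p.2) := by
      rw [← act_mul, ← act_mul, expA_neg]
      congr 1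
      group
    rw [e]
    refine norm_chr_act_le (le_max_left _ _) ?_ ?_ _ _ _
    · refine (fro_expA_le g (by rwa [norm_neg]) h2).trans ?_
      refine le_max_of_le_right ?_
      gcongr
      exact le_max_left _ _
    · have e2 : (expA (-p.1.1) * g * expA p.1.2)⁻¹ = expA (-p.1.2) * g⁻¹ * expA p.1.1 := by
        rw [expA_neg, expA_neg]; group
      rw [e2]
      refine (fro_expA_le g⁻¹ (by rwa [norm_neg]) h1).trans ?_
      refine le_max_of_le_right ?_
      gcongr
      exact le_max_right _ _
  have hpos := norm_pos_iff.mpr (chr_ne_zero (t • ν) (act (expA p.1.1) p.2))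
  have hR0 : 0 ≤ R := le_max_of_le_left zero_le_one
  calc _ ≤ D * (1 / ‖chr (t • ν) (act (expA p.1.1) p.2)‖) *
        (D * (R * ‖chr (t • ν) (act (expA p.1.1) p.2)‖)) := by
        gcongr
        · exact div_nonneg (psi_nonneg _) (norm_nonneg _)
        · exact hb₁.isBump.norm_le _
        · exact psi_le_one _
        · exact hb₂.isBump.norm_le _
    _ = D * D * R := by field_simp

/-- The integrand of `flatIntegral` as an integral over pairs of rows of a product. -/
theorem psiMass_mul_integrand (b₁ b₂ : frakA → ℂ) (t : ℝ) (l₁ l₂ ν : frakADual) (g : G)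
    (H₁ H₂ : frakA) : (psiMass : ℂ) * (b₁ H₁ * b₂ H₂ *
      Complex.exp (Complex.I * ((t * (l₁ H₁ - l₂ H₂) : ℝ) : ℂ)) *
      spherical (t • ν) (expA (-H₁) * g * expA H₂)) =
    ∫ z in indep, kerL b₁ t l₁ ν H₁ z * kerR b₂ t l₂ ν H₂ (act g z) := by
  rw [mul_left_comm, spherical_formula, ← setIntegral_act (expA H₁), ← integral_const_mul]
  congr 1
  funext z
  have e : act (expA (-H₁) * g * expA H₂) (act (expA H₁) z) = act (expA H₂) (act g z) := by
    rw [← act_mul, ← act_mul, expA_neg]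
    congr 1
    group
  have e2 : Complex.exp (Complex.I * ((t * (l₁ H₁ - l₂ H₂) : ℝ) : ℂ)) =
      Complex.exp (Complex.I * ((t * l₁ H₁ : ℝ) : ℂ)) *
        Complex.exp (-(Complex.I * ((t * l₂ H₂ : ℝ) : ℂ))) := by
    rw [← Complex.exp_add]
    congr 1
    push_cast
    ring
  rw [e, e2, kerL, kerR]
  ring

/-- The decoupling of the two integrals over `𝔞` for a fixed pair of rows. -/
theorem psiMass_mul_flatIntegral {n : ℕ} {D : ℝ} {b₁ b₂ : frakA → ℂ} (hb₁ : IsCutoff n D b₁)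
    (hb₂ : IsCutoff n D b₂) (t : ℝ) (l₁ l₂ ν : frakADual) (g : G) :
    (psiMass : ℂ) * flatIntegral b₁ b₂ t l₁ l₂ ν g =
      ∫ z in indep, (∫ H, kerL b₁ t l₁ ν H z) * ∫ H, kerR b₂ t l₂ ν H (act g z) := by
  rw [← (integral_decouple (f := kerL b₁ t l₁ ν) (h := fun H z => kerR b₂ t l₂ ν H (act g z))
    (integrable_kernel hb₁ hb₂ t l₁ l₂ ν g)).1, flatIntegral]
  simp only [← psiMass_mul_integrand, integral_const_mul]

/-- Transposing `g` amounts to exchanging the two cutoff functions and their frequencies. -/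
theorem flatIntegral_trG {n : ℕ} {D : ℝ} {b₁ b₂ : frakA → ℂ} (hb₁ : IsCutoff n D b₁)
    (hb₂ : IsCutoff n D b₂) (t : ℝ) (l₁ l₂ ν : frakADual) (g : G) :
    flatIntegral b₁ b₂ t l₁ l₂ ν g =
      flatIntegral (fun H => b₂ (-H)) (fun H => b₁ (-H)) t l₂ l₁ ν (trG g) := by
  have h := integral_decouple (f := kerL b₁ t l₁ ν) (h := fun H z => kerR b₂ t l₂ ν H (act g z))
    (integrable_kernel hb₁ hb₂ t l₁ l₂ ν g)
  have h' := h.1.trans h.2.symm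
  simp only [← psiMass_mul_integrand, integral_const_mul] at h'
  have h0 : (psiMass : ℂ) ≠ 0 := Complex.ofReal_ne_zero.mpr psiMass_pos.ne'
  rw [flatIntegral, mul_left_cancel₀ h0 h', flatIntegral, ← integral_neg_eq_self]
  congr 1
  funext H₂
  rw [← integral_neg_eq_self]
  congr 1
  funext H₁
  have e : expA (-H₂) * trG g * expA H₁ = trG (expA (- -H₁) * g * expA (-H₂)) := by
    rw [trG_mul, trG_mul, trG_expA, trG_expA, neg_neg, mul_assoc]
  rw [e, spherical_trG]
  simp only [map_neg]
  rw [show -l₁ H₁ - -l₂ H₂ = l₂ H₂ - l₁ H₁ by ring, mul_comm (b₁ (-H₁))]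

theorem IsCutoff.neg {n : ℕ} {D : ℝ} {b : frakA → ℂ} (h : IsCutoff n D b) :
    IsCutoff n D fun H => b (-H) := by
  refine ⟨h.contDiff.comp contDiff_neg, ?_, fun m hm H => ?_⟩
  · have e : (fun H => b (-H)) = b ∘ (Homeomorph.neg frakA) := rfl
    rw [e, tsupport_comp_eq_preimage]
    intro H hH
    have := h.tsupport_subset hH
    simpa using this
  · exact ((LinearIsometryEquiv.neg ℝ (E := frakA)).norm_iteratedFDeriv_comp_right b H m).trans_le
      (h.deriv_le m hm (-H))

/-! ### Bounds for the two factors -/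

/-- The normalised third row. -/
def unitS (z : Pairs) : Fin 3 → ℝ := fun i => z.2 i / √(lenP z)

/-- The normalised cross product of the second and third rows. -/
def unitR (z : Pairs) : Fin 3 → ℝ := fun i => cr z i / √(lenQ z)

/-- The value of `tau` at the normalised vectors of a pair of rows, comparable to the squared
distance of its `K`-component to `M`. -/
def tauP (z : Pairs) : ℝ :=
  (z.2 0 ^ 2 + z.2 1 ^ 2) / lenP z + (cr z 1 ^ 2 + cr z 2 ^ 2) / lenQ z

theorem sqSum_div {v : Fin 3 → ℝ} (h : 0 < sqSum v) :
    sqSum (fun i => v i / √(sqSum v)) = 1 := by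
  have e : sqSum (fun i => v i / √(sqSum v)) = sqSum v / √(sqSum v) ^ 2 := by
    rw [sqSum, sqSum]; ring
  rw [e, Real.sq_sqrt h.le, div_self h.ne']

theorem sqSum_unitS {z : Pairs} (hz : z ∈ indep) : sqSum (unitS z) = 1 :=
  sqSum_div (lenP_pos_of_mem hz)

theorem sqSum_unitR {z : Pairs} (hz : z ∈ indep) : sqSum (unitR z) = 1 :=
  sqSum_div (show 0 < lenQ z from hz)

theorem unitS_dotProduct_unitR (z : Pairs) : unitS z ⬝ᵥ unitR z = 0 := by
  simp only [unitS, unitR, dotProduct, Fin.sum_univ_three, cr_eq]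
  simp
  ring

theorem tau_unit {z : Pairs} (hz : z ∈ indep) : tau (unitS z) (unitR z) = tauP z := by
  simp only [tau, unitS, unitR, tauP, div_pow, Real.sq_sqrt (lenP_pos_of_mem hz).le,
    Real.sq_sqrt (show 0 < lenQ z from hz).le]
  ring

theorem sqSum_vecMul_expA (v : Fin 3 → ℝ) (H : frakA) :
    sqSum (v ᵥ* (expA H).1) = wSum (v ^ 2) H := by
  rw [wSum_eq]
  have e2 : ∀ x : ℝ, Real.exp (2 * x) = Real.exp x ^ 2 := fun x => by
    rw [← Real.exp_nat_mul]; norm_num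
  simp [sqSum, expA_val, Matrix.vecMul_diagonal, e2, mul_pow]

theorem wSum_div_sqrt (v : Fin 3 → ℝ) {L : ℝ} (hL : 0 < L) (H : frakA) :
    wSum (v ^ 2) H = L * wSum ((fun i => v i / √L) ^ 2) H := by
  simp only [wSum_eq, Pi.pow_apply, div_pow, Real.sq_sqrt hL.le]
  field_simp

theorem lenP_act_expA {z : Pairs} (hz : z ∈ indep) (H : frakA) :
    lenP (act (expA H) z) = lenP z * wSum (unitS z ^ 2) H := by
  rw [lenP, act, sqSum_vecMul_expA]
  exact wSum_div_sqrt _ (lenP_pos_of_mem hz) H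

theorem lenQ_act_expA {z : Pairs} (hz : z ∈ indep) (H : frakA) :
    lenQ (act (expA H) z) = lenQ z * wSum (unitR z ^ 2) (-H) := by
  have e : (expA (-H)).1 *ᵥ cr z = cr z ᵥ* (expA (-H)).1 := by
    rw [← Matrix.vecMul_transpose, expA_val, Matrix.diagonal_transpose]
  rw [lenQ, cr_act, ← expA_neg, e, sqSum_vecMul_expA]
  exact wSum_div_sqrt _ hz (-H)

theorem iwaP_act_expA {z : Pairs} (hz : z ∈ indep) (H : frakA) : iwaP (act (expA H) z) =
    iwaP z + iwa (wSum (unitS z ^ 2) H) (wSum (unitR z ^ 2) (-H)) := by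
  have hp := wSum_pos (s := unitS z) (by rw [sqSum_unitS hz]; norm_num) H
  have hq := wSum_pos (s := unitR z) (by rw [sqSum_unitR hz]; norm_num) (-H)
  rw [iwaP, iwaP, lenP_act_expA hz, lenQ_act_expA hz, iwa, iwa, iwa,
    Real.log_mul (lenP_pos_of_mem hz).ne' hp.ne', Real.log_mul (show 0 < lenQ z from hz).ne' hq.ne']
  module

/-- The smooth function `(s, r, H) ↦ e^{-ρ(A(g exp H) - A(g))}`. -/
def ampR (x : ((Fin 3 → ℝ) × (Fin 3 → ℝ)) × frakA) : ℝ :=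
  Real.exp ((Real.log (posSum x.1.1 x.2) + Real.log (posSum x.1.2 (-x.2))) / 2)

theorem contDiff_ampR : ContDiff ℝ ∞ ampR := by
  have h1 : ContDiff ℝ ∞ fun x : ((Fin 3 → ℝ) × (Fin 3 → ℝ)) × frakA => posSum x.1.1 x.2 :=
    contDiff_posSum contDiff_fst.fst contDiff_snd
  have h2 : ContDiff ℝ ∞ fun x : ((Fin 3 → ℝ) × (Fin 3 → ℝ)) × frakA => posSum x.1.2 (-x.2) :=
    contDiff_posSum contDiff_fst.snd contDiff_snd.neg
  exact (((h1.log fun x => (posSum_pos _ _).ne').add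
    (h2.log fun x => (posSum_pos _ _).ne')).div_const 2).exp

theorem ampR_eq {z : Pairs} (hz : z ∈ indep) (H : frakA) : ampR ((unitS z, unitR z), H) =
    Real.exp (-rho (iwa (wSum (unitS z ^ 2) H) (wSum (unitR z ^ 2) (-H)))) := by
  rw [ampR, posSum_of_unit (sqSum_unitS hz), posSum_of_unit (sqSum_unitR hz), rho_iwa]
  congr 1
  ring

theorem chr_act_expA (t : ℝ) (ν : frakADual) {z : Pairs} (hz : z ∈ indep) (H : frakA) :
    chr (t • ν) (act (expA H) z) = chr (t • ν) z *
      (((ampR ((unitS z, unitR z), H))⁻¹ : ℝ) : ℂ) * Complex.exp (Complex.I *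
        ((t * ν (iwa (wSum (unitS z ^ 2) H) (wSum (unitR z ^ 2) (-H))) : ℝ) : ℂ)) := by
  rw [ampR_eq hz, ← Real.exp_neg, neg_neg, Complex.ofReal_exp, chr, chr, ← Complex.exp_add,
    ← Complex.exp_add, iwaP_act_expA hz]
  congr 1
  have hs : ∀ X, (t • ν) X = t * ν X := fun _ => rfl
  simp only [map_add, hs]
  push_cast
  ring

theorem norm_unit_le {z : Pairs} (hz : z ∈ indep) : ‖(unitS z, unitR z)‖ ≤ 1 := by
  rw [Prod.norm_def]
  exact max_le (norm_le_one_of_sqSum (sqSum_unitS hz)) (norm_le_one_of_sqSum (sqSum_unitR hz))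

/-- The bound for the second factor. Its phase is that of `exists_osc_bound` with both functionals
negated. -/
theorem exists_kerR_bound {B : Set frakADual} (hB : IsCompact B) (hBr : B ⊆ regular) (n : ℕ)
    (D : ℝ) : ∃ C₁ C : ℝ, 0 < C₁ ∧ 0 < C ∧ ∀ b : frakA → ℂ, IsCutoff n D b → ∀ ν ∈ B,
      ∀ l : frakADual, ∀ z ∈ indep, ∀ t : ℝ, 0 < t →
      ‖∫ H, kerR b t l ν H z‖ ≤ ‖chr (t • ν) z‖ * C ∧
      (0 < tauP z → C₁ * ‖l - ν‖ ≤ tauP z →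
        ‖∫ H, kerR b t l ν H z‖ ≤ ‖chr (t • ν) z‖ * (C * (t * tauP z)⁻¹ ^ n)) := by
  have hB' : IsCompact ((fun ν => -ν) '' B) := hB.image continuous_neg
  have hBr' : (fun ν => -ν) '' B ⊆ regular := by
    rintro _ ⟨ν, hν, rfl⟩ i j hij
    have := hBr hν i j hij
    exact fun h => this (neg_eq_zero.mp h)
  have hamp : ContDiff ℝ ∞ fun x => (((ampR x)⁻¹ : ℝ) : ℂ) :=
    Complex.ofRealCLM.contDiff.comp (contDiff_ampR.inv fun x => (Real.exp_pos _).ne')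
  obtain ⟨C₁, C, hC₁, hC, h⟩ := exists_osc_bound hB' hBr' hamp
    (isCompact_closedBall (0 : (Fin 3 → ℝ) × (Fin 3 → ℝ)) 1) n D
  refine ⟨C₁, C, hC₁, hC, fun b hb ν hν l z hz t ht => ?_⟩
  have key := h b hb (-ν) ⟨ν, hν, rfl⟩ (-l) (unitS z) (unitR z) (sqSum_unitS hz) (sqSum_unitR hz)
    (unitS_dotProduct_unitR z) (unitS z, unitR z)
    (mem_closedBall_zero_iff.mpr (norm_unit_le hz)) t ht
  have e : ∫ H, kerR b t l ν H z = chr (t • ν) z * ∫ H, b H *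
      (((ampR ((unitS z, unitR z), H))⁻¹ : ℝ) : ℂ) * Complex.exp (Complex.I *
        ((t * phase (-l) (-ν) (unitS z) (unitR z) H : ℝ) : ℂ)) := by
    rw [← integral_const_mul]
    congr 1
    funext H
    have e2 : Complex.exp (Complex.I * ((t * phase (-l) (-ν) (unitS z) (unitR z) H : ℝ) : ℂ)) =
        Complex.exp (-(Complex.I * ((t * l H : ℝ) : ℂ))) * Complex.exp (Complex.I *
        ((t * ν (iwa (wSum (unitS z ^ 2) H) (wSum (unitR z ^ 2) (-H))) : ℝ) : ℂ)) := by
      rw [← Complex.exp_add, phase]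
      congr 1
      have hl : (-l) H = -(l H) := rfl
      have hν' : ∀ X, (-ν) X = -(ν X) := fun _ => rfl
      rw [hl, hν']
      push_cast
      ring
    rw [kerR, chr_act_expA t ν hz, e2]
    ring
  rw [tau_unit hz, show ‖-l - -ν‖ = ‖l - ν‖ by
    rw [neg_sub_neg]; exact norm_sub_rev ν l] at key
  rw [e, norm_mul]
  exact ⟨mul_le_mul_of_nonneg_left key.1 (norm_nonneg _),
    fun h1 h2 => mul_le_mul_of_nonneg_left (key.2 h1 h2) (norm_nonneg _)⟩

theorem kerL_integral_eq_zero {b : frakA → ℂ} {n : ℕ} {D : ℝ} (hb : IsCutoff n D b) (t : ℝ)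
    (l ν : frakADual) {z : Pairs} (hz : ¬ (sqSum z.1 ≤ 16 ∧ sqSum z.2 ≤ 16)) :
    ∫ H, kerL b t l ν H z = 0 := by
  rw [← integral_zero frakA ℂ]
  congr 1
  funext H
  by_cases hH : H ∈ Metric.closedBall (0 : frakA) 1
  · have : psi (act (expA H) z) = 0 := by
      by_contra h
      exact hz (sqSum_le_of_psi_ne_zero (mem_closedBall_zero_iff.mp hH) h)
    simp [kerL, this]
  · simp [kerL, hb.isBump.eq_zero hH]

/-- The smooth amplitude of the first factor: the weight `psi` at `z exp(H)` times `ampR`. -/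
def ampL (x : (Pairs × ((Fin 3 → ℝ) × (Fin 3 → ℝ))) × frakA) : ℝ :=
  step (wSum (x.1.1.1 ^ 2) x.2) * step (wSum (x.1.1.2 ^ 2) x.2) * ampR (x.1.2, x.2)

theorem contDiff_ampL : ContDiff ℝ ∞ ampL := by
  refine ContDiff.mul (ContDiff.mul (contDiff_step.comp ?_) (contDiff_step.comp ?_)) ?_
  · exact contDiff_wSum (contDiff_fst.fst.fst.pow 2) contDiff_snd
  · exact contDiff_wSum (contDiff_fst.fst.snd.pow 2) contDiff_snd
  · exact contDiff_ampR.comp (contDiff_fst.snd.prodMk contDiff_snd)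

/-- The bound for the first factor. -/
theorem exists_kerL_bound {B : Set frakADual} (hB : IsCompact B) (hBr : B ⊆ regular) (n : ℕ)
    (D : ℝ) : ∃ C₁ C : ℝ, 0 < C₁ ∧ 0 < C ∧ ∀ b : frakA → ℂ, IsCutoff n D b → ∀ ν ∈ B,
      ∀ l : frakADual, ∀ z ∈ indep, ∀ t : ℝ, 0 < t →
      ‖∫ H, kerL b t l ν H z‖ ≤ ‖chr (t • ν) z‖⁻¹ * C ∧
      (0 < tauP z → C₁ * ‖l - ν‖ ≤ tauP z →
        ‖∫ H, kerL b t l ν H z‖ ≤ ‖chr (t • ν) z‖⁻¹ * (C * (t * tauP z)⁻¹ ^ n)) := by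
  have hamp : ContDiff ℝ ∞ fun x => ((ampL x : ℝ) : ℂ) :=
    Complex.ofRealCLM.contDiff.comp contDiff_ampL
  obtain ⟨C₁, C, hC₁, hC, h⟩ := exists_osc_bound hB hBr hamp
    (isCompact_closedBall (0 : Pairs × ((Fin 3 → ℝ) × (Fin 3 → ℝ))) 4) n D
  refine ⟨C₁, C, hC₁, hC, fun b hb ν hν l z hz t ht => ?_⟩
  by_cases hbd : sqSum z.1 ≤ 16 ∧ sqSum z.2 ≤ 16
  · have hmem : ‖(z, (unitS z, unitR z))‖ ≤ 4 := by
      rw [Prod.norm_def]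
      refine max_le ?_ ((norm_unit_le hz).trans (by norm_num))
      rw [Prod.norm_def]
      exact max_le (norm_le_of_sqSum_le (by norm_num) (by linarith [hbd.1]))
        (norm_le_of_sqSum_le (by norm_num) (by linarith [hbd.2]))
    have key := h b hb ν hν l (unitS z) (unitR z) (sqSum_unitS hz) (sqSum_unitR hz)
      (unitS_dotProduct_unitR z) (z, (unitS z, unitR z)) (mem_closedBall_zero_iff.mpr hmem) t ht
    have e : ∫ H, kerL b t l ν H z = (chr (t • ν) z)⁻¹ * ∫ H, b H *
        ((ampL ((z, (unitS z, unitR z)), H) : ℝ) : ℂ) * Complex.exp (Complex.I *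
          ((t * phase l ν (unitS z) (unitR z) H : ℝ) : ℂ)) := by
      rw [← integral_const_mul]
      congr 1
      funext H
      have e2 : Complex.exp (Complex.I * ((t * phase l ν (unitS z) (unitR z) H : ℝ) : ℂ)) =
          Complex.exp (Complex.I * ((t * l H : ℝ) : ℂ)) * (Complex.exp (Complex.I *
          ((t * ν (iwa (wSum (unitS z ^ 2) H) (wSum (unitR z ^ 2) (-H))) : ℝ) : ℂ)))⁻¹ := by
        rw [← Complex.exp_neg, ← Complex.exp_add, phase]
        congr 1
        push_cast
        ring
      rw [kerL, chr_act_expA t ν hz, e2, ampL, psi, act, sqSum_vecMul_expA, sqSum_vecMul_expA]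
      have h0 : ((ampR ((unitS z, unitR z), H) : ℝ) : ℂ) ≠ 0 :=
        Complex.ofReal_ne_zero.mpr (Real.exp_pos _).ne'
      have h1 := chr_ne_zero (t • ν) z
      push_cast
      field_simp
    rw [tau_unit hz] at key
    rw [e, norm_mul, norm_inv]
    exact ⟨mul_le_mul_of_nonneg_left key.1 (by positivity),
      fun h1 h2 => mul_le_mul_of_nonneg_left (key.2 h1 h2) (by positivity)⟩
  · rw [kerL_integral_eq_zero hb t l ν hbd, norm_zero]
    exact ⟨by positivity, fun h1 _ => by positivity⟩

/-! ### Geometry near `M` -/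

/-- The independent pairs in a fixed bounded set. -/
def bdd : Set Pairs := {z | z ∈ indep ∧ sqSum z.1 ≤ 16 ∧ sqSum z.2 ≤ 16}

/-- The bounded pairs with `tauP z ≤ x`, whose `K`-component is at distance `O(√x)` from `M`. -/
def near (x : ℝ) : Set Pairs := {z | z ∈ bdd ∧ tauP z ≤ x}

theorem lenQ_le (z : Pairs) : lenQ z ≤ sqSum z.1 * sqSum z.2 := by
  rw [lenQ, cr_eq]
  simp only [sqSum, Matrix.cons_val_zero, Matrix.cons_val_one, Matrix.cons_val]
  nlinarith [sq_nonneg (z.1 0 * z.2 0 + z.1 1 * z.2 1 + z.1 2 * z.2 2)]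

theorem tauP_parts {z : Pairs} (hz : z ∈ indep) :
    z.2 0 ^ 2 + z.2 1 ^ 2 ≤ tauP z * lenP z ∧ cr z 1 ^ 2 + cr z 2 ^ 2 ≤ tauP z * lenQ z ∧
      0 ≤ tauP z := by
  have hP := lenP_pos_of_mem hz
  have hQ : 0 < lenQ z := hz
  have h1 : 0 ≤ (z.2 0 ^ 2 + z.2 1 ^ 2) / lenP z := by positivity
  have h2 : 0 ≤ (cr z 1 ^ 2 + cr z 2 ^ 2) / lenQ z := by positivity
  refine ⟨?_, ?_, add_nonneg h1 h2⟩
  · rw [← div_le_iff₀ hP, tauP]; linarith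
  · rw [← div_le_iff₀ hQ, tauP]; linarith

/-- Near `M`, the three coordinates `v₀`, `v₁`, `u₀` of the pair `(u, v)` are small. -/
theorem near_subset {x : ℝ} {z : Pairs} (hz : z ∈ near x) :
    z.2 0 ^ 2 ≤ 144 * x ∧ z.2 1 ^ 2 ≤ 144 * x ∧ z.1 0 ^ 2 ≤ 144 * x := by
  obtain ⟨⟨hi, hu, hv⟩, hx⟩ := hz
  obtain ⟨h1, h2, h0⟩ := tauP_parts hi
  have hP := lenP_pos_of_mem hi
  have hQ : 0 < lenQ z := hi
  have hx0 : 0 ≤ x := h0.trans hx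
  have h1' : z.2 0 ^ 2 + z.2 1 ^ 2 ≤ x * lenP z := h1.trans (by gcongr)
  have h2' : cr z 1 ^ 2 + cr z 2 ^ 2 ≤ x * (sqSum z.1 * lenP z) :=
    h2.trans (mul_le_mul hx (lenQ_le z) hQ.le hx0)
  have hP16 : lenP z ≤ 16 := hv
  have hx16 : x * lenP z ≤ x * 16 := by gcongr
  have p0 := sq_nonneg (z.2 0)
  have p1 := sq_nonneg (z.2 1)
  refine ⟨by linarith, by linarith, ?_⟩
  have hu' : z.1 0 ^ 2 + z.1 1 ^ 2 + z.1 2 ^ 2 = sqSum z.1 := rfl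
  have q0 := sq_nonneg (z.1 0)
  have q1 := sq_nonneg (z.1 1)
  have q2 := sq_nonneg (z.1 2)
  rcases le_or_gt (1 / 2) x with h | h
  · linarith
  · have hv2 : lenP z ≤ 2 * z.2 2 ^ 2 := by
      have e : lenP z = z.2 0 ^ 2 + z.2 1 ^ 2 + z.2 2 ^ 2 := rfl
      have : x * lenP z ≤ 1 / 2 * lenP z := by gcongr
      linarith
    have hc : cr z 1 = z.1 2 * z.2 0 - z.1 0 * z.2 2 := by rw [cr_eq]; rfl
    have e1 : (z.1 0 * z.2 2) ^ 2 ≤ 2 * cr z 1 ^ 2 + 2 * (z.1 2 ^ 2 * z.2 0 ^ 2) := by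
      rw [hc]
      nlinarith [sq_nonneg (2 * (z.1 2 * z.2 0) - z.1 0 * z.2 2)]
    have e2 : z.1 2 ^ 2 * z.2 0 ^ 2 ≤ sqSum z.1 * (x * lenP z) :=
      mul_le_mul (by linarith) (by linarith) p0 (sqSum_nonneg _)
    have e3 : cr z 1 ^ 2 ≤ x * (sqSum z.1 * lenP z) := by linarith [sq_nonneg (cr z 2)]
    have e4 : z.1 0 ^ 2 * lenP z ≤ (8 * x * sqSum z.1) * lenP z := by
      have : z.1 0 ^ 2 * lenP z ≤ z.1 0 ^ 2 * (2 * z.2 2 ^ 2) := by gcongr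
      rw [mul_pow] at e1
      linarith
    have e5 := le_of_mul_le_mul_right e4 hP
    have e6 : x * sqSum z.1 ≤ x * 16 := by gcongr
    linarith

/-- Three of the six coordinates are `O(√x)` on `near x`, and the others are bounded. -/
theorem volume_near_le {x : ℝ} (hx : 0 < x) :
    volume.real (near x) ≤ 24 ^ 3 * 8 ^ 3 * x ^ (3 / 2 : ℝ) := by
  set a := 12 * √x with ha
  have ha0 : 0 < a := by positivity
  have ha2 : a ^ 2 = 144 * x := by rw [ha, mul_pow, Real.sq_sqrt hx.le]; norm_num
  have box : near x ⊆ (Set.pi univ fun i => Icc (-(![a, 4, 4] : Fin 3 → ℝ) i) (![a, 4, 4] i)) ×ˢ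
      (Set.pi univ fun i => Icc (-(![a, a, 4] : Fin 3 → ℝ) i) (![a, a, 4] i)) := by
    intro z hz
    obtain ⟨h1, h2, h3⟩ := near_subset hz
    obtain ⟨⟨-, hu, hv⟩, -⟩ := hz
    rw [← ha2] at h1 h2 h3
    have m : ∀ v : Fin 3 → ℝ, sqSum v ≤ 16 → ∀ i, v i ∈ Icc (-4 : ℝ) 4 := fun v hv i =>
      abs_le.mp ((norm_le_pi_norm v i).trans (norm_le_of_sqSum_le (by norm_num) (by linarith)))
    have ma : ∀ y : ℝ, y ^ 2 ≤ a ^ 2 → y ∈ Icc (-a) a := fun y hy =>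
      abs_le.mp (abs_le_of_sq_le_sq hy ha0.le)
    constructor
    · intro i _
      fin_cases i
      exacts [ma _ h3, m _ hu 1, m _ hu 2]
    · intro i _
      fin_cases i
      exacts [ma _ h1, ma _ h2, m _ hv 2]
  have hvol : volume.real
      ((Set.pi univ fun i => Icc (-(![a, 4, 4] : Fin 3 → ℝ) i) (![a, 4, 4] i)) ×ˢ
      (Set.pi univ fun i => Icc (-(![a, a, 4] : Fin 3 → ℝ) i) (![a, a, 4] i))) =
      (2 * a) ^ 3 * 8 ^ 3 := by
    rw [Measure.real, Measure.volume_eq_prod, Measure.prod_prod, volume_pi_pi, volume_pi_pi]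
    simp only [Real.volume_Icc, Fin.prod_univ_three, ENNReal.toReal_mul]
    simp only [Matrix.cons_val_zero, Matrix.cons_val_one, Matrix.cons_val, sub_neg_eq_add]
    rw [ENNReal.toReal_ofReal (by positivity), ENNReal.toReal_ofReal (by positivity)]
    ring
  have hfin : volume ((Set.pi univ fun i => Icc (-(![a, 4, 4] : Fin 3 → ℝ) i) (![a, 4, 4] i)) ×ˢ
      (Set.pi univ fun i => Icc (-(![a, a, 4] : Fin 3 → ℝ) i) (![a, a, 4] i))) ≠ ⊤ :=
    ((isCompact_univ_pi fun _ => isCompact_Icc).prod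
      (isCompact_univ_pi fun _ => isCompact_Icc)).measure_lt_top.ne
  refine (measureReal_mono box hfin).trans ?_
  have e : x ^ (3 / 2 : ℝ) = √x ^ 3 := by
    rw [Real.sqrt_eq_rpow, ← Real.rpow_natCast, ← Real.rpow_mul hx.le]
    norm_num
  rw [hvol, e, ha]
  apply le_of_eq
  ring

theorem volume_bdd_lt_top : volume bdd < ⊤ := by
  refine (measure_mono ?_).trans_lt
    (isCompact_closedBall (0 : Pairs) 4).measure_lt_top
  intro z hz
  rw [mem_closedBall_zero_iff, Prod.norm_def]
  exact max_le (norm_le_of_sqSum_le (by norm_num) (by linarith [hz.2.1]))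
    (norm_le_of_sqSum_le (by norm_num) (by linarith [hz.2.2]))

theorem measurableSet_bdd : MeasurableSet bdd := by
  have h1 : MeasurableSet {z : Pairs | sqSum z.1 ≤ 16} :=
    (isClosed_le (by unfold sqSum; fun_prop) continuous_const).measurableSet
  have h2 : MeasurableSet {z : Pairs | sqSum z.2 ≤ 16} :=
    (isClosed_le (by unfold sqSum; fun_prop) continuous_const).measurableSet
  exact measurableSet_indep.inter (h1.inter h2)

theorem measurableSet_near (x : ℝ) : MeasurableSet (near x) := by
  suffices h : Measurable tauP from
    measurableSet_bdd.inter (measurableSet_le h measurable_const : MeasurableSet {z | tauP z ≤ x})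
  have h1 := continuous_lenP.measurable
  have h2 := continuous_lenQ.measurable
  have h3 : ∀ i, Measurable fun z => cr z i := fun i =>
    ((continuous_apply i).comp continuous_cr).measurable
  unfold tauP
  exact (Measurable.div (by fun_prop) h1).add
    (Measurable.div (((h3 1).pow_const 2).add ((h3 2).pow_const 2)) h2)

/-- The squared size of the part of `g` below the diagonal. -/
def lowSq (g : G) : ℝ := g.1 1 0 ^ 2 + g.1 2 0 ^ 2 + g.1 2 1 ^ 2

/-- If the vector `(x, y, w)` is nearly parallel to the first basis vector, and its product with
`(a, b, c)` is small, then so is `a`. -/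
theorem coeff_sq_le {a b c x y w v τ τ' R : ℝ} (hR : 1 ≤ R) (ha : a ^ 2 ≤ R) (hb : b ^ 2 ≤ R)
    (hc : c ^ 2 ≤ R) (hX : 0 < x ^ 2 + y ^ 2 + w ^ 2) (hτ0' : 0 ≤ τ')
    (hτ : y ^ 2 + w ^ 2 ≤ τ * (x ^ 2 + y ^ 2 + w ^ 2)) (hv : v = a * x + b * y + c * w)
    (hτ' : v ^ 2 ≤ τ' * (R * (x ^ 2 + y ^ 2 + w ^ 2))) : a ^ 2 ≤ 6 * R * (τ + τ') := by
  have hR0 : 0 ≤ R := by linarith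
  have hy := sq_nonneg y
  have hw := sq_nonneg w
  rcases le_or_gt (1 / 2) τ with h | h
  · have : R * (1 / 2) ≤ R * τ := by gcongr
    have := mul_nonneg hR0 hτ0'
    linarith
  · set X := x ^ 2 + y ^ 2 + w ^ 2
    have hx : X ≤ 2 * x ^ 2 := by
      have : τ * X ≤ 1 / 2 * X := by gcongr
      have e : X = x ^ 2 + y ^ 2 + w ^ 2 := rfl
      linarith
    have h1 : (a * x) ^ 2 ≤ 3 * (v ^ 2 + (b * y) ^ 2 + (c * w) ^ 2) := by
      have e : a * x = v - b * y - c * w := by rw [hv]; ring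
      rw [e]
      nlinarith [sq_nonneg (v + b * y), sq_nonneg (v + c * w), sq_nonneg (b * y - c * w)]
    have h2 : (b * y) ^ 2 ≤ R * y ^ 2 := by rw [mul_pow]; gcongr
    have h3 : (c * w) ^ 2 ≤ R * w ^ 2 := by rw [mul_pow]; gcongr
    have h4 : R * (y ^ 2 + w ^ 2) ≤ R * (τ * X) := by gcongr
    have h5 : a ^ 2 * X ≤ a ^ 2 * (2 * x ^ 2) := by gcongr
    have h6 : a ^ 2 * X ≤ (6 * R * (τ + τ')) * X := by
      rw [mul_pow] at h1
      linarith
    exact le_of_mul_le_mul_right h6 hX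

theorem entry_sq_le_fro (x : Matrix (Fin 3) (Fin 3) ℝ) (i j : Fin 3) : x i j ^ 2 ≤ fro x := by
  have h : x i j ^ 2 ≤ sqSum (x i) := by
    have h0 := sq_nonneg (x i 0)
    have h1 := sq_nonneg (x i 1)
    have h2 := sq_nonneg (x i 2)
    unfold sqSum
    fin_cases j <;> simp only [Fin.zero_eta, Fin.mk_one, Fin.reduceFinMk] <;> linarith
  refine h.trans ?_
  have h0 := sqSum_nonneg (x 0)
  have h1 := sqSum_nonneg (x 1)
  have h2 := sqSum_nonneg (x 2)
  unfold fro
  fin_cases i <;> simp only [Fin.zero_eta, Fin.mk_one, Fin.reduceFinMk] <;> linarith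

/-- If the squares of the entries of `g` are at most `R`, and those of `g₂₀`, `g₂₁` and of the
cofactor `(g⁻¹)₁₀` at most `T`, then `g₁₀` is small as well. -/
theorem entry_sq_le_of_cofactor {a b c d e f p q r j R T : ℝ} (hR : 1 ≤ R) (hT : 0 ≤ T)
    (ha : a ^ 2 ≤ R) (hb : b ^ 2 ≤ R) (hc : c ^ 2 ≤ R) (hd : d ^ 2 ≤ R) (he : e ^ 2 ≤ R)
    (hf : f ^ 2 ≤ R) (hp : p ^ 2 ≤ T) (hq : q ^ 2 ≤ T) (hj : j ^ 2 ≤ T)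
    (hj' : j = -(d * r) + f * p)
    (hdet : a * e * r - a * f * q - b * d * r + b * f * p + c * d * q - c * e * p = 1) :
    d ^ 2 ≤ 64 * R ^ 3 * T := by
  have hR0 : (0 : ℝ) ≤ R := by linarith
  have hm : ∀ y z : ℝ, y ^ 2 ≤ R → z ^ 2 ≤ R → (y * z) ^ 2 ≤ R ^ 2 := fun y z hy hz => by
    rw [mul_pow, sq R]
    exact mul_le_mul hy hz (sq_nonneg _) hR0
  have sub_sq : ∀ y z : ℝ, y ^ 2 ≤ R ^ 2 → z ^ 2 ≤ R ^ 2 → (y - z) ^ 2 ≤ 4 * R ^ 2 :=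
    fun y z hy hz => by linarith [sq_nonneg (y + z)]
  have c0 := sub_sq _ _ (hm b f hb hf) (hm c e hc he)
  have c1 := sub_sq _ _ (hm c d hc hd) (hm a f ha hf)
  have c2 := sub_sq _ _ (hm a e ha he) (hm b d hb hd)
  have four : ∀ x y z w : ℝ, (x + y + z + w) ^ 2 ≤ 4 * (x ^ 2 + y ^ 2 + z ^ 2 + w ^ 2) :=
    fun x y z w => by
      linarith [sq_nonneg (x - y), sq_nonneg (x - z), sq_nonneg (x - w), sq_nonneg (y - z),
        sq_nonneg (y - w), sq_nonneg (z - w)]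
  -- expand `d det = d` along the third row
  have hd' : d = d * (b * f - c * e) * p + d * (c * d - a * f) * q +
      (a * e - b * d) * f * p + -(a * e - b * d) * j := by
    rw [hj']
    linear_combination (-d) * hdet
  have t1 : (d * (b * f - c * e) * p) ^ 2 ≤ R * (4 * R ^ 2) * T := by
    rw [mul_pow, mul_pow]; gcongr
  have t2 : (d * (c * d - a * f) * q) ^ 2 ≤ R * (4 * R ^ 2) * T := by
    rw [mul_pow, mul_pow]; gcongr
  have t3 : ((a * e - b * d) * f * p) ^ 2 ≤ (4 * R ^ 2) * R * T := by
    rw [mul_pow, mul_pow]; gcongr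
  have t4 : (-(a * e - b * d) * j) ^ 2 ≤ (4 * R ^ 2) * T := by
    rw [mul_pow, neg_sq]; gcongr
  have h := four (d * (b * f - c * e) * p) (d * (c * d - a * f) * q) ((a * e - b * d) * f * p)
    (-(a * e - b * d) * j)
  rw [← hd'] at h
  have h23 : R ^ 2 * T ≤ R ^ 3 * T := by
    gcongr
    · norm_num
  linarith

/-- If both `z` and `z g` are close to `M`, then `g` is close to the upper triangular matrices. -/
theorem lowSq_le {g : G} {R : ℝ} (hR : 1 ≤ R) (h1 : fro g.1 ≤ R) (h2 : fro (g⁻¹).1 ≤ R)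
    {z : Pairs} (hz : z ∈ indep) :
    lowSq g ≤ 400 * R ^ 4 * (tauP z + tauP (act g z)) := by
  have hz' := (act_mem_indep g).mpr hz
  obtain ⟨p1, p2, p0⟩ := tauP_parts hz
  obtain ⟨q1, q2, q0⟩ := tauP_parts hz'
  have hP := lenP_pos_of_mem hz
  have hQ : 0 < lenQ z := hz
  have ge : ∀ i j, g.1 i j ^ 2 ≤ R := fun i j => (entry_sq_le_fro _ i j).trans h1
  have gi : ∀ i j, (g⁻¹).1 i j ^ 2 ≤ R := fun i j => (entry_sq_le_fro _ i j).trans h2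
  have hP' : lenP (act g z) ≤ R * lenP z := (lenP_act_le g z).trans (by gcongr)
  have hQ' : lenQ (act g z) ≤ R * lenQ z := (lenQ_act_le g z).trans (by gcongr)
  have eP : lenP z = z.2 2 ^ 2 + z.2 0 ^ 2 + z.2 1 ^ 2 := by
    have : lenP z = z.2 0 ^ 2 + z.2 1 ^ 2 + z.2 2 ^ 2 := rfl
    rw [this]; ring
  have eQ : lenQ z = cr z 0 ^ 2 + cr z 1 ^ 2 + cr z 2 ^ 2 := rfl
  obtain ⟨T, hT⟩ : ∃ T, T = 6 * R * (tauP z + tauP (act g z)) := ⟨_, rfl⟩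
  have a2 : ∀ j : Fin 3, (act g z).2 j ^ 2 ≤ tauP (act g z) * lenP (act g z) →
      g.1 2 j ^ 2 ≤ T := by
    intro j hj
    rw [hT]
    refine coeff_sq_le hR (ge 2 j) (ge 0 j) (ge 1 j) (x := z.2 2) (y := z.2 0) (w := z.2 1)
      (v := (act g z).2 j) (by rw [← eP]; exact hP) q0 (by rw [← eP]; exact p1) ?_
      (by rw [← eP]; exact hj.trans (by gcongr))
    simp [act, Matrix.vecMul, dotProduct, Fin.sum_univ_three]
    ring
  have b2 : ∀ i : Fin 3, cr (act g z) i ^ 2 ≤ tauP (act g z) * lenQ (act g z) →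
      (g⁻¹).1 i 0 ^ 2 ≤ T := by
    intro i hi
    rw [hT]
    refine coeff_sq_le hR (gi i 0) (gi i 1) (gi i 2) (x := cr z 0) (y := cr z 1) (w := cr z 2)
      (v := cr (act g z) i) (by rw [← eQ]; exact hQ) q0 (by rw [← eQ]; exact p2) ?_
      (by rw [← eQ]; exact hi.trans (by gcongr))
    rw [cr_act]
    simp [Matrix.mulVec, dotProduct, Fin.sum_univ_three]
  have g20 := a2 0 (by linarith [sq_nonneg ((act g z).2 1)])
  have g21 := a2 1 (by linarith [sq_nonneg ((act g z).2 0)])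
  have i10 := b2 1 (by linarith [sq_nonneg (cr (act g z) 2)])
  have hT0 : 0 ≤ T := by rw [hT]; positivity
  have hinv : (g⁻¹).1 1 0 = -(g.1 1 0 * g.1 2 2) + g.1 1 2 * g.1 2 0 := by
    rw [Matrix.SpecialLinearGroup.coe_inv, Matrix.adjugate_fin_three]; rfl
  have hdet := g.2
  rw [Matrix.det_fin_three] at hdet
  have g10 := entry_sq_le_of_cofactor hR hT0 (ge 0 0) (ge 0 1) (ge 0 2) (ge 1 0) (ge 1 1)
    (ge 1 2) g20 g21 i10 hinv hdet
  have r0 : 1 * T ≤ R ^ 3 * T := by gcongr; exact one_le_pow₀ hR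
  have hT3 : 0 ≤ R ^ 3 * T := by positivity
  have e : 400 * R ^ 4 * (tauP z + tauP (act g z)) = (400 / 6) * (R ^ 3 * T) := by rw [hT]; ring
  rw [e, lowSq]
  linarith

/-! ### The Riemannian distance -/

section Distance

open scoped Matrix.Norms.Frobenius

theorem fro_eq_sum (x : Matrix (Fin 3) (Fin 3) ℝ) :
    fro x = ∑ p : Fin 3 × Fin 3, x p.1 p.2 ^ 2 := by
  simp [fro, sqSum, Fintype.sum_prod_type, Fin.sum_univ_three]

theorem sq_norm_eq_fro (x : Matrix (Fin 3) (Fin 3) ℝ) : ‖x‖ ^ 2 = fro x := by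
  have h : ∑ i, ∑ j, ‖x i j‖ ^ 2 = fro x := by
    simp [fro, sqSum, Fin.sum_univ_three]
  have h' : ‖x‖ = √(fro x) := by
    rw [Matrix.frobenius_norm_def, Real.sqrt_eq_rpow, ← h]
    norm_num
  rw [h', Real.sq_sqrt (fro_nonneg x)]

theorem fro_inv_le (g : G) : fro (g⁻¹).1 ≤ 36 * fro g.1 ^ 2 := by
  have e : ∀ i j, g.1 i j ^ 2 ≤ fro g.1 := entry_sq_le_fro g.1
  have h0 := fro_nonneg g.1
  have hm : ∀ i j k l : Fin 3, (g.1 i j * g.1 k l) ^ 2 ≤ fro g.1 ^ 2 := fun i j k l => by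
    rw [mul_pow, sq (fro g.1)]
    exact mul_le_mul (e i j) (e k l) (sq_nonneg _) h0
  have s1 : ∀ a b : ℝ, a ^ 2 ≤ fro g.1 ^ 2 → b ^ 2 ≤ fro g.1 ^ 2 →
      (a - b) ^ 2 ≤ 4 * fro g.1 ^ 2 := fun a b ha hb => by linarith [sq_nonneg (a + b)]
  have s2 : ∀ a b : ℝ, a ^ 2 ≤ fro g.1 ^ 2 → b ^ 2 ≤ fro g.1 ^ 2 →
      (-a + b) ^ 2 ≤ 4 * fro g.1 ^ 2 := fun a b ha hb => by linarith [sq_nonneg (a + b)]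
  rw [Matrix.SpecialLinearGroup.coe_inv, Matrix.adjugate_fin_three]
  simp only [fro, sqSum, Matrix.of_apply, Matrix.cons_val_zero, Matrix.cons_val_one,
    Matrix.cons_val]
  have a00 := s1 _ _ (hm 1 1 2 2) (hm 1 2 2 1)
  have a01 := s2 _ _ (hm 0 1 2 2) (hm 0 2 2 1)
  have a02 := s1 _ _ (hm 0 1 1 2) (hm 0 2 1 1)
  have a10 := s2 _ _ (hm 1 0 2 2) (hm 1 2 2 0)
  have a11 := s1 _ _ (hm 0 0 2 2) (hm 0 2 2 0)
  have a12 := s2 _ _ (hm 0 0 1 2) (hm 0 2 1 0)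
  have a20 := s1 _ _ (hm 1 0 2 1) (hm 1 1 2 0)
  have a21 := s2 _ _ (hm 0 0 2 1) (hm 0 1 2 0)
  have a22 := s1 _ _ (hm 0 0 1 1) (hm 0 1 1 0)
  have ef : fro g.1 = sqSum (g.1 0) + sqSum (g.1 1) + sqSum (g.1 2) := rfl
  simp only [sqSum] at ef
  rw [← ef]
  linarith

theorem hasDerivAt_fro {f : ℝ → Matrix (Fin 3) (Fin 3) ℝ} {f' : Matrix (Fin 3) (Fin 3) ℝ} {s : ℝ}
    (h : HasDerivAt f f' s) :
    HasDerivAt (fun s => fro (f s)) (∑ p : Fin 3 × Fin 3, 2 * (f s p.1 p.2 * f' p.1 p.2)) s := by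
  have he : ∀ i j, HasDerivAt (fun s => f s i j) (f' i j) s := fun i j =>
    ((Matrix.entryLinearMap ℝ ℝ i j).toContinuousLinearMap.hasFDerivAt (x := f s)).comp_hasDerivAt
      s h
  simp only [fro_eq_sum]
  refine HasDerivAt.fun_sum fun p _ => ?_
  exact ((he p.1 p.2).fun_pow 2).congr_deriv (by norm_num; ring)

/-- Along a path with `γ⁻¹ γ' = y`, the logarithm of the squared Frobenius norm of `γ` changes at
speed at most `2 ‖y‖`. -/
theorem abs_deriv_fro_le (x y : Matrix (Fin 3) (Fin 3) ℝ) :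
    |∑ p : Fin 3 × Fin 3, 2 * (x p.1 p.2 * (x * y) p.1 p.2)| ≤ 2 * ‖y‖ * fro x := by
  rw [← Finset.mul_sum, abs_mul, abs_two, mul_assoc]
  refine mul_le_mul_of_nonneg_left ?_ zero_le_two
  refine abs_le_of_sq_le_sq ?_ (mul_nonneg (norm_nonneg _) (fro_nonneg x))
  refine (Finset.sum_mul_sq_le_sq_mul_sq _ _ _).trans ?_
  rw [← fro_eq_sum, ← fro_eq_sum, mul_pow, ← sq_norm_eq_fro, ← sq_norm_eq_fro]
  have h : ‖x * y‖ ^ 2 ≤ (‖x‖ * ‖y‖) ^ 2 := by gcongr; exact Matrix.frobenius_norm_mul x y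
  calc ‖x‖ ^ 2 * ‖x * y‖ ^ 2 ≤ ‖x‖ ^ 2 * (‖x‖ * ‖y‖) ^ 2 := by gcongr
    _ = ‖y‖ ^ 2 * (‖x‖ ^ 2) ^ 2 := by ring

theorem fro_pos (g : G) : 0 < fro g.1 := by
  refine lt_of_le_of_ne (fro_nonneg _) fun h => ?_
  have h0 : ∀ i j, g.1 i j = 0 := fun i j => by
    have := entry_sq_le_fro g.1 i j
    rw [← h] at this
    exact pow_eq_zero_iff two_ne_zero |>.mp (le_antisymm this (sq_nonneg _))
  have hd := g.2
  rw [Matrix.det_fin_three] at hd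
  simp [h0] at hd

/-- A bound for the entries of the points of a Riemannian ball. -/
theorem fro_le_of_leftEDist_le {g : G} (hg : leftEDist g 1 ≤ 1) :
    fro g.1 ≤ 3 * Real.exp 4 := by
  have hlt : leftEDist g 1 < 2 := hg.trans_lt (by norm_num)
  simp only [leftEDist, iInf_lt_iff] at hlt
  obtain ⟨γ, hγ, h0, h1, hlen⟩ := hlt
  set M : ℝ → Matrix (Fin 3) (Fin 3) ℝ := fun s => (γ s).1 with hM
  set V : ℝ → Matrix (Fin 3) (Fin 3) ℝ := fun s => ((γ s)⁻¹).1 * derivWithin M (Icc 0 1) s with hV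
  have hcM : ContinuousOn M (Icc 0 1) := hγ.continuousOn
  have hcI : ContinuousOn (fun s => ((γ s)⁻¹).1) (Icc 0 1) := by
    have e : (fun s => ((γ s)⁻¹).1) = fun s => (M s).adjugate := by
      funext s
      rw [Matrix.SpecialLinearGroup.coe_inv]
    rw [e]
    exact (continuous_id.matrix_adjugate).comp_continuousOn hcM
  have hcV : ContinuousOn V (Icc 0 1) :=
    hcI.mul (hγ.continuousOn_derivWithin (uniqueDiffOn_Icc zero_lt_one) le_rfl)
  have hL : ∫ s in (0 : ℝ)..1, 2 * ‖V s‖ ≤ 4 := by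
    rw [intervalIntegral.integral_const_mul, intervalIntegral.integral_of_le zero_le_one,
      ← integral_Icc_eq_integral_Ioc,
      integral_eq_lintegral_of_nonneg_ae (Filter.Eventually.of_forall fun s => norm_nonneg _)
        (hcV.norm.aestronglyMeasurable measurableSet_Icc)]
    simp only [ofReal_norm]
    have := ENNReal.toReal_mono (by norm_num) hlen.le
    rw [ENNReal.toReal_ofNat] at this
    linarith
  have hpos : ∀ s, 0 < fro (M s) := fun s => fro_pos (γ s)
  have hdM : ∀ s ∈ Ioo (0 : ℝ) 1, HasDerivAt M (M s * V s) s := fun s hs => by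
    have hd : DifferentiableWithinAt ℝ M (Icc 0 1) s :=
      (hγ.differentiableOn one_ne_zero) s (Ioo_subset_Icc_self hs)
    have := hd.hasDerivWithinAt.hasDerivAt (Icc_mem_nhds hs.1 hs.2)
    have e : M s * V s = derivWithin M (Icc 0 1) s := by
      rw [hV, ← Matrix.mul_assoc, hM, ← Matrix.SpecialLinearGroup.coe_mul, mul_inv_cancel,
        Matrix.SpecialLinearGroup.coe_one, Matrix.one_mul]
    rwa [e]
  have key := intervalIntegral.sub_le_integral_of_hasDeriv_right_of_le
    (g := fun s => -Real.log (fro (M s)))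
    (g' := fun s => -((∑ p : Fin 3 × Fin 3, 2 * (M s p.1 p.2 * (M s * V s) p.1 p.2)) / fro (M s)))
    (φ := fun s => 2 * ‖V s‖) (zero_le_one' ℝ) ?_ ?_ ?_ ?_
  · have e1 : fro (M 1) = 3 := by
      rw [hM]
      simp only [h1]
      simp [fro, sqSum]
      norm_num
    have e0 : M 0 = g.1 := by rw [hM]; simp only [h0]
    simp only [e1, e0] at key
    have h2 : Real.log (fro g.1) ≤ Real.log (3 * Real.exp 4) := by
      rw [Real.log_mul (by norm_num) (Real.exp_pos _).ne', Real.log_exp]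
      linarith
    exact (Real.log_le_log_iff (fro_pos g) (by positivity)).mp h2
  · have hcf : Continuous fro := by unfold fro; fun_prop
    exact ((hcf.comp_continuousOn hcM).log fun s _ => (hpos s).ne').neg
  · exact fun s hs => (((hasDerivAt_fro (hdM s hs)).log (hpos s).ne').neg).hasDerivWithinAt
  · exact (continuousOn_const.mul hcV.norm).integrableOn_Icc
  · intro s _
    rw [← neg_div, div_le_iff₀ (hpos s)]
    exact (neg_le_abs _).trans (abs_deriv_fro_le _ _)

/-- The strictly lower triangular matrix with given entries. -/
def lowMat (x y z : ℝ) : Matrix (Fin 3) (Fin 3) ℝ := !![0, 0, 0; x, 0, 0; y, z, 0]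

theorem det_one_add_lowMat (c x y z : ℝ) : (1 + c • lowMat x y z).det = 1 := by
  simp [lowMat, Matrix.det_fin_three]

theorem fro_lowMat (x y z : ℝ) : fro (lowMat x y z) = x ^ 2 + y ^ 2 + z ^ 2 := by
  simp [fro, sqSum, lowMat]
  ring

/-- A diagonal matrix of determinant `1` is the product of its matrix of signs, which lies in `M`,
and of its absolute value, which lies in `A`. -/
theorem exists_mem_MA_of_diagonal {δ : Fin 3 → ℝ} (hδ : δ 0 * δ 1 * δ 2 = 1) :
    ∃ m ∈ setM, ∃ a ∈ setA, (m * a).1 = Matrix.diagonal δ := by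
  have hne : ∀ i, δ i ≠ 0 := by
    have h : δ 0 * δ 1 * δ 2 ≠ 0 := by rw [hδ]; exact one_ne_zero
    obtain ⟨h01, h2⟩ := mul_ne_zero_iff.mp h
    obtain ⟨h0, h1⟩ := mul_ne_zero_iff.mp h01
    intro i
    fin_cases i
    exacts [h0, h1, h2]
  have habs : |δ 0| * |δ 1| * |δ 2| = 1 := by rw [← abs_mul, ← abs_mul, hδ, abs_one]
  let H : frakA := ⟨!₂[Real.log |δ 0|, Real.log |δ 1|, Real.log |δ 2|], by
    change ∑ i, _ = _
    have p := fun i => abs_ne_zero.mpr (hne i)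
    simp only [Fin.sum_univ_three]
    change Real.log |δ 0| + Real.log |δ 1| + Real.log |δ 2| = 0
    rw [← Real.log_mul (p 0) (p 1), ← Real.log_mul (mul_ne_zero (p 0) (p 1)) (p 2), habs,
      Real.log_one]⟩
  let σ : Fin 3 → ℝ := fun i => δ i / |δ i|
  have hσ : ∀ i, σ i * σ i = 1 := fun i => by
    have := abs_ne_zero.mpr (hne i)
    rw [show σ i * σ i = (δ i * δ i) / (|δ i| * |δ i|) by simp only [σ]; field_simp,
      abs_mul_abs_self, div_self (mul_ne_zero (hne i) (hne i))]
  let m : G := ⟨Matrix.diagonal σ, by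
    rw [Matrix.det_diagonal, Fin.prod_univ_three]
    change δ 0 / |δ 0| * (δ 1 / |δ 1|) * (δ 2 / |δ 2|) = 1
    rw [div_mul_div_comm, div_mul_div_comm, hδ, habs, div_one]⟩
  refine ⟨m, ⟨?_, fun H => ?_⟩, expA H, mem_range_self _, ?_⟩
  · change Matrix.diagonal σ * (Matrix.diagonal σ)ᵀ = 1
    rw [Matrix.diagonal_transpose, Matrix.diagonal_mul_diagonal, ← Matrix.diagonal_one]
    congr 1
    funext i
    exact hσ i
  · change Matrix.diagonal σ * Matrix.diagonal _ = Matrix.diagonal _ * Matrix.diagonal σ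
    rw [Matrix.diagonal_mul_diagonal, Matrix.diagonal_mul_diagonal]
    congr 1
    funext i
    ring
  · rw [Matrix.SpecialLinearGroup.coe_mul, expA_val]
    change Matrix.diagonal σ * Matrix.diagonal _ = _
    rw [Matrix.diagonal_mul_diagonal]
    congr 1
    funext i
    have hl : H.1 i = Real.log |δ i| := by fin_cases i <;> rfl
    rw [hl, Real.exp_log (abs_pos.mpr (hne i)), div_mul_cancel₀ _ (abs_ne_zero.mpr (hne i))]

/-- The distance to `MA` of a product of a lower unipotent, a diagonal and an upper unipotent
matrix, estimated by contracting both unipotent factors linearly to the identity. -/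
theorem distMA_le_of_triangular {g : G} {x y z x' y' z' S κ : ℝ} {δ : Fin 3 → ℝ}
    (hδ : δ 0 * δ 1 * δ 2 = 1)
    (hg : g.1 = (1 + lowMat x y z) * Matrix.diagonal δ * (1 + (lowMat x' y' z')ᵀ)) (hS : 1 ≤ S)
    (hκ : κ ≤ S) (hN : ‖lowMat x y z‖ ≤ κ) (hN' : ‖lowMat x' y' z'‖ ≤ κ)
    (hD : ‖Matrix.diagonal δ‖ ≤ S) :
    distMA g ≤ ENNReal.ofReal (2916 * S ^ 8 * κ) := by
  have hκ0 : 0 ≤ κ := (norm_nonneg _).trans hN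
  set P := lowMat x y z
  set Q := (lowMat x' y' z')ᵀ with hQ
  set Δ := Matrix.diagonal δ
  have hQn : ‖Q‖ ≤ κ := by rw [hQ, Matrix.frobenius_norm_transpose]; exact hN'
  obtain ⟨m, hm, a, ha, hma⟩ := exists_mem_MA_of_diagonal hδ
  have hdetΔ : Δ.det = 1 := by rw [Matrix.det_diagonal, Fin.prod_univ_three, hδ]
  let γ : ℝ → G := fun s => ⟨(1 + (1 - s) • P) * Δ * (1 + (1 - s) • Q), by
    rw [Matrix.det_mul, Matrix.det_mul, det_one_add_lowMat, hdetΔ, hQ, ← Matrix.transpose_smul,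
      ← Matrix.transpose_one, ← Matrix.transpose_add, Matrix.det_transpose, det_one_add_lowMat]
    norm_num⟩
  have hder : ∀ s, HasDerivAt (fun s => (γ s).1)
      (-P * Δ * (1 + (1 - s) • Q) + (1 + (1 - s) • P) * Δ * -Q) s := fun s => by
    have hc : ∀ T : Matrix (Fin 3) (Fin 3) ℝ, HasDerivAt (fun s : ℝ => 1 + (1 - s) • T) (-T) s :=
      fun T => by
        have h : HasDerivAt (fun s : ℝ => 1 - s) (-1) s := (hasDerivAt_id s).const_sub 1
        exact ((h.smul_const T).const_add 1).congr_deriv (neg_one_smul ℝ T)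
    exact ((hc P).mul_const Δ).mul (hc Q)
  have hsmooth : ContDiff ℝ 1 fun s => (γ s).1 := by
    have hc : ∀ T : Matrix (Fin 3) (Fin 3) ℝ, ContDiff ℝ 1 (fun s : ℝ => 1 + (1 - s) • T) :=
      fun T => contDiff_const.add ((contDiff_const.sub contDiff_id).smul contDiff_const)
    exact ((hc P).mul contDiff_const).mul (hc Q)
  have hγ0 : γ 0 = g := Subtype.ext (by simp [γ, hg])
  have hγ1 : γ 1 = m * a := Subtype.ext (by rw [hma]; simp [γ, Δ])
  have hone : ‖(1 : Matrix (Fin 3) (Fin 3) ℝ)‖ ≤ 2 := by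
    have h : ‖(1 : Matrix (Fin 3) (Fin 3) ℝ)‖ ^ 2 ≤ 2 ^ 2 := by
      rw [sq_norm_eq_fro]
      simp [fro, sqSum]
      norm_num
    exact (sq_le_sq₀ (norm_nonneg _) zero_le_two).mp h
  have hfac : ∀ T : Matrix (Fin 3) (Fin 3) ℝ, ‖T‖ ≤ κ → ∀ s ∈ Icc (0 : ℝ) 1,
      ‖1 + (1 - s) • T‖ ≤ 3 * S := fun T hT s hs => by
    have h1 : ‖(1 - s) • T‖ ≤ ‖T‖ := by
      rw [norm_smul, Real.norm_of_nonneg (by linarith [hs.2])]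
      exact mul_le_of_le_one_left (norm_nonneg _) (by linarith [hs.1])
    linarith [norm_add_le 1 ((1 - s) • T)]
  have mul3 : ∀ {X Y Z : Matrix (Fin 3) (Fin 3) ℝ} {p q r : ℝ}, ‖X‖ ≤ p → ‖Y‖ ≤ q → ‖Z‖ ≤ r →
      ‖X * Y * Z‖ ≤ p * q * r := fun {X Y Z p q r} hX hY hZ => by
    refine (Matrix.frobenius_norm_mul _ _).trans (mul_le_mul ?_ hZ (norm_nonneg _) ?_)
    · exact (Matrix.frobenius_norm_mul _ _).trans
        (mul_le_mul hX hY (norm_nonneg _) ((norm_nonneg _).trans hX))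
    · exact mul_nonneg ((norm_nonneg _).trans hX) ((norm_nonneg _).trans hY)
  have hspeed : ∀ s ∈ Icc (0 : ℝ) 1,
      ‖((γ s)⁻¹).1 * derivWithin (fun s => (γ s).1) (Icc 0 1) s‖ ≤ 2916 * S ^ 8 * κ := by
    intro s hs
    refine (congrArg (fun X => ‖((γ s)⁻¹).1 * X‖) ((hder s).hasDerivWithinAt.derivWithin
      (uniqueDiffOn_Icc zero_lt_one s hs))).trans_le ?_
    have hP := hfac P hN s hs
    have hQ' := hfac Q hQn s hs
    have n1 : ‖(γ s).1‖ ≤ 3 * S * S * (3 * S) := mul3 hP hD hQ'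
    have n2 : ‖((γ s)⁻¹).1‖ ≤ 6 * (3 * S * S * (3 * S)) ^ 2 := by
      have h := fro_inv_le (γ s)
      rw [← sq_norm_eq_fro, ← sq_norm_eq_fro] at h
      have h2 : ‖((γ s)⁻¹).1‖ ^ 2 ≤ (6 * ‖(γ s).1‖ ^ 2) ^ 2 := by linarith
      refine ((sq_le_sq₀ (norm_nonneg _) (by positivity)).mp h2).trans ?_
      gcongr
    have n3 : ‖-P * Δ * (1 + (1 - s) • Q) + (1 + (1 - s) • P) * Δ * -Q‖ ≤
        κ * S * (3 * S) + 3 * S * S * κ :=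
      (norm_add_le _ _).trans (add_le_add (mul3 (by rwa [norm_neg]) hD hQ')
        (mul3 hP hD (by rwa [norm_neg])))
    refine (Matrix.frobenius_norm_mul _ _).trans ((mul_le_mul n2 n3 (norm_nonneg _)
      (by positivity)).trans (le_of_eq ?_))
    ring
  refine (iInf₂_le_of_le m hm (iInf₂_le_of_le a ha ?_))
  refine iInf₂_le_of_le γ hsmooth.contDiffOn (iInf₂_le_of_le hγ0 hγ1 ?_)
  calc ∫⁻ s in Icc (0 : ℝ) 1, ‖((γ s)⁻¹).1 * derivWithin (fun s => (γ s).1) (Icc 0 1) s‖ₑ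
      ≤ ∫⁻ _ in Icc (0 : ℝ) 1, ENNReal.ofReal (2916 * S ^ 8 * κ) := by
        refine setLIntegral_mono' measurableSet_Icc fun s hs => ?_
        rw [← ofReal_norm]
        exact ENNReal.ofReal_le_ofReal (hspeed s hs)
    _ = ENNReal.ofReal (2916 * S ^ 8 * κ) := by simp

end Distance

/-! ### The distance to `MA` -/

/-- The squared Frobenius norm of the off-diagonal part of `g`. -/
def offSq (g : G) : ℝ := lowSq g + lowSq (trG g)

theorem lowSq_nonneg (g : G) : 0 ≤ lowSq g := by unfold lowSq; positivity

theorem fro_trG (g : G) : fro (trG g).1 = fro g.1 := by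
  simp [fro, sqSum, trG]
  ring

theorem trG_inv (g : G) : (trG g)⁻¹ = trG g⁻¹ := by
  rw [inv_eq_iff_mul_eq_one, ← trG_mul, inv_mul_cancel]
  exact Subtype.ext (by simp [trG])

/-- The leading minors of a matrix of determinant `1` with small off-diagonal entries are bounded
away from zero. -/
theorem minors_bounded_below {a b c d e f p q r R w : ℝ} (hR : 1 ≤ R) (hw : w ≤ 1 / (20 * R))
    (ha : a ^ 2 ≤ R) (he : e ^ 2 ≤ R) (hf : f ^ 2 ≤ R) (hr : r ^ 2 ≤ R) (hb : b ^ 2 ≤ w)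
    (hc : c ^ 2 ≤ w) (hd : d ^ 2 ≤ w) (hf' : f ^ 2 ≤ w) (hp : p ^ 2 ≤ w) (hq : q ^ 2 ≤ w)
    (hdet : a * e * r - a * f * q - b * d * r + b * f * p + c * d * q - c * e * p = 1) :
    1 ≤ 4 * R ^ 2 * a ^ 2 ∧ 1 ≤ 4 * R ^ 2 * (a * e - b * d) ^ 2 := by
  have hR0 : 0 < R := by linarith
  have hRw : R * w ≤ 1 / 20 := by
    rw [le_div_iff₀ (by positivity)] at hw
    linarith
  have hw0 : 0 ≤ w := (sq_nonneg b).trans hb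
  have habs : ∀ x : ℝ, x ^ 2 ≤ R → |x| ≤ R := fun x hx =>
    abs_le_of_sq_le_sq (hx.trans (by nlinarith)) hR0.le
  have hprod : ∀ x y : ℝ, x ^ 2 ≤ w → y ^ 2 ≤ w → |x * y| ≤ w := fun x y hx hy => by
    rw [abs_mul]
    have := sq_abs x
    have := sq_abs y
    nlinarith [sq_nonneg (|x| - |y|)]
  have h3 : ∀ x y z : ℝ, x ^ 2 ≤ R → y ^ 2 ≤ w → z ^ 2 ≤ w → |x * (y * z)| ≤ 1 / 20 :=
    fun x y z hx hy hz => by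
      rw [abs_mul]
      exact (mul_le_mul (habs x hx) (hprod y z hy hz) (abs_nonneg _) hR0.le).trans hRw
  have k1 := abs_le.mp (h3 a f q ha hf' hq)
  have k2 := abs_le.mp (h3 r b d hr hb hd)
  have k3 := abs_le.mp (h3 f b p hf hb hp)
  have k4 := abs_le.mp (h3 q c d (by linarith [show w ≤ R by nlinarith]) hc hd)
  have k5 := abs_le.mp (h3 e c p he hc hp)
  constructor
  · have h : 1 / 2 ≤ a * (e * r) := by linarith [k1.1, k2.1, k3.2, k4.2, k5.1]
    have h2 : (1 / 2) ^ 2 ≤ (a * (e * r)) ^ 2 := by gcongr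
    have h4 : (a * (e * r)) ^ 2 ≤ a ^ 2 * (R * R) := by
      rw [mul_pow, mul_pow]; gcongr
    linarith
  · have h : 1 / 2 ≤ (a * e - b * d) * r := by linarith [k1.1, k2.1, k3.2, k4.2, k5.1]
    have h2 : (1 / 2) ^ 2 ≤ ((a * e - b * d) * r) ^ 2 := by gcongr
    have h4 : ((a * e - b * d) * r) ^ 2 ≤ (a * e - b * d) ^ 2 * R ^ 2 := by
      rw [mul_pow]
      exact mul_le_mul_of_nonneg_left (hr.trans (by nlinarith)) (sq_nonneg _)
    linarith

theorem div_sq_le {x y R t : ℝ} (hy : 1 ≤ 4 * R ^ 2 * y ^ 2) (hx : x ^ 2 ≤ t) :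
    (x / y) ^ 2 ≤ 4 * R ^ 2 * t := by
  have hy0 : 0 < y ^ 2 := by
    rcases (sq_nonneg y).eq_or_lt with h | h
    · rw [← h] at hy; linarith
    · exact h
  rw [div_pow, div_le_iff₀ hy0]
  have ht : 0 ≤ t := (sq_nonneg x).trans hx
  calc x ^ 2 ≤ t := hx
    _ = t * 1 := (mul_one t).symm
    _ ≤ t * (4 * R ^ 2 * y ^ 2) := by gcongr
    _ = 4 * R ^ 2 * t * y ^ 2 := by ring

theorem cross_sq_le {x y z u R w : ℝ} (hx : x ^ 2 ≤ R) (hy : y ^ 2 ≤ w) (hz : z ^ 2 ≤ w)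
    (hu : u ^ 2 ≤ R) : (x * y - z * u) ^ 2 ≤ 4 * R * w := by
  have h1 : (x * y) ^ 2 ≤ R * w := by
    rw [mul_pow]; exact mul_le_mul hx hy (sq_nonneg _) ((sq_nonneg _).trans hx)
  have h2 : (z * u) ^ 2 ≤ w * R := by
    rw [mul_pow]; exact mul_le_mul hz hu (sq_nonneg _) ((sq_nonneg _).trans hz)
  linarith [sq_nonneg (x * y + z * u)]

section Distance

open scoped Matrix.Norms.Frobenius

/-- The distance of a nearly diagonal matrix to `MA`, by means of its triangular decomposition. -/
theorem distMA_le_of_offSq_le {g : G} {R : ℝ} (hR : 1 ≤ R) (hg : fro g.1 ≤ R)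
    (hw : offSq g ≤ 1 / (20 * R)) :
    distMA g ≤ ENNReal.ofReal (2916 * (6 * R ^ 2) ^ 8 * (5 * R ^ 2 * √(offSq g))) := by
  obtain ⟨w, hw'⟩ : ∃ w, w = offSq g := ⟨_, rfl⟩
  rw [← hw'] at hw ⊢
  have e : ∀ i j, g.1 i j ^ 2 ≤ R := fun i j => (entry_sq_le_fro _ i j).trans hg
  have hoff : w = g.1 1 0 ^ 2 + g.1 2 0 ^ 2 + g.1 2 1 ^ 2 +
    (g.1 0 1 ^ 2 + g.1 0 2 ^ 2 + g.1 1 2 ^ 2) := hw'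
  have hdet := g.2
  rw [Matrix.det_fin_three] at hdet
  have e00 := e 0 0
  have e01 := e 0 1
  have e02 := e 0 2
  have e10 := e 1 0
  have e11 := e 1 1
  have e12 := e 1 2
  have e20 := e 2 0
  have e21 := e 2 1
  have e22 := e 2 2
  have hgm : g.1 = !![g.1 0 0, g.1 0 1, g.1 0 2; g.1 1 0, g.1 1 1, g.1 1 2;
      g.1 2 0, g.1 2 1, g.1 2 2] := Matrix.eta_fin_three _
  generalize g.1 0 0 = a, g.1 0 1 = b, g.1 0 2 = c, g.1 1 0 = d, g.1 1 1 = e, g.1 1 2 = f,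
    g.1 2 0 = p, g.1 2 1 = q, g.1 2 2 = r at *
  have wb : b ^ 2 ≤ w := by
    linarith [sq_nonneg c, sq_nonneg d, sq_nonneg f, sq_nonneg p, sq_nonneg q]
  have wc : c ^ 2 ≤ w := by
    linarith [sq_nonneg b, sq_nonneg d, sq_nonneg f, sq_nonneg p, sq_nonneg q]
  have wd : d ^ 2 ≤ w := by
    linarith [sq_nonneg b, sq_nonneg c, sq_nonneg f, sq_nonneg p, sq_nonneg q]
  have wf : f ^ 2 ≤ w := by
    linarith [sq_nonneg b, sq_nonneg c, sq_nonneg d, sq_nonneg p, sq_nonneg q]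
  have wp : p ^ 2 ≤ w := by
    linarith [sq_nonneg b, sq_nonneg c, sq_nonneg d, sq_nonneg f, sq_nonneg q]
  have wq : q ^ 2 ≤ w := by
    linarith [sq_nonneg b, sq_nonneg c, sq_nonneg d, sq_nonneg f, sq_nonneg p]
  have hw0 : 0 ≤ w := (sq_nonneg b).trans wb
  obtain ⟨m1, m2⟩ := minors_bounded_below hR hw e00 e11 e12 e22 wb wc wd wf wp wq hdet
  obtain ⟨m, hm⟩ : ∃ m, m = a * e - b * d := ⟨_, rfl⟩
  rw [← hm] at m2
  have ha0 : a ≠ 0 := by rintro rfl; norm_num at m1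
  have hm0 : m ≠ 0 := by rintro rfl; norm_num at m2
  have hR0 : (0 : ℝ) ≤ R := by linarith
  have pow_mono : ∀ {i j : ℕ}, i ≤ j → R ^ i ≤ R ^ j := fun h => pow_le_pow_right₀ hR h
  -- both unipotent factors have the same shape
  have hnorm : ∀ x y z u v : ℝ, x ^ 2 ≤ w → y ^ 2 ≤ w → z ^ 2 ≤ w → u ^ 2 ≤ w → v ^ 2 ≤ R →
      ‖lowMat (x / a) (y / a) ((a * z - u * v) / m)‖ ≤ 5 * R ^ 2 * √w := by
    intro x y z u v hx hy hz hu hv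
    have h : ‖lowMat (x / a) (y / a) ((a * z - u * v) / m)‖ ^ 2 ≤ (5 * R ^ 2 * √w) ^ 2 := by
      rw [sq_norm_eq_fro, fro_lowMat, mul_pow, Real.sq_sqrt hw0]
      have h1 := div_sq_le m1 hx
      have h2 := div_sq_le m1 hy
      have h3 := div_sq_le m2 (cross_sq_le e00 hz hu hv)
      have r1 : R ^ 2 * w ≤ R ^ 4 * w := mul_le_mul_of_nonneg_right (pow_mono (by norm_num)) hw0
      have r2 : R ^ 3 * w ≤ R ^ 4 * w := mul_le_mul_of_nonneg_right (pow_mono (by norm_num)) hw0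
      have r3 : 0 ≤ R ^ 4 * w := by positivity
      linarith
    exact (sq_le_sq₀ (norm_nonneg _) (by positivity)).mp h
  have hκ : 5 * R ^ 2 * √w ≤ 6 * R ^ 2 := by
    have : √w ≤ 1 := by
      refine (Real.sqrt_le_sqrt (hw.trans ?_)).trans_eq Real.sqrt_one
      rw [div_le_one (by positivity)]
      linarith
    have := mul_le_mul_of_nonneg_left this (show 0 ≤ 5 * R ^ 2 by positivity)
    linarith [sq_nonneg R]
  have hΔ : ‖Matrix.diagonal ![a, m / a, 1 / m]‖ ≤ 6 * R ^ 2 := by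
    have h : ‖Matrix.diagonal ![a, m / a, 1 / m]‖ ^ 2 ≤ (6 * R ^ 2) ^ 2 := by
      rw [sq_norm_eq_fro]
      have h1 : m ^ 2 ≤ 4 * R * R := by
        rw [hm]
        exact cross_sq_le e00 e11 e01 e10
      have h2 := div_sq_le m1 h1
      have h3 := div_sq_le m2 (one_pow 2 : (1 : ℝ) ^ 2 = 1).le
      have e0 : fro (Matrix.diagonal ![a, m / a, 1 / m]) = a ^ 2 + (m / a) ^ 2 + (1 / m) ^ 2 := by
        simp [fro, sqSum]
      rw [e0]
      have r1 := pow_mono (show 1 ≤ 4 by norm_num)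
      have r2 := pow_mono (show 2 ≤ 4 by norm_num)
      have r3 := pow_mono (show 0 ≤ 4 by norm_num)
      rw [pow_one] at r1
      linarith
    exact (sq_le_sq₀ (norm_nonneg _) (by positivity)).mp h
  refine distMA_le_of_triangular (x := d / a) (y := p / a) (z := (a * q - p * b) / m)
    (x' := b / a) (y' := c / a) (z' := (a * f - c * d) / m) (δ := ![a, m / a, 1 / m]) ?_ ?_ ?_ hκ
    (hnorm d p q p b wd wp wq wp e01) (hnorm b c f c d wb wc wf wc e10) hΔ
  · simp
    field_simp
  · rw [hgm]
    have h22 : a * m * r = p * c * m + (a * q - p * b) * (a * f - c * d) + a := by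
      rw [hm]; linear_combination a * hdet
    ext i j
    fin_cases i <;> fin_cases j <;>
      simp [Matrix.mul_apply, Fin.sum_univ_three, lowMat, Matrix.one_apply, Matrix.diagonal_apply]
        <;> field_simp
    all_goals first | linear_combination -hm | linear_combination h22 | ring
  · have := pow_mono (show 0 ≤ 2 by norm_num)
    linarith

end Distance

theorem one_mem_setM : (1 : G) ∈ setM := ⟨one_mem K, fun H => by simp⟩

/-- Near the identity, the distance to `MA` is controlled by the off-diagonal entries. -/
theorem exists_distMA_le : ∃ C : ℝ, 0 < C ∧ ∀ g : G, leftEDist g 1 ≤ 1 →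
    distMA g ≤ ENNReal.ofReal (C * √(offSq g)) := by
  have hR : 1 ≤ 3 * Real.exp 4 := by linarith [Real.add_one_le_exp 4]
  set R := 3 * Real.exp 4
  have hR0 : 0 < R := by positivity
  set C := 2916 * (6 * R ^ 2) ^ 8 * (5 * R ^ 2) with hC
  refine ⟨max C √(20 * R), lt_max_of_lt_left (by positivity), fun g hg => ?_⟩
  rcases le_or_gt (offSq g) (1 / (20 * R)) with h | h
  · refine (distMA_le_of_offSq_le hR (fro_le_of_leftEDist_le hg) h).trans
      (ENNReal.ofReal_le_ofReal ?_)
    rw [← mul_assoc, ← hC]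
    gcongr
    exact le_max_left _ _
  -- otherwise the distance is at most that to the identity
  · have h1 : distMA g ≤ 1 := by
      refine iInf₂_le_of_le 1 one_mem_setM (iInf₂_le_of_le 1 ⟨0, expA_zero⟩ ?_)
      rwa [one_mul]
    refine h1.trans ?_
    rw [ENNReal.one_le_ofReal]
    have h2 : 1 ≤ √(20 * R) * √(offSq g) := by
      rw [← Real.sqrt_mul (by positivity), Real.one_le_sqrt]
      rw [div_lt_iff₀ (by positivity)] at h
      linarith
    exact h2.trans (by gcongr; exact le_max_right _ _)

/-! ### The bounds for the oscillatory integral -/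

theorem near_subset_bdd (x : ℝ) : near x ⊆ bdd := fun _ h => h.1

theorem norm_setIntegral_indep_le {F : Pairs → ℂ} {p q x : ℝ}
    (h : ∀ z ∈ indep, ‖F z‖ ≤ bdd.indicator (fun _ => p) z + (near x).indicator (fun _ => q) z) :
    ‖∫ z in indep, F z‖ ≤ p * volume.real bdd + q * volume.real (near x) := by
  have hn : volume (near x) < ⊤ := (measure_mono (near_subset_bdd x)).trans_lt volume_bdd_lt_top
  have i1 : Integrable (bdd.indicator fun _ : Pairs => p) (volume.restrict indep) :=
    ((integrableOn_const volume_bdd_lt_top.ne).integrable_indicator measurableSet_bdd).restrict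
  have i2 : Integrable ((near x).indicator fun _ : Pairs => q) (volume.restrict indep) :=
    ((integrableOn_const hn.ne).integrable_indicator (measurableSet_near x)).restrict
  have hb : bdd ∩ indep = bdd := inter_eq_left.mpr fun _ h => h.1
  have hnb : near x ∩ indep = near x := inter_eq_left.mpr fun _ h => h.1.1
  refine (norm_integral_le_of_norm_le (i1.add i2)
    (ae_restrict_of_forall_mem measurableSet_indep h)).trans (le_of_eq ?_)
  rw [integral_add' i1 i2, integral_indicator measurableSet_bdd,
    integral_indicator (measurableSet_near x), Measure.restrict_restrict measurableSet_bdd,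
    Measure.restrict_restrict (measurableSet_near x), hb, hnb, setIntegral_const,
    setIntegral_const, smul_eq_mul, smul_eq_mul, mul_comm, mul_comm q]

/-- The estimates from which both bounds follow. The parameter `x` separates the pairs near `M`,
whose measure is `O(x^{3/2})`, from those on which the integrals over `𝔞` decay. If `g` is far from
the upper triangular matrices, one of the two factors decays for every pair. -/
theorem exists_flatIntegral_bound {B : Set frakADual} (hB : IsCompact B) (hBr : B ⊆ regular) (n : ℕ)
    (D : ℝ) {R : ℝ} (hR : 1 ≤ R) : ∃ C₁ C₂ C : ℝ, 0 < C₁ ∧ 0 < C₂ ∧ 0 < C ∧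
      ∀ b₁ b₂ : frakA → ℂ, IsCutoff n D b₁ → IsCutoff n D b₂ → ∀ t : ℝ, 0 < t → ∀ ν ∈ B,
      ∀ l₁ l₂ : frakADual, ∀ g : G, fro g.1 ≤ R → fro (g⁻¹).1 ≤ R →
      ‖flatIntegral b₁ b₂ t l₁ l₂ ν g‖ ≤ C ∧
      ∀ x : ℝ, 0 < x → C₁ * ‖l₁ - ν‖ ≤ x → C₁ * ‖l₂ - ν‖ ≤ x →
        ‖flatIntegral b₁ b₂ t l₁ l₂ ν g‖ ≤ C * (x ^ (3 / 2 : ℝ) + (t * x)⁻¹ ^ n) ∧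
        (C₂ * x ≤ lowSq g → ‖flatIntegral b₁ b₂ t l₁ l₂ ν g‖ ≤ C * (t * x)⁻¹ ^ n) := by
  obtain ⟨A₁, C, hA₁, hC, hL⟩ := exists_kerL_bound hB hBr n D
  obtain ⟨A₁', C', hA₁', hC', hR'⟩ := exists_kerR_bound hB hBr n D
  have hE : 0 < R * C * C' := by positivity
  obtain ⟨E, hEe⟩ : ∃ E, E = R * C * C' := ⟨_, rfl⟩
  rw [← hEe] at hE
  have hm := psiMass_pos
  have hv : 0 ≤ volume.real bdd := measureReal_nonneg
  refine ⟨max A₁ A₁', 2 * (400 * R ^ 4),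
    psiMass⁻¹ * (E * (volume.real bdd + 24 ^ 3 * 8 ^ 3)), lt_max_of_lt_left hA₁, by positivity,
    by positivity, fun b₁ b₂ hb₁ hb₂ t ht ν hν l₁ l₂ g h1 h2 => ?_⟩
  set F : Pairs → ℂ := fun z =>
    (∫ H, kerL b₁ t l₁ ν H z) * ∫ H, kerR b₂ t l₂ ν H (act g z) with hF
  have hI : ‖flatIntegral b₁ b₂ t l₁ l₂ ν g‖ = psiMass⁻¹ * ‖∫ z in indep, F z‖ := by
    rw [hF, ← psiMass_mul_flatIntegral hb₁ hb₂, norm_mul, Complex.norm_real,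
      Real.norm_of_nonneg hm.le, inv_mul_cancel_left₀ hm.ne']
  -- bounds for the two factors multiply
  have hmul : ∀ z, ∀ p q : ℝ, 0 ≤ p → 0 ≤ q →
      ‖∫ H, kerL b₁ t l₁ ν H z‖ ≤ ‖chr (t • ν) z‖⁻¹ * (C * p) →
      ‖∫ H, kerR b₂ t l₂ ν H (act g z)‖ ≤ ‖chr (t • ν) (act g z)‖ * (C' * q) →
      ‖F z‖ ≤ E * (p * q) := by
    intro z p q hp hq hx hy
    have hc : 0 < ‖chr (t • ν) z‖ := norm_pos_iff.mpr (chr_ne_zero _ _)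
    have hy' := hy.trans (mul_le_mul_of_nonneg_right
      (norm_chr_act_le hR h1 h2 (t • ν) (t • ν) z) (by positivity))
    rw [hF, norm_mul]
    refine (mul_le_mul hx hy' (norm_nonneg _) (by positivity)).trans (le_of_eq ?_)
    rw [hEe]
    field_simp
  have hzero : ∀ z ∈ indep, z ∉ bdd → F z = 0 := fun z hz hzb => by
    have : ¬ (sqSum z.1 ≤ 16 ∧ sqSum z.2 ≤ 16) := fun h => hzb ⟨hz, h⟩
    simp only [hF, kerL_integral_eq_zero hb₁ t l₁ ν this, zero_mul]
  have hLz := fun z hz => hL b₁ hb₁ ν hν l₁ z hz t ht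
  have hRz := fun z (hz : z ∈ indep) =>
    hR' b₂ hb₂ ν hν l₂ (act g z) ((act_mem_indep g).mpr hz) t ht
  have htriv : ∀ z ∈ indep, ‖F z‖ ≤ E := fun z hz => by
    simpa using hmul z 1 1 zero_le_one zero_le_one (by simpa using (hLz z hz).1)
      (by simpa using (hRz z hz).1)
  rw [hI]
  have hmono : ∀ {y y' : ℝ}, ‖∫ z in indep, F z‖ ≤ y' →
      y' ≤ E * (volume.real bdd + 24 ^ 3 * 8 ^ 3) * y →
      psiMass⁻¹ * ‖∫ z in indep, F z‖ ≤
        psiMass⁻¹ * (E * (volume.real bdd + 24 ^ 3 * 8 ^ 3)) * y := fun {y y'} h h' => by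
    rw [mul_assoc psiMass⁻¹]
    exact mul_le_mul_of_nonneg_left (h.trans h') (by positivity)
  -- a bound on `bdd` is a bound everywhere
  have hglobal : ∀ p : ℝ, 0 ≤ p → (∀ z ∈ bdd, ‖F z‖ ≤ p) →
      ‖∫ z in indep, F z‖ ≤ p * volume.real bdd := fun p hp h => by
    have := norm_setIntegral_indep_le (F := F) (p := p) (q := 0) (x := 1) fun z hz => ?_
    · simpa using this
    by_cases hzb : z ∈ bdd
    · simpa [hzb] using h z hzb
    · simp [hzb, hzero z hz hzb]
  refine ⟨?_, fun x hx hl₁ hl₂ => ?_⟩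
  · rw [← mul_one (psiMass⁻¹ * (E * (volume.real bdd + 24 ^ 3 * 8 ^ 3)))]
    refine hmono (hglobal E hE.le fun z hz => htriv z hz.1) ?_
    linarith
  obtain ⟨y, hy⟩ : ∃ y, y = (t * x)⁻¹ ^ n := ⟨_, rfl⟩
  have hy0 : 0 ≤ y := by rw [hy]; positivity
  rw [← hy]
  have hdec : ∀ τ, x ≤ τ → (t * τ)⁻¹ ^ n ≤ y := fun τ hτ => by
    rw [hy]
    have : 0 < τ := hx.trans_le hτ
    gcongr
  have hfarL : ∀ z ∈ indep, x ≤ tauP z → ‖F z‖ ≤ E * y := fun z hz hτ => by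
    have hA : A₁ * ‖l₁ - ν‖ ≤ tauP z :=
      ((mul_le_mul_of_nonneg_right
        (le_max_left _ _) (ContinuousLinearMap.opNorm_nonneg (l₁ - ν))).trans hl₁).trans hτ
    have h := (hLz z hz).2 (hx.trans_le hτ) hA
    have h' := hmul z ((t * tauP z)⁻¹ ^ n) 1
      (pow_nonneg (inv_nonneg.mpr (mul_nonneg ht.le (hx.le.trans hτ))) n) zero_le_one h
      (by simpa using (hRz z hz).1)
    rw [mul_one] at h'
    exact h'.trans (mul_le_mul_of_nonneg_left (hdec _ hτ) hE.le)
  have hfarR : ∀ z ∈ indep, x ≤ tauP (act g z) → ‖F z‖ ≤ E * y := fun z hz hτ => by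
    have hA : A₁' * ‖l₂ - ν‖ ≤ tauP (act g z) :=
      ((mul_le_mul_of_nonneg_right
        (le_max_right _ _) (ContinuousLinearMap.opNorm_nonneg (l₂ - ν))).trans hl₂).trans hτ
    have h := (hRz z hz).2 (hx.trans_le hτ) hA
    have h' := hmul z 1 ((t * tauP (act g z))⁻¹ ^ n) zero_le_one
      (pow_nonneg (inv_nonneg.mpr (mul_nonneg ht.le (hx.le.trans hτ))) n)
      (by simpa using (hLz z hz).1) h
    rw [one_mul] at h'
    exact h'.trans (mul_le_mul_of_nonneg_left (hdec _ hτ) hE.le)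
  have hx32 : 0 ≤ x ^ (3 / 2 : ℝ) := by positivity
  constructor
  · refine hmono (norm_setIntegral_indep_le (F := F) (p := E * y) (q := E) (x := x)
      fun z hz => ?_) ?_
    · by_cases hzb : z ∈ bdd
      · rcases le_or_gt x (tauP z) with hτ | hτ
        · refine (hfarL z hz hτ).trans ?_
          rw [indicator_of_mem hzb]
          have : 0 ≤ (near x).indicator (fun _ => E) z := indicator_nonneg (fun _ _ => hE.le) z
          linarith
        · have hzn : z ∈ near x := ⟨hzb, hτ.le⟩
          rw [indicator_of_mem hzb, indicator_of_mem hzn]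
          have := htriv z hz
          have := mul_nonneg hE.le hy0
          linarith
      · have hzn : z ∉ near x := fun h => hzb h.1
        simp [hzb, hzn, hzero z hz hzb]
    · have := mul_le_mul_of_nonneg_left (volume_near_le hx) hE.le
      have p1 := mul_nonneg (mul_nonneg hE.le hv) hx32
      have p2 := mul_nonneg hE.le hy0
      linarith
  · intro hlow
    refine hmono (hglobal (E * y) (by positivity) fun z hz => ?_) ?_
    · have h := hlow.trans (lowSq_le hR h1 h2 hz.1)
      have h' : 2 * x ≤ tauP z + tauP (act g z) := by
        refine le_of_mul_le_mul_left ?_ (show 0 < 400 * R ^ 4 by positivity)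
        linarith
      rcases le_or_gt x (tauP z) with hτ | hτ
      · exact hfarL z hz.1 hτ
      · exact hfarR z hz.1 (by linarith)
    · have p2 := mul_nonneg hE.le hy0
      linarith

/-- A Riemannian ball is bounded, together with its inverse. -/
theorem fro_le_of_near_one {g : G} (hg : leftEDist g 1 ≤ 1) :
    fro g.1 ≤ 36 * (3 * Real.exp 4) ^ 2 ∧ fro (g⁻¹).1 ≤ 36 * (3 * Real.exp 4) ^ 2 := by
  have h := fro_le_of_leftEDist_le hg
  have h0 := fro_nonneg g.1
  have h2 : fro g.1 ^ 2 ≤ (3 * Real.exp 4) ^ 2 := by gcongr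
  refine ⟨h.trans ?_, (fro_inv_le g).trans (by linarith)⟩
  have : 1 ≤ Real.exp 4 := by linarith [Real.add_one_le_exp 4]
  nlinarith

theorem one_le_radius : 1 ≤ 36 * (3 * Real.exp 4) ^ 2 := by
  have : 1 ≤ Real.exp 4 := by linarith [Real.add_one_le_exp 4]
  nlinarith

theorem rpow_mul_inv_le {t β a : ℝ} (ht : 1 ≤ t) (hβ : 1 ≤ β) {κ : ℝ} (hκ : 0 < κ) (n : ℕ) :
    (t * (κ * (t ^ (-1 + a) * β)))⁻¹ ^ n ≤ κ⁻¹ ^ n * t ^ (-(a * n)) := by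
  have ht0 : 0 < t := by linarith
  have e : t * (κ * (t ^ (-1 + a) * β)) = κ * t ^ a * β := by
    rw [Real.rpow_add ht0, Real.rpow_neg_one]
    field_simp
  have hta : 0 < t ^ a := Real.rpow_pos_of_pos ht0 _
  rw [e, Real.rpow_neg ht0.le, Real.rpow_mul ht0.le, Real.rpow_natCast, ← inv_pow, ← mul_pow,
    ← mul_inv]
  have : κ * t ^ a * 1 ≤ κ * t ^ a * β := by gcongr
  rw [mul_one] at this
  gcongr

/-- The bound valid for all `g` near the identity: pairs at distance `√x` from `M` with
`x = t^{-1+2ε/3} β` contribute the main term, the others a rapidly decaying one. -/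
theorem flatIntegral_bound (ε : ℝ) (hε : 0 < ε) : ∃ n : ℕ,
      ∀ B : Set frakADual, IsCompact B → B ⊆ regular →
      ∀ D : ℝ, ∃ C : ℝ, 0 < C ∧
      ∀ b₁ b₂ : frakA → ℂ, IsCutoff n D b₁ → IsCutoff n D b₂ →
      ∀ t β : ℝ, 1 ≤ t → 1 ≤ β →
      ∀ ν ∈ B, ∀ l₁ l₂ : frakADual, ‖l₁ - ν‖ ≤ β / t → ‖l₂ - ν‖ ≤ β / t →
      ∀ g : G, leftEDist g 1 ≤ 1 →
        ‖flatIntegral b₁ b₂ t l₁ l₂ ν g‖ ≤ C * (t ^ (-(3 / 2) + ε : ℝ) * β ^ (3 / 2 : ℝ)) := by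
  obtain ⟨n, hn⟩ := exists_nat_ge (9 / (4 * ε))
  refine ⟨n, fun B hB hBr D => ?_⟩
  obtain ⟨C₁, C₂, C, hC₁, hC₂, hC, h⟩ := exists_flatIntegral_bound hB hBr n D one_le_radius
  refine ⟨C * (C₁ ^ (3 / 2 : ℝ) + C₁⁻¹ ^ n), by positivity,
    fun b₁ b₂ hb₁ hb₂ t β ht hβ ν hν l₁ l₂ hl₁ hl₂ g hg => ?_⟩
  have ht0 : 0 < t := by linarith
  have hβ0 : 0 < β := by linarith
  have hx : ∀ y : ℝ, y ≤ β / t → C₁ * y ≤ C₁ * (t ^ (-1 + 2 * ε / 3) * β) := fun y hy => by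
    refine mul_le_mul_of_nonneg_left (hy.trans ?_) hC₁.le
    rw [div_eq_inv_mul, ← Real.rpow_neg_one]
    gcongr
    linarith
  obtain ⟨h1, h2⟩ := fro_le_of_near_one hg
  have key := ((h b₁ b₂ hb₁ hb₂ t ht0 ν hν l₁ l₂ g h1 h2).2
    (C₁ * (t ^ (-1 + 2 * ε / 3) * β)) (by positivity) (hx _ hl₁) (hx _ hl₂)).1
  refine key.trans ?_
  rw [mul_assoc]
  refine mul_le_mul_of_nonneg_left ?_ hC.le
  rw [add_mul]
  refine add_le_add (le_of_eq ?_) ((rpow_mul_inv_le ht hβ hC₁ n).trans ?_)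
  · rw [Real.mul_rpow hC₁.le (by positivity), Real.mul_rpow (by positivity) hβ0.le,
      ← Real.rpow_mul ht0.le]
    congr 3
    ring
  · refine mul_le_mul_of_nonneg_left ?_ (by positivity)
    have hb : 1 ≤ β ^ (3 / 2 : ℝ) := Real.one_le_rpow hβ (by norm_num)
    have e : t ^ (-(2 * ε / 3 * n)) ≤ t ^ (-(3 / 2) + ε) := by
      refine Real.rpow_le_rpow_of_exponent_le ht ?_
      rw [div_le_iff₀ (by positivity)] at hn
      linarith
    exact e.trans (le_mul_of_one_le_right (by positivity) hb)

/-- The rapid decay away from `MA`: there `g` or its transpose has a large entry below the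
diagonal, and transposition exchanges the roles of the two variables. -/
theorem flatIntegral_decay (ε : ℝ) (hε : 0 < ε) (A : ℝ) (hA : 0 < A) : ∃ n : ℕ,
      ∀ B : Set frakADual, IsCompact B → B ⊆ regular →
      ∀ D : ℝ, ∃ C : ℝ, 0 < C ∧
      ∀ b₁ b₂ : frakA → ℂ, IsCutoff n D b₁ → IsCutoff n D b₂ →
      ∀ t β : ℝ, 1 ≤ t → 1 ≤ β →
      ∀ ν ∈ B, ∀ l₁ l₂ : frakADual, ‖l₁ - ν‖ ≤ β / t → ‖l₂ - ν‖ ≤ β / t →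
      ∀ g : G, leftEDist g 1 ≤ 1 →
        ENNReal.ofReal (t ^ (-(1 / 2) + ε : ℝ) * β ^ (1 / 2 : ℝ)) ≤ distMA g →
        ‖flatIntegral b₁ b₂ t l₁ l₂ ν g‖ ≤ C * t ^ (-A) := by
  obtain ⟨n, hn⟩ := exists_nat_ge (A / (2 * ε))
  refine ⟨n, fun B hB hBr D => ?_⟩
  obtain ⟨C₁, C₂, C, hC₁, hC₂, hC, h⟩ := exists_flatIntegral_bound hB hBr n D one_le_radius
  obtain ⟨C₃, hC₃, hdist⟩ := exists_distMA_le
  -- with this constant, `C₂ x` is half of the lower bound for `offSq g`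
  obtain ⟨κ, hκe⟩ : ∃ κ, κ = (2 * C₃ ^ 2 * C₂)⁻¹ := ⟨_, rfl⟩
  have hκ : 0 < κ := by rw [hκe]; positivity
  have hκC : 2 * (C₃ ^ 2 * (C₂ * κ)) = 1 := by rw [hκe]; field_simp
  refine ⟨C * (κ⁻¹ ^ n + (C₁ / κ) ^ (A / (2 * ε))), by positivity,
    fun b₁ b₂ hb₁ hb₂ t β ht hβ ν hν l₁ l₂ hl₁ hl₂ g hg hd => ?_⟩
  have ht0 : 0 < t := by linarith
  have hβ0 : 0 < β := by linarith
  obtain ⟨h1, h2⟩ := fro_le_of_near_one hg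
  have tA : 0 < t ^ (-A) := Real.rpow_pos_of_pos ht0 _
  rcases lt_or_ge (t ^ (2 * ε)) (C₁ / κ) with hT | hT
  -- for bounded `t` there is nothing to gain
  · refine (h b₁ b₂ hb₁ hb₂ t ht0 ν hν l₁ l₂ g h1 h2).1.trans ?_
    have e : t ^ A ≤ (C₁ / κ) ^ (A / (2 * ε)) := by
      have e1 : t ^ A = (t ^ (2 * ε)) ^ (A / (2 * ε)) := by
        rw [← Real.rpow_mul ht0.le]
        congr 1
        field_simp
      rw [e1]
      gcongr
    have e2 : 1 ≤ (κ⁻¹ ^ n + (C₁ / κ) ^ (A / (2 * ε))) * t ^ (-A) := by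
      rw [Real.rpow_neg ht0.le, ← div_eq_mul_inv, one_le_div (Real.rpow_pos_of_pos ht0 _)]
      exact e.trans (le_add_of_nonneg_left (by positivity))
    rw [mul_assoc]
    exact le_mul_of_one_le_right hC.le e2
  set y := t ^ (-1 + 2 * ε) * β with hy
  have hy0 : 0 < y := by positivity
  have hx : ∀ u : ℝ, u ≤ β / t → C₁ * u ≤ κ * y := fun u hu => by
    have e : κ * y = (κ * t ^ (2 * ε)) * (β / t) := by
      rw [hy, Real.rpow_add ht0, Real.rpow_neg_one]
      field_simp
    rw [e]
    have e2 : C₁ ≤ κ * t ^ (2 * ε) := by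
      rw [div_le_iff₀ hκ] at hT
      linarith
    calc C₁ * u ≤ C₁ * (β / t) := by gcongr
      _ ≤ _ := by gcongr
  have hoff0 : 0 ≤ offSq g := add_nonneg (lowSq_nonneg _) (lowSq_nonneg _)
  have hoff : y ≤ C₃ ^ 2 * offSq g := by
    have h3 := hd.trans (hdist g hg)
    rw [ENNReal.ofReal_le_ofReal_iff (by positivity)] at h3
    have h4 : (t ^ (-(1 / 2) + ε : ℝ) * β ^ (1 / 2 : ℝ)) ^ 2 ≤ (C₃ * √(offSq g)) ^ 2 := by
      gcongr
    rw [mul_pow, mul_pow, Real.sq_sqrt hoff0, ← Real.rpow_natCast, ← Real.rpow_natCast (β ^ _),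
      ← Real.rpow_mul ht0.le, ← Real.rpow_mul hβ0.le] at h4
    norm_num at h4
    rw [hy]
    convert h4 using 3
    ring
  have hlow : C₂ * (κ * y) ≤ lowSq g ∨ C₂ * (κ * y) ≤ lowSq (trG g) := by
    by_contra! hcon
    have h5 : offSq g < 2 * (C₂ * (κ * y)) := by
      rw [offSq]
      linarith [hcon.1, hcon.2]
    have h6 : C₃ ^ 2 * offSq g < C₃ ^ 2 * (2 * (C₂ * (κ * y))) := by gcongr
    have h7 : C₃ ^ 2 * (2 * (C₂ * (κ * y))) = y := by
      calc _ = (2 * (C₃ ^ 2 * (C₂ * κ))) * y := by ring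
        _ = y := by rw [hκC, one_mul]
    linarith
  have hfin : C * (t * (κ * y))⁻¹ ^ n ≤ C * (κ⁻¹ ^ n + (C₁ / κ) ^ (A / (2 * ε))) * t ^ (-A) := by
    rw [mul_assoc]
    refine mul_le_mul_of_nonneg_left ((rpow_mul_inv_le ht hβ hκ n).trans ?_) hC.le
    have e : t ^ (-(2 * ε * n)) ≤ t ^ (-A) := by
      refine Real.rpow_le_rpow_of_exponent_le ht ?_
      rw [div_le_iff₀ (by positivity)] at hn
      linarith
    exact mul_le_mul (le_add_of_nonneg_right (by positivity)) e (by positivity) (by positivity)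
  refine le_trans ?_ hfin
  rcases hlow with hl | hl
  · exact ((h b₁ b₂ hb₁ hb₂ t ht0 ν hν l₁ l₂ g h1 h2).2 (κ * y) (by positivity)
      (hx _ hl₁) (hx _ hl₂)).2 hl
  · rw [flatIntegral_trG hb₁ hb₂]
    have h1' : fro (trG g).1 ≤ 36 * (3 * Real.exp 4) ^ 2 := by rwa [fro_trG]
    have h2' : fro ((trG g)⁻¹).1 ≤ 36 * (3 * Real.exp 4) ^ 2 := by rwa [trG_inv, fro_trG]
    exact ((h _ _ hb₂.neg hb₁.neg t ht0 ν hν l₂ l₁ (trG g) h1' h2').2 (κ * y) (by positivity)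
      (hx _ hl₂) (hx _ hl₁)).2 hl

end FlatSL3

end

theorem mainTheorem5 :
    -- the bound valid for all `g` near the identity
    (∀ ε : ℝ, 0 < ε → ∃ n : ℕ,
      ∀ B : Set FlatSL3.frakADual, IsCompact B → B ⊆ FlatSL3.regular →
      ∀ D : ℝ, ∃ C : ℝ, 0 < C ∧
      ∀ b₁ b₂ : FlatSL3.frakA → ℂ, FlatSL3.IsCutoff n D b₁ → FlatSL3.IsCutoff n D b₂ →
      ∀ t β : ℝ, 1 ≤ t → 1 ≤ β → β ≤ t ^ (1 / 2 : ℝ) →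
      ∀ ν ∈ B, ∀ l₁ ∈ B, ∀ l₂ ∈ B, ‖l₁ - ν‖ ≤ β / t → ‖l₂ - ν‖ ≤ β / t →
      ∀ g : FlatSL3.G, FlatSL3.leftEDist g 1 ≤ 1 →
        ‖FlatSL3.flatIntegral b₁ b₂ t l₁ l₂ ν g‖
          ≤ C * (t ^ (-(3 / 2) + ε : ℝ) * β ^ (3 / 2 : ℝ))) ∧
    -- the rapid decay for `g` away from `MA`
    (∀ ε : ℝ, 0 < ε → ∀ A : ℝ, 0 < A → ∃ n : ℕ,
      ∀ B : Set FlatSL3.frakADual, IsCompact B → B ⊆ FlatSL3.regular →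
      ∀ D : ℝ, ∃ C : ℝ, 0 < C ∧
      ∀ b₁ b₂ : FlatSL3.frakA → ℂ, FlatSL3.IsCutoff n D b₁ → FlatSL3.IsCutoff n D b₂ →
      ∀ t β : ℝ, 1 ≤ t → 1 ≤ β → β ≤ t ^ (1 / 2 : ℝ) →
      ∀ ν ∈ B, ∀ l₁ ∈ B, ∀ l₂ ∈ B, ‖l₁ - ν‖ ≤ β / t → ‖l₂ - ν‖ ≤ β / t →
      ∀ g : FlatSL3.G, FlatSL3.leftEDist g 1 ≤ 1 →
        ENNReal.ofReal (t ^ (-(1 / 2) + ε : ℝ) * β ^ (1 / 2 : ℝ)) ≤ FlatSL3.distMA g →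
        ‖FlatSL3.flatIntegral b₁ b₂ t l₁ l₂ ν g‖ ≤ C * t ^ (-A)) := by
  refine ⟨fun ε hε => ?_, fun ε hε A hA => ?_⟩
  · obtain ⟨n, hn⟩ := FlatSL3.flatIntegral_bound ε hε
    refine ⟨n, fun B hB hBr D => ?_⟩
    obtain ⟨C, hC, h⟩ := hn B hB hBr D
    exact ⟨C, hC, fun b₁ b₂ hb₁ hb₂ t β ht hβ _ ν hν l₁ _ l₂ _ hl₁ hl₂ =>
      h b₁ b₂ hb₁ hb₂ t β ht hβ ν hν l₁ l₂ hl₁ hl₂⟩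
  · obtain ⟨n, hn⟩ := FlatSL3.flatIntegral_decay ε hε A hA
    refine ⟨n, fun B hB hBr D => ?_⟩
    obtain ⟨C, hC, h⟩ := hn B hB hBr D
    exact ⟨C, hC, fun b₁ b₂ hb₁ hb₂ t β ht hβ _ ν hν l₁ _ l₂ _ hl₁ hl₂ =>
      h b₁ b₂ hb₁ hb₂ t β ht hβ ν hν l₁ l₂ hl₁ hl₂⟩
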